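/- Let $n\ge 3$ and let $B_r(x)\subset\mathbb R^n$ be the open ball, $B_r=B_r(0)$. For a Lebesgue measurable set $E\subset\mathbb R^n$ let $P(E)=\sup\{\int_E \operatorname{div}T\,dx : T\in C^1_c(\mathbb R^n;\mathbb R^n),\ |T|\le 1\}\in[0,\infty]$ be its perimeter; $E$ is a set of finite perimeter if $P(E)<\infty$. Let $D^1(\mathbb R^n)$ be the closure of $C_c^\infty(\mathbb R^n)$ in the norm $\|\nabla\varphi\|_{L^2}$, regarded as a space of functions in $L^{2n/(n-2)}(\mathbb R^n)$ by means of the Sobolev inequality. For $\beta\ge 1$ and $K>0$ put $a_E=\mathbf 1_{E^c}+\beta\mathbf 1_E$, let $\mathcal A(E)$ be the set of pairs $(u,\rho)\in D^1(\mathbb R^n)\times L^2(\mathbb R^n)$ with $\rho\mathbf 1_{E^c}=0$ a.e., $\int\rho\,dx=1$ and $-\operatorname{div}(a_E\nabla u)=\rho$ in $\mathcal D'(\mathbb R^n)$, and let $$\mathcal G_{\beta,K}(E)=\inf_{(u,\rho)\in\mathcal A(E)}\Big\{\int_{\mathbb R^n}a_E|\nabla u|^2\,dx+K\int_E\rho^2\,dx\Big\},\qquad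 \mathcal F_{\beta,K,Q}(E)=P(E)+Q^2\,\mathcal G_{\beta,K}(E).$$ **Proposition.** Let $n\ge3$ and $A>0$. There exist constants $\Lambda_2>0$ and $\bar r_2>0$, depending only on $n$ and $A$, with the following property. Let $\beta\ge1$, $K>0$ and $Q\ge0$ satisfy $\beta+K+\frac1K+Q\le A$, let $R\ge1$, and let $E$ be any minimizer of $$\min\{\mathcal F_{\beta,K,Q}(E): E \text{ measurable},\ |E|=|B_1|,\ E\subset B_R\}.$$ Then a pair $(u_E,\rho_E)\in\mathcal A(E)$ attaining the infimum $\mathcal G_{\beta,K}(E)$ exists, and for every such pair: (i) for every set of finite perimeter $F\subseteq E$ with $E\setminus F\subset B_r(x)$ for some $x\in\mathbb R^n$ and $r\le\bar r_2$, $$P(E)\le P(F)+\Lambda_2|E\setminus F|+\Lambda_2Q^2\int_{E\setminus F}|\nabla u_E|^2\,dx;$$ (ii) for every set of finite perimeter $F\supseteq E$ (not necessarily contained in $B_R$) with $F\setminus E\subset B_r(x)$ for some $x\in\mathbb R^n$ and $r\le\bar r_2$, $$P(E)\le P(F)+\Lambda_2|F\setminus E|.$$ In particular, for every set of finite perimeter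 $F$ with $E\Delta F\subset B_r(x)$ for some $x\in\mathbb R^n$ and $r\le\bar r_2$, $$P(E)\le P(F)+\Lambda_2|E\Delta F|+\Lambda_2Q^2\int_{E\Delta F}|\nabla u_E|^2\,dx.$$ -/

import Mathlib

open MeasureTheory Filter Topology
open scoped ENNReal ContDiff

noncomputable section

namespace ChargedDroplet

/-- Euclidean space `ℝⁿ` with its Euclidean norm. -/
abbrev Rn (n : ℕ) : Type := EuclideanSpace ℝ (Fin n)

/-- The divergence of a vector field. -/
def divergence {n : ℕ} (T : Rn n → Rn n) (x : Rn n) : ℝ :=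
  ∑ i : Fin n, (fderiv ℝ T x (EuclideanSpace.single i (1 : ℝ))) i

/-- The (De Giorgi) perimeter `P(E)`: the supremum of `∫_E div T` over all
`T ∈ C_c^1(ℝⁿ; ℝⁿ)` with `|T| ≤ 1`. -/
def perimeter {n : ℕ} (E : Set (Rn n)) : ℝ≥0∞ :=
  ⨆ (T : Rn n → Rn n) (_ : ContDiff ℝ 1 T) (_ : HasCompactSupport T) (_ : ∀ x, ‖T x‖ ≤ 1),
    ENNReal.ofReal (∫ x in E, divergence T x)

/-- Lebesgue measurable sets of finite perimeter. -/
def IsFinitePerimeter {n : ℕ} (E : Set (Rn n)) : Prop :=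
  NullMeasurableSet E volume ∧ perimeter E < ⊤

/-- Test functions: `φ ∈ C_c^∞(ℝⁿ)`. -/
def IsTestFunction {n : ℕ} (φ : Rn n → ℝ) : Prop :=
  ContDiff ℝ ∞ φ ∧ HasCompactSupport φ

/-- `g` is the weak (distributional) gradient of `u`. -/
def IsWeakGradient {n : ℕ} (u : Rn n → ℝ) (g : Rn n → Rn n) : Prop :=
  LocallyIntegrable u volume ∧ LocallyIntegrable g volume ∧
    ∀ φ : Rn n → ℝ, IsTestFunction φ → ∫ x, u x • gradient φ x = -∫ x, φ x • g x

/-- The critical Sobolev exponent `2* = 2n/(n-2)` (used for `n ≥ 3`). -/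
def sobolevExponent (n : ℕ) : ℝ≥0∞ := ENNReal.ofReal (2 * (n : ℝ) / ((n : ℝ) - 2))

/-- `u ∈ D¹(ℝⁿ)` with `∇u = g`: the closure of `C_c^∞(ℝⁿ)` in the norm `‖∇φ‖_{L²}`, realized as
a space of functions (and not of functions modulo constants) through the Sobolev embedding
into `L^{2*}`. -/
structure MemD1 {n : ℕ} (u : Rn n → ℝ) (g : Rn n → Rn n) : Prop where
  memLp : MemLp u (sobolevExponent n) volume
  gradient_memLp : MemLp g 2 volume
  isWeakGradient : IsWeakGradient u g
  mem_closure : ∃ φ : ℕ → Rn n → ℝ, (∀ k, IsTestFunction (φ k)) ∧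
    Tendsto (fun k => eLpNorm (fun x => gradient (φ k) x - g x) 2 volume) atTop (𝓝 0)

/-- The permittivity `a_E = 1_{Eᶜ} + β 1_E`. -/
def permittivity {n : ℕ} (β : ℝ) (E : Set (Rn n)) (x : Rn n) : ℝ :=
  Eᶜ.indicator (fun _ => (1 : ℝ)) x + β * E.indicator (fun _ => (1 : ℝ)) x

/-- The class `𝒜(E)` of admissible pairs `(u, ρ)`, where `g` records `∇u`:
`u ∈ D¹(ℝⁿ)`, `ρ ∈ L²(ℝⁿ)`, `ρ = 0` a.e. outside `E`, `∫ ρ = 1`, and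
`-div (a_E ∇u) = ρ` in the sense of distributions. -/
structure Admissible {n : ℕ} (β : ℝ) (E : Set (Rn n))
    (u : Rn n → ℝ) (g : Rn n → Rn n) (ρ : Rn n → ℝ) : Prop where
  memD1 : MemD1 u g
  memLp : MemLp ρ 2 volume
  eq_zero : ∀ᵐ x ∂(volume : Measure (Rn n)), x ∉ E → ρ x = 0
  integral_eq_one : ∫ x, ρ x = 1
  equation : ∀ φ : Rn n → ℝ, IsTestFunction φ →
    ∫ x, permittivity β E x * inner ℝ (g x) (gradient φ x) = ∫ x, ρ x * φ x

/-- The electrostatic energy `∫ a_E |∇u|² + K ∫_E ρ²` of a pair, with `g = ∇u`. -/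
def electricEnergy {n : ℕ} (β K : ℝ) (E : Set (Rn n)) (g : Rn n → Rn n) (ρ : Rn n → ℝ) : ℝ≥0∞ :=
  (∫⁻ x, ENNReal.ofReal (permittivity β E x * ‖g x‖ ^ 2)) +
    ENNReal.ofReal K * ∫⁻ x in E, ENNReal.ofReal (ρ x ^ 2)

/-- `𝒢_{β,K}(E)`, the infimum of the electrostatic energy over the admissible pairs. -/
def G {n : ℕ} (β K : ℝ) (E : Set (Rn n)) : ℝ≥0∞ :=
  ⨅ (u : Rn n → ℝ) (g : Rn n → Rn n) (ρ : Rn n → ℝ) (_ : Admissible β E u g ρ),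
    electricEnergy β K E g ρ

/-- `(u, ρ)` is a minimizing pair for `𝒢_{β,K}(E)`, that is `(u, ρ) = (u_E, ρ_E)`,
with `g = ∇u_E`. -/
def IsMinimizingPair {n : ℕ} (β K : ℝ) (E : Set (Rn n))
    (u : Rn n → ℝ) (g : Rn n → Rn n) (ρ : Rn n → ℝ) : Prop :=
  Admissible β E u g ρ ∧ electricEnergy β K E g ρ = G β K E

/-- The free energy `ℱ_{β,K,Q}(E) = P(E) + Q² 𝒢_{β,K}(E)`. -/
def freeEnergy {n : ℕ} (β K Q : ℝ) (E : Set (Rn n)) : ℝ≥0∞ :=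
  perimeter E + ENNReal.ofReal (Q ^ 2) * G β K E

/-- The competitors: Lebesgue measurable sets `E ⊆ B_R` with `|E| = |B_1|`. -/
def IsCompetitor {n : ℕ} (R : ℝ) (E : Set (Rn n)) : Prop :=
  NullMeasurableSet E volume ∧ E ⊆ Metric.ball 0 R ∧
    volume E = volume (Metric.ball (0 : Rn n) 1)

/-- `E` solves `min {ℱ_{β,K,Q}(E) : |E| = |B_1|, E ⊆ B_R}`. -/
def IsMinimizer {n : ℕ} (β K Q R : ℝ) (E : Set (Rn n)) : Prop :=
  IsCompetitor R E ∧ ∀ F : Set (Rn n), IsCompetitor R F → freeEnergy β K Q E ≤ freeEnergy β K Q F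

/-- `β, K, Q` are controlled by `A` (the parameters being a permittivity `β ≥ 1`, a physical
constant `K > 0` and a charge `Q ≥ 0`). -/
def ControlledBy (A β K Q : ℝ) : Prop :=
  1 ≤ β ∧ 0 < K ∧ 0 ≤ Q ∧ β + K + 1 / K + Q ≤ A

end ChargedDroplet

end

/-!
The two ingredients are a family of perimeter comparisons that need no structure theory for sets of
finite perimeter, and a dual description of the electrostatic energy.

*Perimeter.* Testing the perimeter with a field `T` modified by a smooth radial cutoff compares the
perimeters of `E` and of `E ∪ B` or `E ∩ B` for a ball `B`. Filling a ball of radius `s` costs at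
most `n / s` times the added volume (`perimeter_union_ball_le`), because the field `(x - z) / s`
calibrates the sphere. Intersecting a bounded set with a ball centred at the origin costs nothing
(`perimeter_inter_ball_le`), and neither does shrinking (`perimeter_smul_le`).

*Electrostatics.* By duality `G β K E` is the reciprocal of the infimum `capacity β K E` of
`∫ a_E |∇φ|² + K⁻¹ ∫_E (1 - φ)²` over test functions (`G_eq_inv_capacity`). The capacity is monotone
in `E`, it is bounded below at the volume of the unit ball (`exists_le_capacity`), and it scales like
a volume at worst (`pow_mul_capacity_le_capacity_smul`). Moreover the distance of a competitor `φ`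
to the rescaled minimizing pair is exactly its excess (`IsMinimizingPair.energyForm_sub`). So when
`E \ F` is removed from `E`, the loss `(β - 1) ∫_{E \ F} |∇φ|²` is absorbed by the excess, up to a
multiple of `∫_{E \ F} |∇u_E|²`, and the zero-order loss is at most a multiple of `|E \ F|` since
competitors may be truncated (`exists_capacity_sub_le`).

*Comparison.* A set `F ⊆ B_R` with `|F| ≥ |B_1|` becomes a competitor after shrinking, which changes
the capacity at most by a multiple of the excess volume (`IsMinimizer.perimeter_le_of_volume_le`).
Sets that leave `B_R` are first intersected with it. This settles outer perturbations. Applied to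
`E ∪ B`, it makes `E` minimal under adding balls up to a volume term, and a De Giorgi type iteration,
started from a ball that `E` nearly fills (`exists_ball_diff_le`), gives a ball of radius `s₀`,
depending only on `n` and `A`, that is contained in `E` up to a null set
(`exists_radius_ball_ae_subset`). For a general perturbation `F`, too small a volume is
restored by adding to `F` a ball of radius at least `s₀` inside `B_R`, chosen from a continuous
nested family starting with the ball found in `E` (`exists_ball_fill`). This adds at most the volume
`|E \ F|` and costs at most `n / s₀` per unit of volume. The perturbation may have any size,
so any positive `r₂` works.
-/

namespace ChargedDroplet

open scoped Pointwise

/-! ### Vector fields and the divergence -/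

/-- The vector fields over which the perimeter is a supremum: `T ∈ C_c^1` with `|T| ≤ 1`. -/
structure IsUnitField {n : ℕ} (T : Rn n → Rn n) : Prop where
  contDiff : ContDiff ℝ 1 T
  hasCompactSupport : HasCompactSupport T
  norm_le : ∀ x, ‖T x‖ ≤ 1

section Divergence

variable {n : ℕ} {T S : Rn n → Rn n} {f : Rn n → ℝ} {x : Rn n}

lemma divergence_add (hT : DifferentiableAt ℝ T x) (hS : DifferentiableAt ℝ S x) :
    divergence (fun y => T y + S y) x = divergence T x + divergence S x := by
  simp [divergence, fderiv_fun_add hT hS, Finset.sum_add_distrib]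

lemma divergence_sub (hT : DifferentiableAt ℝ T x) (hS : DifferentiableAt ℝ S x) :
    divergence (fun y => T y - S y) x = divergence T x - divergence S x := by
  simp [divergence, fderiv_fun_sub hT hS, Finset.sum_sub_distrib]

lemma divergence_neg : divergence (fun y => -T y) x = -divergence T x := by
  simp [divergence, fderiv_fun_neg, Finset.sum_neg_distrib]

lemma sum_smul_single (v : Rn n) : ∑ i : Fin n, v i • EuclideanSpace.single i (1 : ℝ) = v := by
  ext j
  simp [Finset.sum_apply, Pi.single_apply]

lemma divergence_smul (hf : DifferentiableAt ℝ f x) (hT : DifferentiableAt ℝ T x) :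
    divergence (fun y => f y • T y) x = f x * divergence T x + fderiv ℝ f x (T x) := by
  have h : fderiv ℝ f x (T x) = ∑ i : Fin n, T x i * fderiv ℝ f x (EuclideanSpace.single i 1) := by
    conv_lhs => rw [← sum_smul_single (T x)]
    simp
  simp [divergence, fderiv_fun_smul hf hT, Finset.sum_add_distrib, h, Finset.mul_sum, mul_comm]

lemma divergence_const_smul_sub (c : ℝ) (z x : Rn n) :
    divergence (fun y => c • (y - z)) x = c * n := by
  have : fderiv ℝ (fun y : Rn n => c • (y - z)) x = c • ContinuousLinearMap.id ℝ _ := by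
    rw [fderiv_fun_const_smul (by fun_prop)]
    simp [fderiv_sub_const]
  simp [divergence, this, mul_comm]

lemma divergence_const_smul (c : ℝ) (T : Rn n → Rn n) (x : Rn n) :
    divergence (fun y => T (c • y)) x = c * divergence T (c • x) := by
  simp [divergence, fderiv_comp_smul, Finset.mul_sum]

lemma continuous_divergence (hT : ContDiff ℝ 1 T) : Continuous (divergence T) := by
  unfold divergence
  have := hT.continuous_fderiv one_ne_zero
  fun_prop

lemma hasCompactSupport_divergence (hT : HasCompactSupport T) :
    HasCompactSupport (divergence T) := by
  refine (hT.fderiv (𝕜 := ℝ)).mono' fun y hy => ?_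
  by_contra h
  apply hy
  have : fderiv ℝ T y = 0 := image_eq_zero_of_notMem_tsupport h
  simp [divergence, this]

lemma integrable_divergence (hT : ContDiff ℝ 1 T) (hc : HasCompactSupport T) :
    Integrable (divergence T) :=
  (continuous_divergence hT).integrable_of_hasCompactSupport (hasCompactSupport_divergence hc)

lemma integral_divergence_eq_zero (hT : ContDiff ℝ 1 T) (hc : HasCompactSupport T) :
    ∫ x, divergence T x = 0 := by
  have hd := hT.continuous_fderiv one_ne_zero
  have hcoord : ∀ (i : Fin n) (v : Rn n), Integrable (fun x => (fderiv ℝ T x v) i) := by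
    intro i v
    refine Continuous.integrable_of_hasCompactSupport (by fun_prop) ?_
    refine (hc.fderiv (𝕜 := ℝ)).mono fun y hy => ?_
    contrapose! hy
    simp only [Function.mem_support, not_not] at hy ⊢
    simp [hy]
  unfold divergence
  rw [integral_finsetSum _ (fun i _ => hcoord i _)]
  refine Finset.sum_eq_zero fun i _ => ?_
  have hTi : ∀ x, HasFDerivAt (fun y => T y i) ((EuclideanSpace.proj i).comp (fderiv ℝ T x)) x :=
    fun x => (EuclideanSpace.proj (𝕜 := ℝ) i).hasFDerivAt.comp x
      ((hT.differentiable one_ne_zero) x).hasFDerivAt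
  have hfd : ∀ x v, fderiv ℝ (fun y => T y i) x v = (fderiv ℝ T x v) i := by
    intro x v
    rw [(hTi x).fderiv]; rfl
  have hint : Integrable (fun x => T x i) := by
    refine Continuous.integrable_of_hasCompactSupport
      (by have := hT.continuous; fun_prop) ?_
    refine hc.mono fun y hy => ?_
    contrapose! hy
    simp only [Function.mem_support, not_not] at hy ⊢
    simp [hy]
  have := integral_mul_fderiv_eq_neg_fderiv_mul_of_integrable (μ := (volume : Measure (Rn n)))
    (f := fun x => T x i) (g := fun _ => (1 : ℝ)) (v := EuclideanSpace.single i 1)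
    (by simpa [hfd] using hcoord i _) (by simp) (by simpa using hint)
    (fun x _ => (hTi x).differentiableAt) (fun x _ => by fun_prop)
  simpa [hfd] using this.symm

end Divergence

section Perimeter

variable {n : ℕ} {E F : Set (Rn n)}

lemma IsUnitField.zero : IsUnitField (fun _ : Rn n => (0 : Rn n)) :=
  ⟨contDiff_const, HasCompactSupport.zero, by simp⟩

lemma IsUnitField.neg {T : Rn n → Rn n} (hT : IsUnitField T) : IsUnitField (fun x => -T x) :=
  ⟨hT.contDiff.neg, hT.hasCompactSupport.neg, by simpa using hT.norm_le⟩

lemma perimeter_le_iff {c : ℝ≥0∞} :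
    perimeter E ≤ c ↔ ∀ T, IsUnitField T → ENNReal.ofReal (∫ x in E, divergence T x) ≤ c := by
  unfold perimeter
  simp only [iSup_le_iff]
  exact ⟨fun h T hT => h T hT.1 hT.2 hT.3, fun h T h1 h2 h3 => h T ⟨h1, h2, h3⟩⟩

lemma perimeter_le_ofReal {c : ℝ}
    (h : ∀ T, IsUnitField T → ∫ x in E, divergence T x ≤ c) : perimeter E ≤ ENNReal.ofReal c :=
  perimeter_le_iff.2 fun T hT => ENNReal.ofReal_le_ofReal (h T hT)

lemma integral_divergence_le (hE : perimeter E ≠ ⊤) {T : Rn n → Rn n} (hT : IsUnitField T) :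
    ∫ x in E, divergence T x ≤ (perimeter E).toReal :=
  (ENNReal.ofReal_le_iff_le_toReal hE).1 (perimeter_le_iff.1 le_rfl T hT)

lemma toReal_perimeter_le {c : ℝ}
    (h : ∀ T, IsUnitField T → ∫ x in E, divergence T x ≤ c) : (perimeter E).toReal ≤ c := by
  have h0 : 0 ≤ c := by simpa [divergence] using h _ IsUnitField.zero
  exact ENNReal.toReal_le_of_le_ofReal h0 (perimeter_le_ofReal h)

lemma perimeter_congr (h : E =ᵐ[volume] F) : perimeter E = perimeter F := by
  simp only [perimeter, Measure.restrict_congr_set h]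

@[simp] lemma perimeter_empty : perimeter (∅ : Set (Rn n)) = 0 := by
  simp [perimeter]

/-- For bounded sets the compact support of the test fields is irrelevant. -/
lemma integral_divergence_le_of_isBounded (hE : perimeter E ≠ ⊤) (hm : NullMeasurableSet E)
    (hb : Bornology.IsBounded E) {T : Rn n → Rn n} (hT : ContDiff ℝ 1 T) (h1 : ∀ x, ‖T x‖ ≤ 1) :
    ∫ x in E, divergence T x ≤ (perimeter E).toReal := by
  obtain ⟨r, hr, hE'⟩ := hb.subset_ball_lt 0 (0 : Rn n)
  let χ : ContDiffBump (0 : Rn n) := ⟨r, r + 1, hr, by linarith⟩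
  have hU : IsUnitField (fun x => χ x • T x) := by
    refine ⟨χ.contDiff.smul hT, χ.hasCompactSupport.smul_right, fun x => ?_⟩
    rw [norm_smul, Real.norm_of_nonneg χ.nonneg]
    exact mul_le_one₀ χ.le_one (norm_nonneg _) (h1 x)
  have heq : ∀ x ∈ E, divergence (fun x => χ x • T x) x = divergence T x := by
    intro x hx
    have : (fun x => χ x • T x) =ᶠ[𝓝 x] T := by
      filter_upwards [Metric.isOpen_ball.mem_nhds (hE' hx)] with y hy
      rw [χ.one_of_mem_closedBall (Metric.ball_subset_closedBall hy), one_smul]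
    simp [divergence, this.fderiv_eq]
  have h2 := integral_divergence_le hE hU
  have h3 : ∀ᵐ x ∂(volume.restrict E), divergence (fun x => χ x • T x) x = divergence T x :=
    (ae_restrict_iff'₀ hm).2 (ae_of_all _ heq)
  rwa [integral_congr_ae h3] at h2

/-- Shrinking does not increase the perimeter: the perimeter of `c • E` is `c ^ (n - 1)` times
that of `E`. -/
lemma perimeter_smul_le {c : ℝ} (hc : 0 < c) (hc1 : c ≤ 1) (hn : 1 ≤ n) :
    perimeter (c • E) ≤ perimeter E := by
  refine perimeter_le_iff.2 fun T hT => ?_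
  have hU : IsUnitField (fun x => T (c • x)) := by
    refine ⟨hT.contDiff.comp (contDiff_const_smul c), ?_, fun x => hT.norm_le _⟩
    exact hT.hasCompactSupport.comp_homeomorph (Homeomorph.smulOfNeZero c hc.ne')
  refine le_trans ?_ (perimeter_le_iff.1 le_rfl _ hU)
  have h := Measure.setIntegral_comp_smul_of_pos (volume : Measure (Rn n)) (divergence T) E hc
  have h2 : ∫ x in c • E, divergence T x = c ^ n * ∫ x in E, divergence T (c • x) := by
    rw [h, finrank_euclideanSpace_fin, smul_eq_mul, mul_inv_cancel_left₀ (by positivity)]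
  simp only [divergence_const_smul]
  rw [integral_const_mul, h2]
  obtain ⟨k, rfl⟩ : ∃ k, n = k + 1 := ⟨n - 1, by omega⟩
  rw [pow_succ, mul_assoc]
  by_cases hpos : 0 ≤ c * ∫ x in E, divergence T (c • x)
  · exact ENNReal.ofReal_le_ofReal (mul_le_of_le_one_left hpos (pow_le_one₀ hc.le hc1))
  · rw [ENNReal.ofReal_of_nonpos]
    · exact zero_le
    · exact mul_nonpos_of_nonneg_of_nonpos (by positivity) (by linarith)

end Perimeter

/-! ### Radial cutoff functions -/

lemma exists_deriv_smoothTransition_bound : ∃ L : ℝ, 0 < L ∧ ∀ t : ℝ,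
    0 ≤ deriv Real.smoothTransition t ∧ deriv Real.smoothTransition t ≤ L ∧
      ((t ≤ 0 ∨ 1 ≤ t) → deriv Real.smoothTransition t = 0) := by
  have hS : ContDiff ℝ 1 Real.smoothTransition := Real.smoothTransition.contDiff (n := 1)
  have hc : Continuous (deriv Real.smoothTransition) := hS.continuous_deriv_one
  have h0 : ∀ t, 0 ≤ deriv Real.smoothTransition t := fun t =>
    Real.smoothTransition.monotone.deriv_nonneg
  -- at the two endpoints the derivative vanishes because they are extremal points
  have hz : ∀ t : ℝ, (t ≤ 0 ∨ 1 ≤ t) → deriv Real.smoothTransition t = 0 := by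
    rintro t (ht | ht)
    · refine IsLocalMin.deriv_eq_zero (Eventually.of_forall fun y => ?_)
      rw [Real.smoothTransition.zero_of_nonpos ht]
      exact Real.smoothTransition.nonneg y
    · refine IsLocalMax.deriv_eq_zero (Eventually.of_forall fun y => ?_)
      rw [Real.smoothTransition.one_of_one_le ht]
      exact Real.smoothTransition.le_one y
  obtain ⟨C, hC⟩ := isCompact_Icc.exists_bound_of_continuousOn (s := Set.Icc (0 : ℝ) 1)
    hc.continuousOn
  refine ⟨max C 1, by positivity, fun t => ⟨h0 t, ?_, hz t⟩⟩
  by_cases ht : t ∈ Set.Icc (0 : ℝ) 1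
  · exact (le_abs_self _).trans ((hC t ht).trans (le_max_left _ _))
  · rw [hz t]
    · positivity
    · by_contra! h
      exact ht ⟨h.1.le, h.2.le⟩

/-- A smooth radial cutoff between the balls of radius `√(s² - ε)` and `s` around `z`. -/
noncomputable def radialCutoff {n : ℕ} (z : Rn n) (s ε : ℝ) (x : Rn n) : ℝ :=
  Real.smoothTransition ((s ^ 2 - ‖x - z‖ ^ 2) / ε)

section Cutoff

variable {n : ℕ} {z x : Rn n} {s ε : ℝ}

lemma contDiff_radialCutoff {k : ℕ∞} : ContDiff ℝ k (radialCutoff z s ε) := by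
  refine Real.smoothTransition.contDiff.comp ?_
  exact (contDiff_const.sub ((contDiff_id.sub contDiff_const).norm_sq ℝ)).div_const _

lemma radialCutoff_nonneg : 0 ≤ radialCutoff z s ε x := Real.smoothTransition.nonneg _

lemma radialCutoff_le_one : radialCutoff z s ε x ≤ 1 := Real.smoothTransition.le_one _

lemma radialCutoff_eq_zero (hs : 0 < s) (hε : 0 < ε) (hx : x ∉ Metric.ball z s) :
    radialCutoff z s ε x = 0 := by
  rw [Metric.mem_ball, dist_eq_norm, not_lt] at hx
  refine Real.smoothTransition.zero_of_nonpos (div_nonpos_of_nonpos_of_nonneg ?_ hε.le)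
  nlinarith

lemma radialCutoff_eq_one (hε : 0 < ε) (hx : ‖x - z‖ ^ 2 ≤ s ^ 2 - ε) :
    radialCutoff z s ε x = 1 := by
  refine Real.smoothTransition.one_of_one_le ?_
  rw [le_div_iff₀ hε]
  linarith

lemma fderiv_radialCutoff (v : Rn n) : fderiv ℝ (radialCutoff z s ε) x v =
    -(2 / ε * deriv Real.smoothTransition ((s ^ 2 - ‖x - z‖ ^ 2) / ε)) * inner ℝ (x - z) v := by
  have h1 : HasFDerivAt (fun y : Rn n => (s ^ 2 - ‖y - z‖ ^ 2) / ε)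
      (ε⁻¹ • (-((2 : ℝ) • innerSL ℝ (x - z)))) x := by
    have h2 := ((hasFDerivAt_id (𝕜 := ℝ) x).sub_const z).norm_sq
    have h3 := (h2.const_sub (s ^ 2)).const_mul ε⁻¹
    refine (h3.congr_of_eventuallyEq (Eventually.of_forall fun y => ?_)).congr_fderiv ?_
    · simp [div_eq_inv_mul]
    · ext v
      simp
  have hd : DifferentiableAt ℝ Real.smoothTransition ((s ^ 2 - ‖x - z‖ ^ 2) / ε) :=
    ((Real.smoothTransition.contDiff (n := 1)).differentiable one_ne_zero) _
  have h4 : HasFDerivAt (radialCutoff z s ε) _ x := hd.hasDerivAt.comp_hasFDerivAt x h1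
  rw [h4.fderiv]
  simp [inner_sub_left]
  ring

lemma tendsto_radialCutoff (hs : 0 < s) (x : Rn n) :
    Tendsto (fun ε => radialCutoff z s ε x) (𝓝[>] 0)
      (𝓝 ((Metric.ball z s).indicator (fun _ => (1 : ℝ)) x)) := by
  by_cases hx : x ∈ Metric.ball z s
  · rw [Set.indicator_of_mem hx]
    rw [Metric.mem_ball, dist_eq_norm] at hx
    have hpos : 0 < s ^ 2 - ‖x - z‖ ^ 2 := by nlinarith [norm_nonneg (x - z)]
    refine tendsto_const_nhds.congr' ?_
    filter_upwards [Ioo_mem_nhdsGT hpos] with ε hε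
    rw [radialCutoff_eq_one hε.1 (by linarith [hε.2])]
  · rw [Set.indicator_of_notMem hx]
    refine tendsto_const_nhds.congr' ?_
    filter_upwards [self_mem_nhdsWithin] with ε hε
    rw [radialCutoff_eq_zero hs hε hx]

/-- The shell that carries the gradient of `radialCutoff z s ε`. -/
def shell {n : ℕ} (z : Rn n) (s ε : ℝ) : Set (Rn n) :=
  {x | s ^ 2 - ε < ‖x - z‖ ^ 2} ∩ Metric.ball z s

lemma measurableSet_shell : MeasurableSet (shell z s ε) :=
  (measurableSet_lt measurable_const (by fun_prop)).inter Metric.isOpen_ball.measurableSet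

lemma deriv_smoothTransition_eq_zero_of_notMem_shell (hs : 0 < s) (hε : 0 < ε)
    (hx : x ∉ shell z s ε) :
    deriv Real.smoothTransition ((s ^ 2 - ‖x - z‖ ^ 2) / ε) = 0 := by
  obtain ⟨L, -, hL⟩ := exists_deriv_smoothTransition_bound
  refine (hL _).2.2 ?_
  by_contra! h
  have h1 := h.1
  have h2 := h.2
  rw [div_lt_one hε] at h2
  rw [div_pos_iff_of_pos_right hε] at h1
  refine hx ⟨show s ^ 2 - ε < ‖x - z‖ ^ 2 by linarith, ?_⟩
  rw [Metric.mem_ball, dist_eq_norm]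
  exact lt_of_pow_lt_pow_left₀ 2 hs.le (by linarith)

lemma volume_shell_lt_top : volume (shell z s ε) < ⊤ :=
  (measure_mono Set.inter_subset_right).trans_lt measure_ball_lt_top

lemma tendsto_volume_shell :
    Tendsto (fun ε => volume.real (shell z s ε)) (𝓝[>] 0) (𝓝 0) := by
  have h := tendsto_integral_filter_of_dominated_convergence (μ := (volume : Measure (Rn n)))
    (l := 𝓝[>] (0 : ℝ)) (F := fun ε => (shell z s ε).indicator (fun _ => (1 : ℝ)))
    (f := fun _ => (0 : ℝ)) (bound := (Metric.ball z s).indicator (fun _ => (1 : ℝ)))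
    (Eventually.of_forall fun ε =>
      (measurable_const.indicator measurableSet_shell).aestronglyMeasurable)
    (Eventually.of_forall fun ε => ae_of_all _ fun x => by
      rw [Real.norm_of_nonneg (Set.indicator_nonneg (fun _ _ => zero_le_one) x)]
      exact Set.indicator_le_indicator_of_subset Set.inter_subset_right
        (fun _ => zero_le_one) x)
    ((integrable_indicator_iff Metric.isOpen_ball.measurableSet).2
      (integrableOn_const measure_ball_lt_top.ne))
    (ae_of_all _ fun x => by
      by_cases hx : x ∈ Metric.ball z s
      · rw [Metric.mem_ball, dist_eq_norm] at hx
        have hpos : 0 < s ^ 2 - ‖x - z‖ ^ 2 := by nlinarith [norm_nonneg (x - z)]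
        refine tendsto_const_nhds.congr' ?_
        filter_upwards [Ioo_mem_nhdsGT hpos] with ε hε
        rw [Set.indicator_of_notMem]
        intro h
        have : s ^ 2 - ε < ‖x - z‖ ^ 2 := h.1
        linarith [hε.2]
      · refine tendsto_const_nhds.congr fun ε => ?_
        rw [Set.indicator_of_notMem]
        exact fun h => hx h.2)
  simpa [integral_indicator measurableSet_shell, Measure.real] using h

end Cutoff

lemma integrable_fderiv_radialCutoff {n : ℕ} {z : Rn n} {s ε : ℝ} {V : Rn n → Rn n} (hs : 0 < s)
    (hε : 0 < ε) (hV : Continuous V) :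
    Integrable (fun x => fderiv ℝ (radialCutoff z s ε) x (V x)) := by
  have hηc : ContDiff ℝ 1 (radialCutoff z s ε) := contDiff_radialCutoff (k := 1)
  have hηs : HasCompactSupport (radialCutoff z s ε) := by
    refine HasCompactSupport.intro (isCompact_closedBall z s) fun x hx => ?_
    exact radialCutoff_eq_zero hs hε fun h => hx (Metric.ball_subset_closedBall h)
  have := hηc.continuous_fderiv one_ne_zero
  refine Continuous.integrable_of_hasCompactSupport (by fun_prop) ?_
  refine (hηs.fderiv (𝕜 := ℝ)).mono fun x hx => ?_
  contrapose! hx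
  simp only [Function.mem_support, not_not] at hx ⊢
  simp [hx]

/-! ### Comparison of perimeters by calibration -/

section Calibration

variable {n : ℕ} {E : Set (Rn n)} {z : Rn n} {s : ℝ} {T S : Rn n → Rn n}

/-- Testing the perimeter of `E` with a field that agrees with `T` outside the ball and with `S`
deep inside it. -/
lemma integral_sub_le_perimeter_of_cutoff (hE : perimeter E ≠ ⊤) (hm : NullMeasurableSet E)
    (hs : 0 < s) {ε : ℝ} (hε : 0 < ε) (hT : IsUnitField T) (hS : ContDiff ℝ 1 S)
    (hS1 : ∀ x ∈ Metric.ball z s, ‖S x‖ ≤ 1) :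
    (∫ x in E, divergence T x)
      - (∫ x in Eᶜ, radialCutoff z s ε x * (divergence S x - divergence T x))
      - (∫ x in Eᶜ, fderiv ℝ (radialCutoff z s ε) x (S x - T x)) ≤ (perimeter E).toReal := by
  set η := radialCutoff z s ε with hη
  have hηc : ContDiff ℝ 1 η := contDiff_radialCutoff (k := 1)
  have hηd : Differentiable ℝ η := hηc.differentiable one_ne_zero
  have hTd := hT.contDiff.differentiable one_ne_zero
  have hSd := hS.differentiable one_ne_zero
  have hηs : HasCompactSupport η := by
    refine HasCompactSupport.intro (isCompact_closedBall z s) fun x hx => ?_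
    exact radialCutoff_eq_zero hs hε fun h => hx (Metric.ball_subset_closedBall h)
  have hW : ContDiff ℝ 1 (fun x => η x • (S x - T x)) := hηc.smul (hS.sub hT.contDiff)
  have hWs : HasCompactSupport (fun x => η x • (S x - T x)) := hηs.smul_right
  have hU : IsUnitField (fun x => T x + η x • (S x - T x)) := by
    refine ⟨hT.contDiff.add hW, hT.hasCompactSupport.add hWs, fun x => ?_⟩
    by_cases hx : x ∈ Metric.ball z s
    · have : T x + η x • (S x - T x) = (1 - η x) • T x + η x • S x := by module
      rw [this]
      refine (norm_add_le _ _).trans ?_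
      have h0 : 0 ≤ η x := radialCutoff_nonneg
      have h1 : η x ≤ 1 := radialCutoff_le_one
      rw [norm_smul, norm_smul, Real.norm_of_nonneg h0, Real.norm_of_nonneg (sub_nonneg.2 h1)]
      nlinarith [hT.norm_le x, hS1 x hx]
    · have : η x = 0 := radialCutoff_eq_zero hs hε hx
      simpa [this] using hT.norm_le x
  have h1 := integral_divergence_le hE hU
  have hdiv : ∀ x, divergence (fun x => η x • (S x - T x)) x
      = η x * (divergence S x - divergence T x) + fderiv ℝ η x (S x - T x) := by
    intro x
    rw [divergence_smul (T := fun x => S x - T x) (hηd x) ((hSd x).sub (hTd x)), divergence_sub (hSd x) (hTd x)]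
  have hdiv2 : ∀ x, divergence (fun x => T x + η x • (S x - T x)) x
      = divergence T x + divergence (fun x => η x • (S x - T x)) x := by
    intro x
    rw [divergence_add (hTd x) ((hW.differentiable one_ne_zero) x)]
  have hiT := integrable_divergence hT.contDiff hT.hasCompactSupport
  have hiW := integrable_divergence hW hWs
  simp only [hdiv2] at h1
  rw [integral_add hiT.integrableOn hiW.integrableOn] at h1
  have h2 := integral_add_compl₀ hm hiW
  rw [integral_divergence_eq_zero hW hWs] at h2
  have hcS := continuous_divergence hS
  have hcT := continuous_divergence hT.contDiff
  have hi1 : Integrable (fun x => η x * (divergence S x - divergence T x)) := by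
    refine Continuous.integrable_of_hasCompactSupport (by fun_prop) hηs.mul_right
  have hi2 : Integrable (fun x => fderiv ℝ η x (S x - T x)) :=
    integrable_fderiv_radialCutoff hs hε (hS.continuous.sub hT.contDiff.continuous)
  have h3 : ∫ x in Eᶜ, divergence (fun x => η x • (S x - T x)) x
      = (∫ x in Eᶜ, η x * (divergence S x - divergence T x))
        + ∫ x in Eᶜ, fderiv ℝ η x (S x - T x) := by
    rw [← integral_add hi1.integrableOn hi2.integrableOn]
    simp only [hdiv]
  linarith

/-- The limit of `integral_sub_le_perimeter_of_cutoff` as the cutoff tends to the indicator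
function of the ball. -/
lemma integral_union_sub_le_perimeter (hE : perimeter E ≠ ⊤) (hm : NullMeasurableSet E)
    (hs : 0 < s) (hT : IsUnitField T) (hS : ContDiff ℝ 1 S)
    (hS1 : ∀ x ∈ Metric.ball z s, ‖S x‖ ≤ 1) {b : ℝ → ℝ} {c : ℝ} (hb : Tendsto b (𝓝[>] 0) (𝓝 c))
    (hbound : ∀ᶠ ε in 𝓝[>] (0 : ℝ),
      ∫ x in Eᶜ, fderiv ℝ (radialCutoff z s ε) x (S x - T x) ≤ b ε) :
    (∫ x in E ∪ Metric.ball z s, divergence T x) - ∫ x in Metric.ball z s \ E, divergence S x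
      ≤ (perimeter E).toReal + c := by
  have hcS := continuous_divergence hS
  have hcT := continuous_divergence hT.contDiff
  have hBm : MeasurableSet (Metric.ball z s) := Metric.isOpen_ball.measurableSet
  have hiB : ∀ {f : Rn n → ℝ}, Continuous f → IntegrableOn f (Metric.ball z s) := fun hf =>
    (hf.continuousOn.integrableOn_compact (isCompact_closedBall z s)).mono_set
      Metric.ball_subset_closedBall
  have hlim : Tendsto
      (fun ε => ∫ x in Eᶜ, radialCutoff z s ε x * (divergence S x - divergence T x)) (𝓝[>] 0)
      (𝓝 (∫ x in Eᶜ, (Metric.ball z s).indicator (fun _ => (1 : ℝ)) x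
        * (divergence S x - divergence T x))) := by
    refine tendsto_integral_filter_of_dominated_convergence
      (fun x => (Metric.ball z s).indicator (fun x => |divergence S x - divergence T x|) x)
      (Eventually.of_forall fun ε => ?_) ?_ ?_ (ae_of_all _ fun x => ?_)
    · have : Continuous (radialCutoff z s ε) := (contDiff_radialCutoff (k := 1)).continuous
      exact Continuous.aestronglyMeasurable (by fun_prop)
    · filter_upwards [self_mem_nhdsWithin] with ε hε
      refine ae_of_all _ fun x => ?_
      by_cases hx : x ∈ Metric.ball z s
      · rw [Set.indicator_of_mem hx, norm_mul, Real.norm_of_nonneg radialCutoff_nonneg]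
        exact mul_le_of_le_one_left (abs_nonneg _) radialCutoff_le_one
      · rw [Set.indicator_of_notMem hx, radialCutoff_eq_zero hs hε hx]
        simp
    · exact ((integrable_indicator_iff hBm).2 (hiB (by fun_prop))).integrableOn
    · exact (tendsto_radialCutoff hs x).mul_const _
  have hval : ∫ x in Eᶜ, (Metric.ball z s).indicator (fun _ => (1 : ℝ)) x
        * (divergence S x - divergence T x)
      = (∫ x in Metric.ball z s \ E, divergence S x)
        - ∫ x in Metric.ball z s \ E, divergence T x := by
    have h1 : ∀ x, (Metric.ball z s).indicator (fun _ => (1 : ℝ)) x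
        * (divergence S x - divergence T x)
        = (Metric.ball z s).indicator (fun x => divergence S x - divergence T x) x := by
      intro x
      by_cases hx : x ∈ Metric.ball z s <;> simp [hx]
    simp only [h1]
    rw [setIntegral_indicator hBm, Set.inter_comm, ← Set.sdiff_eq, integral_sub
      ((hiB hcS).mono_set Set.sdiff_subset) ((hiB hcT).mono_set Set.sdiff_subset)]
  rw [hval] at hlim
  have hun : ∫ x in E ∪ Metric.ball z s, divergence T x
      = (∫ x in E, divergence T x) + ∫ x in Metric.ball z s \ E, divergence T x := by
    have hiT := integrable_divergence hT.contDiff hT.hasCompactSupport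
    rw [← Set.union_sdiff_self, setIntegral_union₀ (Set.disjoint_sdiff_right.aedisjoint)
      (hBm.nullMeasurableSet.diff hm) hiT.integrableOn hiT.integrableOn]
  have hfin := le_of_tendsto_of_tendsto (hlim.const_sub (∫ x in E, divergence T x))
    (hb.const_add (perimeter E).toReal) (by
      filter_upwards [hbound, self_mem_nhdsWithin] with ε h1 h2
      have := integral_sub_le_perimeter_of_cutoff (z := z) hE hm hs h2 hT hS hS1
      linarith)
  linarith

end Calibration

section Comparison

variable {n : ℕ} {E : Set (Rn n)} {z : Rn n} {s : ℝ}

lemma setIntegral_compl_le_of_shell {ε C : ℝ} {q : Rn n → ℝ} (hq : Integrable q)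
    (hC : ∀ x ∈ shell z s ε, q x ≤ C) (h0 : ∀ x ∉ shell z s ε, q x = 0) :
    ∫ x in Eᶜ, q x ≤ C * volume.real (shell z s ε \ E) := by
  have hi : Integrable ((shell z s ε).indicator (fun _ => C)) :=
    (integrable_indicator_iff measurableSet_shell).2 (integrableOn_const volume_shell_lt_top.ne)
  calc ∫ x in Eᶜ, q x ≤ ∫ x in Eᶜ, (shell z s ε).indicator (fun _ => C) x := by
        refine integral_mono hq.integrableOn hi.integrableOn fun x => ?_
        by_cases hx : x ∈ shell z s ε
        · simpa [hx] using hC x hx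
        · simpa [hx] using (h0 x hx).le
    _ = C * volume.real (shell z s ε \ E) := by
        rw [setIntegral_indicator measurableSet_shell, Set.inter_comm, ← Set.sdiff_eq,
          setIntegral_const, smul_eq_mul, mul_comm]

/-- Filling a ball of radius `s` costs at most `n / s` times the added volume, because the field
`(x - z) / s` calibrates the sphere and has divergence `n / s`. -/
lemma perimeter_union_ball_le (hm : NullMeasurableSet E) (hs : 0 < s) :
    perimeter (E ∪ Metric.ball z s) ≤
      perimeter E + ENNReal.ofReal (n / s) * volume (Metric.ball z s \ E) := by
  by_cases hE : perimeter E = ⊤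
  · simp [hE]
  obtain ⟨L, hL0, hL⟩ := exists_deriv_smoothTransition_bound
  have hfin : volume (Metric.ball z s \ E) ≠ ⊤ :=
    ((measure_mono Set.sdiff_subset).trans_lt measure_ball_lt_top).ne
  have key : perimeter (E ∪ Metric.ball z s) ≤
      ENNReal.ofReal ((perimeter E).toReal + n / s * volume.real (Metric.ball z s \ E)) := by
    refine perimeter_le_ofReal fun T hT => ?_
    have hS : ContDiff ℝ 1 (fun x : Rn n => s⁻¹ • (x - z)) := by fun_prop
    have h := integral_union_sub_le_perimeter (z := z) (S := fun x => s⁻¹ • (x - z)) hE hm hs hT hS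
      (fun x hx => by
        rw [Metric.mem_ball, dist_eq_norm] at hx
        rw [norm_smul, norm_inv, Real.norm_of_nonneg hs.le, inv_mul_le_iff₀ hs]
        linarith)
      (b := fun ε => 2 * L / s * volume.real (shell z s ε)) (c := 2 * L / s * 0)
      (tendsto_volume_shell.const_mul _) ?_
    · simp only [divergence_const_smul_sub] at h
      rw [setIntegral_const, smul_eq_mul] at h
      have : volume.real (Metric.ball z s \ E) * (s⁻¹ * n)
        = n / s * volume.real (Metric.ball z s \ E) := by ring
      linarith
    · filter_upwards [self_mem_nhdsWithin] with ε hε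
      have hε : 0 < ε := hε
      refine (setIntegral_compl_le_of_shell (z := z) (s := s) (ε := ε) (C := 2 * L / s)
        (integrable_fderiv_radialCutoff (V := fun x => s⁻¹ • (x - z) - T x) hs hε
        (hS.continuous.sub hT.contDiff.continuous)) ?_ ?_).trans ?_
      · intro x hx
        rw [fderiv_radialCutoff]
        have hd := hL ((s ^ 2 - ‖x - z‖ ^ 2) / ε)
        set d := deriv Real.smoothTransition ((s ^ 2 - ‖x - z‖ ^ 2) / ε)
        have h1 : s ^ 2 - ε < ‖x - z‖ ^ 2 := hx.1
        have h2 : ‖x - z‖ < s := by simpa [dist_eq_norm] using hx.2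
        rw [inner_sub_right, inner_smul_right, real_inner_self_eq_norm_sq]
        have h3 : inner ℝ (x - z) (T x) ≤ ‖x - z‖ :=
          (real_inner_le_norm _ _).trans (mul_le_of_le_one_right (norm_nonneg _) (hT.norm_le x))
        have h4 : inner ℝ (x - z) (T x) - s⁻¹ * ‖x - z‖ ^ 2 ≤ ε / s := by
          rw [← sub_nonneg]
          have : ε / s - (‖x - z‖ - s⁻¹ * ‖x - z‖ ^ 2)
              = (ε - ‖x - z‖ * (s - ‖x - z‖)) / s := by field_simp
          have h5 : 0 ≤ (ε - ‖x - z‖ * (s - ‖x - z‖)) / s := by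
            refine div_nonneg ?_ hs.le
            nlinarith [norm_nonneg (x - z)]
          linarith
        calc -(2 / ε * d) * (s⁻¹ * ‖x - z‖ ^ 2 - inner ℝ (x - z) (T x))
            = 2 / ε * d * (inner ℝ (x - z) (T x) - s⁻¹ * ‖x - z‖ ^ 2) := by ring
          _ ≤ 2 / ε * L * (ε / s) := by
              refine (mul_le_mul_of_nonneg_left h4 (mul_nonneg (by positivity) hd.1)).trans ?_
              have : 2 / ε * d ≤ 2 / ε * L := mul_le_mul_of_nonneg_left hd.2.1 (by positivity)
              exact mul_le_mul_of_nonneg_right this (by positivity)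
          _ = 2 * L / s := by field_simp
      · intro x hx
        rw [fderiv_radialCutoff, deriv_smoothTransition_eq_zero_of_notMem_shell hs hε hx]
        simp
      · refine mul_le_mul_of_nonneg_left ?_ (by positivity)
        exact measureReal_mono Set.sdiff_subset volume_shell_lt_top.ne
  refine key.trans ?_
  rw [ENNReal.ofReal_add ENNReal.toReal_nonneg (by positivity), ENNReal.ofReal_toReal hE,
    ENNReal.ofReal_mul (by positivity), Measure.real, ENNReal.ofReal_toReal hfin]

/-- Cutting `Eᶜ` along the sphere of radius `s` creates at most a multiple of `M` of new perimeter if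
`|B_σ \ E|` grows at most at the rate `M` just before `σ = s`. -/
lemma exists_perimeter_union_ball_add_diff_le : ∃ C : ℝ, 0 < C ∧
    ∀ (n : ℕ) (E : Set (Rn n)) (z : Rn n) (s M : ℝ), perimeter E ≠ ⊤ → NullMeasurableSet E →
      0 < s → (∀ᶠ τ in 𝓝[>] (0 : ℝ),
        volume.real (Metric.ball z s \ E) - volume.real (Metric.ball z (s - τ) \ E) ≤ M * τ) →
      perimeter (E ∪ Metric.ball z s) ≠ ⊤ ∧ perimeter (Metric.ball z s \ E) ≠ ⊤ ∧
      (perimeter (E ∪ Metric.ball z s)).toReal + (perimeter (Metric.ball z s \ E)).toReal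
        ≤ (perimeter E).toReal + C * M := by
  obtain ⟨L, hL0, hL⟩ := exists_deriv_smoothTransition_bound
  refine ⟨4 * L, by positivity, fun n E z s M hE hm hs hM => ?_⟩
  have key : ∀ T T', IsUnitField T → IsUnitField T' →
      (∫ x in E ∪ Metric.ball z s, divergence T x)
        + (∫ x in Metric.ball z s \ E, divergence T' x)
        ≤ (perimeter E).toReal + 4 * L * M := by
    intro T T' hT hT'
    have h := integral_union_sub_le_perimeter (z := z) (S := fun x => -T' x) hE hm hs hT
      hT'.neg.contDiff (fun x _ => hT'.neg.norm_le x) (b := fun _ => 4 * L * M)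
      tendsto_const_nhds ?_
    · simp only [divergence_neg, integral_neg, sub_neg_eq_add] at h
      exact h
    · -- the shell of the cutoff has thickness at most `ε / s`
      have hτ : Tendsto (fun ε : ℝ => ε / s) (𝓝[>] 0) (𝓝[>] 0) := by
        refine tendsto_nhdsWithin_iff.2 ⟨?_, ?_⟩
        · have : Tendsto (fun ε : ℝ => ε / s) (𝓝 0) (𝓝 (0 / s)) := by
            exact (continuous_id.div_const s).tendsto 0
          rw [zero_div] at this
          exact this.mono_left nhdsWithin_le_nhds
        · filter_upwards [self_mem_nhdsWithin] with ε hε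
          exact div_pos hε hs
      filter_upwards [self_mem_nhdsWithin, hτ.eventually hM,
        Ioo_mem_nhdsGT (show (0 : ℝ) < s ^ 2 by positivity)] with ε hε hMε hεs
      have hε : 0 < ε := hε
      refine (setIntegral_compl_le_of_shell (z := z) (s := s) (ε := ε) (C := 4 * L * s / ε)
        (integrable_fderiv_radialCutoff (V := fun x => -T' x - T x) hs hε
        (hT'.neg.contDiff.continuous.sub hT.contDiff.continuous)) ?_ ?_).trans ?_
      · intro x hx
        rw [fderiv_radialCutoff]
        have hd := hL ((s ^ 2 - ‖x - z‖ ^ 2) / ε)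
        set d := deriv Real.smoothTransition ((s ^ 2 - ‖x - z‖ ^ 2) / ε)
        have h2 : ‖x - z‖ < s := by simpa [dist_eq_norm] using hx.2
        have h3 : |inner ℝ (x - z) (-T' x - T x)| ≤ s * 2 := by
          refine (abs_real_inner_le_norm _ _).trans ?_
          refine mul_le_mul h2.le ?_ (norm_nonneg _) hs.le
          refine (norm_sub_le _ _).trans ?_
          linarith [hT.norm_le x, hT'.neg.norm_le x]
        calc -(2 / ε * d) * inner ℝ (x - z) (-T' x - T x)
            = 2 / ε * d * (-inner ℝ (x - z) (-T' x - T x)) := by ring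
          _ ≤ 2 / ε * L * (s * 2) := by
              refine (mul_le_mul_of_nonneg_left ((neg_le_abs _).trans h3)
                (mul_nonneg (by positivity) hd.1)).trans ?_
              have : 2 / ε * d ≤ 2 / ε * L := mul_le_mul_of_nonneg_left hd.2.1 (by positivity)
              exact mul_le_mul_of_nonneg_right this (by positivity)
          _ = 4 * L * s / ε := by ring
      · intro x hx
        rw [fderiv_radialCutoff, deriv_smoothTransition_eq_zero_of_notMem_shell hs hε hx]
        simp
      · have hsub : shell z s ε \ E ⊆
            (Metric.ball z s \ E) \ (Metric.ball z (s - ε / s) \ E) := by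
          rintro x ⟨⟨h1, h2⟩, h3⟩
          refine ⟨⟨h2, h3⟩, fun h4 => ?_⟩
          have h1 : s ^ 2 - ε < ‖x - z‖ ^ 2 := h1
          have h5 : ‖x - z‖ < s - ε / s := by simpa [dist_eq_norm] using h4.1
          have h6 : ε / s * s = ε := by field_simp
          have h7 : 0 < ε / s := by positivity
          have h8 : ε / s < s := by rw [div_lt_iff₀ hs]; nlinarith [hεs.2]
          nlinarith [norm_nonneg (x - z)]
        have hmb : ∀ r, volume (Metric.ball z r \ E) ≠ ⊤ := fun r =>
          ((measure_mono Set.sdiff_subset).trans_lt measure_ball_lt_top).ne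
        have h1 : volume.real (shell z s ε \ E) ≤ M * (ε / s) := by
          refine le_trans ?_ hMε
          refine (measureReal_mono hsub
            ((measure_mono Set.sdiff_subset).trans_lt (hmb s).lt_top).ne).trans ?_
          have hsub2 : Metric.ball z (s - ε / s) \ E ⊆ Metric.ball z s \ E := by
            refine Set.sdiff_subset_sdiff_left (Metric.ball_subset_ball ?_)
            have : 0 < ε / s := by positivity
            linarith
          have hnm : NullMeasurableSet (Metric.ball z (s - ε / s) \ E) :=
            Metric.isOpen_ball.measurableSet.nullMeasurableSet.diff hm
          rw [Measure.real, Measure.real, Measure.real, measure_sdiff hsub2 hnm (hmb _),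
            ENNReal.toReal_sub_of_le (measure_mono hsub2) (hmb _)]
        calc 4 * L * s / ε * volume.real (shell z s ε \ E)
            ≤ 4 * L * s / ε * (M * (ε / s)) :=
              mul_le_mul_of_nonneg_left h1 (by positivity)
          _ = 4 * L * M := by field_simp
  have hdiv0 : ∀ A : Set (Rn n), ∫ x in A, divergence (fun _ : Rn n => (0 : Rn n)) x = 0 := by
    intro A; simp [divergence]
  have h1 : perimeter (E ∪ Metric.ball z s) ≤
      ENNReal.ofReal ((perimeter E).toReal + 4 * L * M) :=
    perimeter_le_ofReal fun T hT => by simpa [hdiv0] using key T _ hT IsUnitField.zero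
  have h2 : perimeter (Metric.ball z s \ E) ≤
      ENNReal.ofReal ((perimeter E).toReal + 4 * L * M) :=
    perimeter_le_ofReal fun T hT => by simpa [hdiv0] using key _ T IsUnitField.zero hT
  refine ⟨(h1.trans_lt ENNReal.ofReal_lt_top).ne, (h2.trans_lt ENNReal.ofReal_lt_top).ne, ?_⟩
  rw [← le_sub_iff_add_le']
  refine toReal_perimeter_le fun T' hT' => ?_
  rw [le_sub_iff_add_le, add_comm, ← le_sub_iff_add_le]
  refine toReal_perimeter_le fun T hT => ?_
  rw [le_sub_iff_add_le]
  exact key T T' hT hT'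

/-- Intersecting a bounded set with a ball centred at the origin does not increase the perimeter:
outside the ball the (regularized) radial field has nonnegative divergence. -/
lemma perimeter_inter_ball_le (hm : NullMeasurableSet E) (hb : Bornology.IsBounded E)
    (hs : 0 < s) : perimeter (E ∩ Metric.ball 0 s) ≤ perimeter E := by
  by_cases hE : perimeter E = ⊤
  · simp [hE]
  obtain ⟨L, hL0, hL⟩ := exists_deriv_smoothTransition_bound
  have hvE : volume E ≠ ⊤ := hb.measure_lt_top.ne
  have hBm : MeasurableSet (Metric.ball (0 : Rn n) s) := Metric.isOpen_ball.measurableSet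
  rw [← ENNReal.ofReal_toReal hE]
  refine perimeter_le_ofReal fun T hT => ?_
  have hcT := continuous_divergence hT.contDiff
  have hiT := integrable_divergence hT.contDiff hT.hasCompactSupport
  have hTd := hT.contDiff.differentiable one_ne_zero
  have hstep : ∀ ε : ℝ, 0 < ε → ∫ x in E, radialCutoff 0 s ε x * divergence T x
      ≤ (perimeter E).toReal + 2 * L * ε * volume.real E := by
    intro ε hε
    set η : Rn n → ℝ := radialCutoff 0 s ε with hη
    have hηc : ContDiff ℝ 1 η := contDiff_radialCutoff (k := 1)
    have hηd : Differentiable ℝ η := hηc.differentiable one_ne_zero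
    -- the regularization parameter `ε ^ 4` makes the error of order `ε`
    let w : Rn n → ℝ := fun x => Real.sqrt (‖x‖ ^ 2 + ε ^ 4)
    have hw0 : ∀ x, 0 < w x := fun x => Real.sqrt_pos.2 (by positivity)
    have hw2 : ∀ x, w x ^ 2 = ‖x‖ ^ 2 + ε ^ 4 := fun x => Real.sq_sqrt (by positivity)
    have hwx : ∀ x, ‖x‖ ≤ w x := fun x => Real.le_sqrt_of_sq_le (by nlinarith [pow_pos hε 4])
    have hwε : ∀ x, w x ≤ ‖x‖ + ε ^ 2 := fun x => by
      refine Real.sqrt_le_iff.2 ⟨by positivity, ?_⟩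
      nlinarith [norm_nonneg x, pow_pos hε 2, mul_nonneg (norm_nonneg x) (pow_pos hε 2).le]
    have hwc : ContDiff ℝ 1 (fun x => (w x)⁻¹) := by
      refine ContDiff.inv (ContDiff.sqrt ?_ fun x => by positivity) fun x => (hw0 x).ne'
      exact (contDiff_id.norm_sq ℝ).add contDiff_const
    have hX : ContDiff ℝ 1 (fun x => (w x)⁻¹ • x) := hwc.smul contDiff_id
    have hXd := hX.differentiable one_ne_zero
    have hwd : ∀ x, HasFDerivAt (fun x => (w x)⁻¹)
        (-((w x)⁻¹ ^ 3) • innerSL ℝ x) x := by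
      intro x
      have h1 := ((hasFDerivAt_id (𝕜 := ℝ) x).norm_sq).add_const (ε ^ 4)
      have h2 := (Real.hasDerivAt_sqrt (show ‖id x‖ ^ 2 + ε ^ 4 ≠ 0 by positivity)).inv
        (hw0 x).ne'
      have h3 := h2.comp_hasFDerivAt x h1
      refine h3.congr_fderiv ?_
      ext v
      have h4 : Real.sqrt (‖id x‖ ^ 2 + ε ^ 4) = w x := rfl
      have := (hw0 x).ne'
      simp only [h4]
      simp
      field_simp
    have hdivX : ∀ x, 0 ≤ divergence (fun x => (w x)⁻¹ • x) x := by
      intro x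
      rcases Nat.eq_zero_or_pos n with hn | hn
      · subst hn; simp [divergence]
      have hn1 : (1 : ℝ) ≤ n := by exact_mod_cast hn
      have h1 := divergence_const_smul_sub (n := n) 1 0 x
      simp only [one_smul, sub_zero, one_mul] at h1
      rw [divergence_smul (T := fun x => x) (hwd x).differentiableAt differentiableAt_id, h1,
        (hwd x).fderiv]
      have h2 : ((-((w x)⁻¹ ^ 3) • innerSL ℝ x) : Rn n →L[ℝ] ℝ) x
          = -((w x)⁻¹ ^ 3 * ‖x‖ ^ 2) := by
        simp
      rw [h2]
      have h3 : (w x)⁻¹ ^ 3 * ‖x‖ ^ 2 ≤ (w x)⁻¹ := by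
        have : (w x)⁻¹ = (w x)⁻¹ ^ 3 * w x ^ 2 := by
          have := (hw0 x).ne'
          field_simp
        conv_rhs => rw [this]
        refine mul_le_mul_of_nonneg_left ?_ (pow_nonneg (inv_nonneg.2 (hw0 x).le) _)
        exact pow_le_pow_left₀ (norm_nonneg _) (hwx x) 2
      nlinarith [inv_pos.2 (hw0 x)]
    have hX1 : ∀ x, ‖(w x)⁻¹ • x‖ ≤ 1 := fun x => by
      rw [norm_smul, norm_inv, Real.norm_of_nonneg (hw0 x).le, inv_mul_le_iff₀ (hw0 x), mul_one]
      exact hwx x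
    have hY : ContDiff ℝ 1 (fun x => (w x)⁻¹ • x + η x • (T x - (w x)⁻¹ • x)) :=
      hX.add (hηc.smul (hT.contDiff.sub hX))
    have hY1 : ∀ x, ‖(w x)⁻¹ • x + η x • (T x - (w x)⁻¹ • x)‖ ≤ 1 := by
      intro x
      have h0 : 0 ≤ η x := radialCutoff_nonneg
      have h1 : η x ≤ 1 := radialCutoff_le_one
      have : (w x)⁻¹ • x + η x • (T x - (w x)⁻¹ • x)
          = (1 - η x) • ((w x)⁻¹ • x) + η x • T x := by module
      rw [this]
      refine (norm_add_le _ _).trans ?_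
      rw [norm_smul, norm_smul (η x), Real.norm_of_nonneg h0,
        Real.norm_of_nonneg (sub_nonneg.2 h1)]
      nlinarith [hT.norm_le x, hX1 x]
    have hfin := integral_divergence_le_of_isBounded hE hm hb hY hY1
    have hdivY : ∀ x, η x * divergence T x - 2 * L * ε
        ≤ divergence (fun x => (w x)⁻¹ • x + η x • (T x - (w x)⁻¹ • x)) x := by
      intro x
      rw [divergence_add (S := fun x => η x • (T x - (w x)⁻¹ • x)) (hXd x) (((hηd x).smul ((hTd x).sub (hXd x)))),
        divergence_smul (T := fun x => T x - (w x)⁻¹ • x) (hηd x) ((hTd x).sub (hXd x)),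
        divergence_sub (hTd x) (hXd x), hη, fderiv_radialCutoff, ← hη]
      have h0 : 0 ≤ η x := radialCutoff_nonneg
      have h1 : η x ≤ 1 := radialCutoff_le_one
      have hd := hL ((s ^ 2 - ‖x - 0‖ ^ 2) / ε)
      set d := deriv Real.smoothTransition ((s ^ 2 - ‖x - 0‖ ^ 2) / ε)
      rw [sub_zero, inner_sub_right, inner_smul_right, real_inner_self_eq_norm_sq]
      have h2 : inner ℝ x (T x) ≤ ‖x‖ :=
        (real_inner_le_norm _ _).trans (mul_le_of_le_one_right (norm_nonneg _) (hT.norm_le x))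
      have h3 : inner ℝ x (T x) - (w x)⁻¹ * ‖x‖ ^ 2 ≤ ε ^ 2 := by
        have h4 : w x - (w x)⁻¹ * ‖x‖ ^ 2 = (w x)⁻¹ * ε ^ 4 := by
          have h5 := (hw0 x).ne'
          have h6 := hw2 x
          field_simp
          linarith
        have h7 : ‖x‖ - (w x)⁻¹ * ‖x‖ ^ 2 = (w x)⁻¹ * (‖x‖ * (w x - ‖x‖)) := by
          have h5 := (hw0 x).ne'
          field_simp
        have h8 : (w x)⁻¹ * (‖x‖ * (w x - ‖x‖)) ≤ (w x)⁻¹ * (w x * ε ^ 2) := by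
          refine mul_le_mul_of_nonneg_left ?_ (inv_nonneg.2 (hw0 x).le)
          exact mul_le_mul (hwx x) (by linarith [hwε x]) (by linarith [hwx x]) (hw0 x).le
        rw [inv_mul_cancel_left₀ (hw0 x).ne'] at h8
        linarith
      have h9 : 2 / ε * d * (inner ℝ x (T x) - (w x)⁻¹ * ‖x‖ ^ 2) ≤ 2 * L * ε := by
        calc _ ≤ 2 / ε * d * ε ^ 2 :=
              mul_le_mul_of_nonneg_left h3 (mul_nonneg (by positivity) hd.1)
          _ = 2 * d * ε := by field_simp
          _ ≤ 2 * L * ε := by nlinarith [hd.2.1]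
      nlinarith [mul_nonneg (sub_nonneg.2 h1) (hdivX x)]
    have hiη : Integrable (fun x => η x * divergence T x) := by
      have := hηc.continuous
      exact Continuous.integrable_of_hasCompactSupport (by fun_prop)
        (hasCompactSupport_divergence hT.hasCompactSupport).mul_left
    have hiY : IntegrableOn
        (divergence (fun x => (w x)⁻¹ • x + η x • (T x - (w x)⁻¹ • x))) E := by
      obtain ⟨r, hr⟩ := hb.subset_closedBall (0 : Rn n)
      exact ((continuous_divergence hY).continuousOn.integrableOn_compact
        (isCompact_closedBall 0 r)).mono_set hr
    have hmono : ∫ x in E, (η x * divergence T x - 2 * L * ε)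
        ≤ ∫ x in E, divergence (fun x => (w x)⁻¹ • x + η x • (T x - (w x)⁻¹ • x)) x :=
      integral_mono (hiη.integrableOn.sub (integrableOn_const hvE)) hiY hdivY
    rw [integral_sub hiη.integrableOn (integrableOn_const hvE), setIntegral_const,
      smul_eq_mul] at hmono
    linarith
  have hlim : Tendsto (fun ε => ∫ x in E, radialCutoff 0 s ε x * divergence T x) (𝓝[>] 0)
      (𝓝 (∫ x in E, (Metric.ball 0 s).indicator (fun _ => (1 : ℝ)) x * divergence T x)) := by
    refine tendsto_integral_filter_of_dominated_convergence (fun x => |divergence T x|)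
      (Eventually.of_forall fun ε => ?_) (Eventually.of_forall fun ε => ae_of_all _ fun x => ?_)
      hiT.abs.integrableOn (ae_of_all _ fun x => (tendsto_radialCutoff hs x).mul_const _)
    · have : Continuous (radialCutoff (0 : Rn n) s ε) := (contDiff_radialCutoff (k := 1)).continuous
      exact Continuous.aestronglyMeasurable (by fun_prop)
    · rw [norm_mul, Real.norm_of_nonneg radialCutoff_nonneg]
      exact mul_le_of_le_one_left (abs_nonneg _) radialCutoff_le_one
  have hval : ∫ x in E, (Metric.ball 0 s).indicator (fun _ => (1 : ℝ)) x * divergence T x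
      = ∫ x in E ∩ Metric.ball 0 s, divergence T x := by
    have h1 : ∀ x, (Metric.ball 0 s).indicator (fun _ => (1 : ℝ)) x * divergence T x
        = (Metric.ball 0 s).indicator (divergence T) x := by
      intro x
      by_cases hx : x ∈ Metric.ball 0 s <;> simp [hx]
    simp only [h1]
    rw [setIntegral_indicator hBm]
  rw [hval] at hlim
  have hr : Tendsto (fun ε : ℝ => (perimeter E).toReal + 2 * L * ε * volume.real E) (𝓝[>] 0)
      (𝓝 ((perimeter E).toReal + 2 * L * 0 * volume.real E)) := by
    refine Tendsto.mono_left ?_ nhdsWithin_le_nhds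
    exact Continuous.tendsto (by fun_prop) 0
  have := le_of_tendsto_of_tendsto hlim hr (by
    filter_upwards [self_mem_nhdsWithin] with ε hε using hstep ε hε)
  simpa using this

end Comparison

/-! ### Translations, the isoperimetric inequality, and nearly filled balls -/

section Translation

variable {n : ℕ} {E : Set (Rn n)}

lemma volume_real_ball (hn : 1 ≤ n) (x : Rn n) {r : ℝ} (hr : 0 ≤ r) :
    volume.real (Metric.ball x r) = r ^ n * volume.real (Metric.ball (0 : Rn n) 1) := by
  have : Nonempty (Fin n) := ⟨⟨0, hn⟩⟩
  rw [Measure.real, Measure.addHaar_ball volume x hr, ENNReal.toReal_mul,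
    ENNReal.toReal_ofReal (by positivity), finrank_euclideanSpace_fin, Measure.real]

lemma volume_real_unitBall_pos : 0 < volume.real (Metric.ball (0 : Rn n) 1) :=
  ENNReal.toReal_pos (Metric.measure_ball_pos _ _ one_pos).ne' measure_ball_lt_top.ne

lemma exists_smooth_approx_indicator (hm : NullMeasurableSet E) (hb : Bornology.IsBounded E)
    {δ : ℝ} (hδ : 0 < δ) : ∃ φ : Rn n → ℝ, ContDiff ℝ 1 φ ∧ HasCompactSupport φ ∧
      (∀ x, 0 ≤ φ x ∧ φ x ≤ 1) ∧ ∫ x in E, (1 - φ x) ≤ δ ∧ ∫ x in Eᶜ, φ x ≤ δ := by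
  obtain ⟨E', hE'E, hE'm, hE'⟩ := hm.exists_measurable_subset_ae_eq
  have hvE : volume E ≠ ⊤ := hb.measure_lt_top.ne
  have hvE' : volume E' ≠ ⊤ := (hb.subset hE'E).measure_lt_top.ne
  have hδ' : ENNReal.ofReal δ ≠ 0 := by simpa using hδ
  obtain ⟨K, hKE, hK, hKδ⟩ := hE'm.exists_isCompact_sdiff_lt hvE' hδ'
  obtain ⟨U, hKU, hU, hUδ⟩ := hK.exists_isOpen_lt_add (μ := volume) hδ'
  obtain ⟨r, hr⟩ := hK.isBounded.subset_ball (0 : Rn n)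
  have hV : IsOpen (U ∩ Metric.ball 0 r) := hU.inter Metric.isOpen_ball
  obtain ⟨φ, hφ, hφr, hφ0, hφ1⟩ := exists_contMDiff_zero_iff_one_iff_of_isClosed (n := 1)
    (modelWithCornersSelf ℝ (Rn n)) hV.isClosed_compl hK.isClosed
    (Set.disjoint_left.2 fun x hx hxK => hx ⟨hKU hxK, hr hxK⟩)
  have h01 : ∀ x, 0 ≤ φ x ∧ φ x ≤ 1 := fun x => hφr ⟨x, rfl⟩
  have hφc : ContDiff ℝ 1 φ := hφ.contDiff
  have hcont := hφc.continuous
  have hφs : HasCompactSupport φ := by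
    refine HasCompactSupport.intro (isCompact_closedBall 0 r) fun x hx => ?_
    exact (hφ0 x).1 fun h => hx (Metric.ball_subset_closedBall h.2)
  have hiφ : Integrable φ := hcont.integrable_of_hasCompactSupport hφs
  have hKm := hK.measurableSet
  have hUm := hU.measurableSet
  refine ⟨φ, hφc, hφs, h01, ?_, ?_⟩
  · have hEK : volume (E \ K) ≤ ENNReal.ofReal δ := by
      rw [measure_congr (hE'.symm.diff (ae_eq_refl K))]
      exact hKδ.le
    calc ∫ x in E, (1 - φ x) ≤ ∫ x in E, Kᶜ.indicator (fun _ => (1 : ℝ)) x := by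
          refine integral_mono ((integrableOn_const hvE).sub hiφ.integrableOn)
            ((integrableOn_const (C := (1 : ℝ)) hvE).indicator hKm.compl) fun x => ?_
          by_cases hx : x ∈ K
          · simp [hx, (hφ1 x).1 hx]
          · simpa [hx] using (h01 x).1
      _ = volume.real (E \ K) := by
          rw [setIntegral_indicator hKm.compl, ← Set.sdiff_eq]
          simp
      _ ≤ δ := ENNReal.toReal_le_of_le_ofReal hδ.le hEK
  · have hKfin : volume K ≠ ⊤ := hK.measure_lt_top.ne
    have hUK : volume (U \ K) ≤ ENNReal.ofReal δ := by
      rw [measure_sdiff hKU hKm.nullMeasurableSet hKfin]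
      exact tsub_le_iff_left.2 hUδ.le
    have hUfin : volume U ≠ ⊤ := (hUδ.trans_le le_top).ne
    calc ∫ x in Eᶜ, φ x ≤ ∫ x in Eᶜ, U.indicator (fun _ => (1 : ℝ)) x := by
          refine integral_mono hiφ.integrableOn
            ((integrable_indicator_iff hUm).2 (integrableOn_const hUfin)).integrableOn fun x => ?_
          by_cases hx : x ∈ U
          · simpa [hx] using (h01 x).2
          · have h0 : φ x = 0 := (hφ0 x).1 fun h => hx h.1
            simp [hx, h0]
      _ = volume.real (Eᶜ ∩ U) := by
          rw [setIntegral_indicator hUm]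
          simp
      _ ≤ δ := by
          refine ENNReal.toReal_le_of_le_ofReal hδ.le ((measure_mono ?_).trans hUK)
          exact fun x hx => ⟨hx.2, fun h => hx.1 (hE'E (hKE h))⟩

lemma integral_sub_translate_le (hb : Bornology.IsBounded E)
    (hE : perimeter E ≠ ⊤) {φ : Rn n → ℝ} (hφ : ContDiff ℝ 1 φ) (hφs : HasCompactSupport φ)
    (hφ1 : ∀ x, |φ x| ≤ 1) (v : Rn n) :
    (∫ x in E, φ x) - (∫ x in E, φ (x + v)) ≤ ‖v‖ * (perimeter E).toReal := by
  rcases eq_or_ne v 0 with rfl | hv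
  · simp
  have hv0 : 0 < ‖v‖ := norm_pos_iff.2 hv
  have hvE : volume E ≠ ⊤ := hb.measure_lt_top.ne
  have hφd := hφ.differentiable one_ne_zero
  have hcd := hφ.continuous_fderiv one_ne_zero
  have hc := hφ.continuous
  obtain ⟨C, hC⟩ := (hφs.fderiv (𝕜 := ℝ)).exists_bound_of_continuous hcd
  have hiφ : ∀ t : ℝ, Integrable (fun x => φ (x + t • v)) := fun t =>
    (hc.integrable_of_hasCompactSupport hφs).comp_add_right _
  have hder : ∀ t : ℝ, HasDerivAt (fun t : ℝ => -∫ x in E, φ (x + t • v))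
      (-∫ x in E, fderiv ℝ φ (x + t • v) v) t := by
    intro t
    refine (hasDerivAt_integral_of_dominated_loc_of_deriv_le (μ := volume.restrict E)
      (F := fun t x => φ (x + t • v)) (F' := fun t x => fderiv ℝ φ (x + t • v) v)
      (bound := fun _ => C * ‖v‖) (s := Set.univ) (x₀ := t) univ_mem
      (Eventually.of_forall fun t => ?_) (hiφ t).integrableOn ?_ ?_ (integrableOn_const hvE)
      ?_).2.neg
    · exact Continuous.aestronglyMeasurable (by fun_prop)
    · exact Continuous.aestronglyMeasurable (by fun_prop)
    · exact ae_of_all _ fun x t _ => ((fderiv ℝ φ (x + t • v)).le_opNorm v).trans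
        (mul_le_mul_of_nonneg_right (hC _) (norm_nonneg _))
    · refine ae_of_all _ fun x t _ => ?_
      have h1 : HasDerivAt (fun t : ℝ => x + t • v) v t := by
        simpa using ((hasDerivAt_id t).smul_const v).const_add x
      exact (hφd _).hasFDerivAt.comp_hasDerivAt t h1
  have hle : ∀ t : ℝ, deriv (fun t : ℝ => -∫ x in E, φ (x + t • v)) t
      ≤ ‖v‖ * (perimeter E).toReal := by
    intro t
    rw [(hder t).deriv]
    -- the field points in the direction of the translation
    have hg : ContDiff ℝ 1 (fun x => -φ (x + t • v)) :=
      (hφ.comp (contDiff_id.add contDiff_const)).neg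
    have hgs : HasCompactSupport (fun x => φ (x + t • v)) :=
      hφs.comp_homeomorph (Homeomorph.addRight (t • v))
    have hU : IsUnitField (fun x => (-φ (x + t • v)) • (‖v‖⁻¹ • v)) := by
      refine ⟨hg.smul contDiff_const, ?_, fun x => ?_⟩
      · exact HasCompactSupport.smul_right (f := fun x => -φ (x + t • v))
          (f' := fun _ => ‖v‖⁻¹ • v) hgs.neg
      · rw [norm_smul, norm_smul, norm_inv, norm_norm, inv_mul_cancel₀ hv0.ne', mul_one, norm_neg]
        exact hφ1 _
    have h1 := integral_divergence_le hE hU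
    have h2 : ∀ x, divergence (fun x => (-φ (x + t • v)) • (‖v‖⁻¹ • v)) x
        = ‖v‖⁻¹ * -(fderiv ℝ φ (x + t • v) v) := by
      intro x
      rw [divergence_smul (T := fun _ => ‖v‖⁻¹ • v) ((hg.differentiable one_ne_zero) x)
        (differentiableAt_const _)]
      have h3 : fderiv ℝ (fun x => -φ (x + t • v)) x = -fderiv ℝ φ (x + t • v) := by
        rw [fderiv_fun_neg, fderiv_comp_add_right]
      rw [h3]
      simp [divergence]
    simp only [h2] at h1
    rw [integral_const_mul, integral_neg, inv_mul_le_iff₀ hv0] at h1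
    exact h1
  have := image_sub_le_mul_sub_of_deriv_le (fun t => (hder t).differentiableAt) hle
    (zero_le_one' ℝ)
  simp only [one_smul, zero_smul, add_zero, sub_zero, mul_one] at this
  linarith

/-- The translation estimate for sets of finite perimeter. -/
lemma volume_translate_diff_le (hm : NullMeasurableSet E) (hb : Bornology.IsBounded E)
    (hE : perimeter E ≠ ⊤) (v : Rn n) :
    volume {x | x ∈ E ∧ x + v ∉ E} ≤ ENNReal.ofReal (‖v‖ * (perimeter E).toReal) := by
  have hvE : volume E ≠ ⊤ := hb.measure_lt_top.ne
  have hmv : NullMeasurableSet {x | x + v ∈ E} :=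
    hm.preimage (measurePreserving_add_right volume v).quasiMeasurePreserving
  have hA : NullMeasurableSet {x | x ∈ E ∧ x + v ∉ E} := hm.inter hmv.compl
  have hAE : {x | x ∈ E ∧ x + v ∉ E} ⊆ E := fun x hx => hx.1
  have hAfin : volume {x | x ∈ E ∧ x + v ∉ E} ≠ ⊤ := (hb.subset hAE).measure_lt_top.ne
  rw [← ENNReal.ofReal_toReal hAfin]
  refine ENNReal.ofReal_le_ofReal (le_of_forall_pos_le_add fun δ hδ => ?_)
  obtain ⟨φ, hφ, hφs, h01, h1, h2⟩ := exists_smooth_approx_indicator hm hb (half_pos hδ)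
  have h3 := integral_sub_translate_le hb hE hφ hφs
    (fun x => abs_le.2 ⟨by linarith [(h01 x).1], (h01 x).2⟩) v
  have hiφ : Integrable φ := hφ.continuous.integrable_of_hasCompactSupport hφs
  have hiφv : Integrable (fun x => φ (x + v)) := hiφ.comp_add_right v
  have hi1 : IntegrableOn (fun _ : Rn n => (1 : ℝ)) E := integrableOn_const hvE
  have hic : Integrable (Eᶜ.indicator φ) := hiφ.indicator₀ hm.compl
  have hicv : Integrable (fun x => Eᶜ.indicator φ (x + v)) := hic.comp_add_right v
  have h4 : ∫ x in E, Eᶜ.indicator φ (x + v) ≤ δ / 2 := by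
    calc ∫ x in E, Eᶜ.indicator φ (x + v) ≤ ∫ x, Eᶜ.indicator φ (x + v) :=
          setIntegral_le_integral hicv (ae_of_all _ fun x =>
            Set.indicator_nonneg (fun y _ => (h01 y).1) _)
      _ = ∫ x, Eᶜ.indicator φ x := integral_add_right_eq_self _ v
      _ = ∫ x in Eᶜ, φ x := integral_indicator₀ hm.compl
      _ ≤ δ / 2 := h2
  have h5 : volume.real {x | x ∈ E ∧ x + v ∉ E}
      ≤ ∫ x in E, ((φ x - φ (x + v)) + (1 - φ x) + Eᶜ.indicator φ (x + v)) := by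
    calc volume.real {x | x ∈ E ∧ x + v ∉ E}
        = ∫ x in E, {x | x ∈ E ∧ x + v ∉ E}.indicator (fun _ => (1 : ℝ)) x := by
          rw [integral_indicator₀ (hA.mono_ac Measure.absolutelyContinuous_restrict),
            Measure.restrict_restrict₀ (hA.mono_ac Measure.absolutelyContinuous_restrict),
            Set.inter_eq_self_of_subset_left hAE]
          simp
      _ ≤ _ := by
          refine setIntegral_mono_on₀ ?_ (((hiφ.integrableOn.sub hiφv.integrableOn).add
            (hi1.sub hiφ.integrableOn)).add hicv.integrableOn) hm fun x hx => ?_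
          · exact hi1.indicator₀ (hA.mono_ac Measure.absolutelyContinuous_restrict)
          · by_cases hxv : x + v ∈ E
            · have : x ∉ {x | x ∈ E ∧ x + v ∉ E} := fun h => h.2 hxv
              rw [Set.indicator_of_notMem this, Set.indicator_of_notMem (by simpa using hxv)]
              linarith [(h01 (x + v)).2]
            · have : x ∈ {x | x ∈ E ∧ x + v ∉ E} := ⟨hx, hxv⟩
              rw [Set.indicator_of_mem this, Set.indicator_of_mem (by simpa using hxv)]
              linarith
  have hj1 : IntegrableOn (fun x => φ x - φ (x + v)) E :=
    hiφ.integrableOn.sub hiφv.integrableOn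
  have hj2 : IntegrableOn (fun x => 1 - φ x) E := hi1.sub hiφ.integrableOn
  have hj3 : IntegrableOn (fun x => (φ x - φ (x + v)) + (1 - φ x)) E := hj1.add hj2
  rw [integral_add hj3 hicv.integrableOn, integral_add hj1 hj2,
    integral_sub hiφ.integrableOn hiφv.integrableOn] at h5
  have h6 : (volume {x | x ∈ E ∧ x + v ∉ E}).toReal = volume.real {x | x ∈ E ∧ x + v ∉ E} := rfl
  linarith

/-- Averaging the translation estimate over a ball: some ball of radius `s` is filled by `E` up to
a fraction `s P(E) / |E|` of its volume. -/
lemma exists_ball_diff_le (hm : NullMeasurableSet E) (hb : Bornology.IsBounded E)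
    (hE : perimeter E ≠ ⊤) (h0 : volume E ≠ 0) (s : ℝ) :
    ∃ y : Rn n, volume.real (Metric.ball y s \ E) * volume.real E ≤
      volume.real (Metric.ball (0 : Rn n) s) * (s * (perimeter E).toReal) := by
  -- it suffices to treat a Borel representative
  wlog hmeas : MeasurableSet E generalizing E
  · obtain ⟨E', hE'E, hE'm, hE'⟩ := hm.exists_measurable_subset_ae_eq
    obtain ⟨y, hy⟩ := this hE'm.nullMeasurableSet (hb.subset hE'E)
      (by rwa [perimeter_congr hE']) (by rwa [measure_congr hE']) hE'm
    refine ⟨y, ?_⟩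
    rw [perimeter_congr hE', measureReal_congr hE',
      measureReal_congr ((ae_eq_refl (Metric.ball y s)).diff hE')] at hy
    exact hy
  have hvE : volume E ≠ ⊤ := hb.measure_lt_top.ne
  set c : ℝ := s * (perimeter E).toReal with hc
  -- the pairs `(y, w)` for which the translation by `w` moves `y` out of `E`; the measure of this
  -- set is computed in both orders of integration
  let D : Set (Rn n × Rn n) := {p | p.1 ∈ E ∧ p.2 ∈ Metric.ball 0 s ∧ p.1 + p.2 ∉ E}
  have hD : MeasurableSet D := by
    have h1 : MeasurableSet {p : Rn n × Rn n | p.1 ∈ E} := measurable_fst hmeas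
    have h2 : MeasurableSet {p : Rn n × Rn n | p.2 ∈ Metric.ball 0 s} :=
      measurable_snd Metric.isOpen_ball.measurableSet
    have h3 : MeasurableSet {p : Rn n × Rn n | p.1 + p.2 ∈ E} :=
      (measurable_fst.add measurable_snd) hmeas
    exact h1.inter (h2.inter h3.compl)
  have hD1 : (volume.prod volume) D = ∫⁻ y in E, volume (Metric.ball y s \ E) := by
    rw [Measure.prod_apply hD, ← lintegral_indicator hmeas]
    refine lintegral_congr fun y => ?_
    by_cases hy : y ∈ E
    · rw [Set.indicator_of_mem hy]
      have : Prod.mk y ⁻¹' D = (fun w => y + w) ⁻¹' (Metric.ball y s \ E) := by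
        ext w
        simp [D, hy]
      rw [this, measure_preimage_add]
    · rw [Set.indicator_of_notMem hy]
      have : Prod.mk y ⁻¹' D = ∅ := by
        ext w
        simp [D, hy]
      rw [this, measure_empty]
  have hD2 : (volume.prod volume) D ≤ volume (Metric.ball (0 : Rn n) s) * ENNReal.ofReal c := by
    rw [Measure.prod_apply_symm hD]
    calc ∫⁻ w, volume ((fun y => (y, w)) ⁻¹' D)
        ≤ ∫⁻ w, (Metric.ball (0 : Rn n) s).indicator (fun _ => ENNReal.ofReal c) w := by
          refine lintegral_mono fun w => ?_
          by_cases hw : w ∈ Metric.ball (0 : Rn n) s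
          · rw [Set.indicator_of_mem hw]
            have h1 : (fun y => (y, w)) ⁻¹' D ⊆ {x | x ∈ E ∧ x + w ∉ E} := fun y hy =>
              ⟨hy.1, hy.2.2⟩
            refine (measure_mono h1).trans ((volume_translate_diff_le hm hb hE w).trans ?_)
            refine ENNReal.ofReal_le_ofReal (mul_le_mul_of_nonneg_right ?_ ENNReal.toReal_nonneg)
            exact (mem_ball_zero_iff.1 hw).le
          · rw [Set.indicator_of_notMem hw]
            have : (fun y => (y, w)) ⁻¹' D = ∅ := by
              ext y
              have hw' : w ∉ Metric.ball (0 : Rn n) s := hw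
              simp only [Set.mem_preimage, Set.mem_empty_iff_false, iff_false]
              exact fun h => hw' h.2.1
            rw [this, measure_empty]
      _ = volume (Metric.ball (0 : Rn n) s) * ENNReal.ofReal c := by
          rw [lintegral_indicator Metric.isOpen_ball.measurableSet, setLIntegral_const, mul_comm]
  have hmeasf : Measurable (fun y : Rn n => volume (Metric.ball y s \ E)) := by
    have h2 : MeasurableSet {p : Rn n × Rn n | p.2 ∈ Metric.ball p.1 s} := by
      have : {p : Rn n × Rn n | p.2 ∈ Metric.ball p.1 s} = {p | dist p.2 p.1 < s} := rfl
      rw [this]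
      exact measurableSet_lt (measurable_snd.dist measurable_fst) measurable_const
    have h3 : MeasurableSet {p : Rn n × Rn n | p.2 ∈ Metric.ball p.1 s \ E} :=
      h2.diff (measurable_snd hmeas)
    exact measurable_measure_prodMk_left h3
  obtain ⟨y, -, hy⟩ := exists_le_setLAverage h0 hvE hmeasf.aemeasurable
  rw [setLAverage_eq, ← hD1] at hy
  refine ⟨y, ?_⟩
  have h1 : volume (Metric.ball y s \ E) * volume E ≤
      volume (Metric.ball (0 : Rn n) s) * ENNReal.ofReal c :=
    ((ENNReal.le_div_iff_mul_le (Or.inl h0) (Or.inl hvE)).1 hy).trans hD2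
  rcases le_or_gt 0 s with hs | hs
  · have hc0 : 0 ≤ c := mul_nonneg hs ENNReal.toReal_nonneg
    have h2 := ENNReal.toReal_mono (ENNReal.mul_ne_top measure_ball_lt_top.ne
      ENNReal.ofReal_ne_top) h1
    rwa [ENNReal.toReal_mul, ENNReal.toReal_mul, ENNReal.toReal_ofReal hc0] at h2
  · simp [Metric.ball_eq_empty.2 hs.le]

/-- An isoperimetric inequality. It follows from `exists_ball_diff_le` for balls of twice the
volume of the set. -/
lemma volume_pow_le_perimeter_pow (hn : 1 ≤ n) (hm : NullMeasurableSet E)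
    (hb : Bornology.IsBounded E) (hE : perimeter E ≠ ⊤) :
    volume.real (Metric.ball (0 : Rn n) 1) * volume.real E ^ n ≤
      2 ^ (n + 1) * volume.real E * (perimeter E).toReal ^ n := by
  set κ := volume.real (Metric.ball (0 : Rn n) 1) with hκ
  have hκ0 : 0 < κ := volume_real_unitBall_pos
  have hvE : volume E ≠ ⊤ := hb.measure_lt_top.ne
  rcases eq_or_ne (volume E) 0 with h0 | h0
  · have : volume.real E = 0 := by simp [Measure.real, h0]
    simp [this, show n ≠ 0 by omega]
  set a := volume.real E with ha
  have ha0 : 0 < a := ENNReal.toReal_pos h0 hvE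
  set ρ : ℝ := (2 * a / κ) ^ ((n : ℝ)⁻¹) with hρ
  have hρ0 : 0 ≤ ρ := by positivity
  have hρn : ρ ^ n = 2 * a / κ := Real.rpow_inv_natCast_pow (by positivity) (by omega)
  obtain ⟨y, hy⟩ := exists_ball_diff_le hm hb hE h0 ρ
  have hball : ∀ y : Rn n, volume.real (Metric.ball y ρ) = 2 * a := fun y => by
    rw [volume_real_ball hn y hρ0, hρn, div_mul_cancel₀ _ hκ0.ne']
  rw [hball] at hy
  have h1 : a ≤ volume.real (Metric.ball y ρ \ E) := by
    have := measureReal_union_le (μ := volume) (Metric.ball y ρ \ E) E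
    rw [Set.sdiff_union_self] at this
    have h2 : volume.real (Metric.ball y ρ) ≤ volume.real (Metric.ball y ρ ∪ E) :=
      measureReal_mono Set.subset_union_left
        (measure_union_lt_top measure_ball_lt_top hvE.lt_top).ne
    rw [hball] at h2
    linarith
  have h2 : a ≤ 2 * (ρ * (perimeter E).toReal) := by
    have h3 : a * a ≤ (2 * (ρ * (perimeter E).toReal)) * a := by
      calc a * a ≤ volume.real (Metric.ball y ρ \ E) * a :=
            mul_le_mul_of_nonneg_right h1 ha0.le
        _ ≤ _ := hy
        _ = _ := by ring
    exact le_of_mul_le_mul_right h3 ha0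
  calc κ * a ^ n ≤ κ * (2 * (ρ * (perimeter E).toReal)) ^ n :=
        mul_le_mul_of_nonneg_left (pow_le_pow_left₀ ha0.le h2 n) hκ0.le
    _ = 2 ^ (n + 1) * a * (perimeter E).toReal ^ n := by
        rw [mul_pow, mul_pow, hρn]
        field_simp
        ring

end Translation

/-! ### Density estimate for sets that are minimal under enlargement -/

section Density

variable {n : ℕ} {E : Set (Rn n)}

lemma measureReal_diff_sub_le {A B : Set (Rn n)} (hA : MeasurableSet A) (hAB : A ⊆ B)
    (hB : volume B ≠ ⊤) :
    volume.real (B \ E) - volume.real (A \ E) ≤ volume.real B - volume.real A := by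
  have hBA : volume.real B - volume.real A = volume.real (B \ A) := by
    have := measureReal_sdiff_add_inter (μ := volume) (s := B) (t := A) hA hB
    rw [Set.inter_eq_self_of_subset_right hAB] at this
    linarith
  rw [hBA, sub_le_iff_le_add]
  refine (measureReal_mono ?_ ?_).trans (measureReal_union_le _ _)
  · intro x hx
    by_cases hxA : x ∈ A
    · exact Or.inr ⟨hxA, hx.2⟩
    · exact Or.inl ⟨hx.1, hxA⟩
  · refine ((measure_mono ?_).trans_lt hB.lt_top).ne
    exact Set.union_subset Set.sdiff_subset (Set.sdiff_subset.trans hAB)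

/-- Balls of radius `σ` whose centre moves with speed at most one are nested. -/
lemma ball_add_smul_subset {z v : Rn n} (hv : ‖v‖ ≤ 1) {a b : ℝ} (hab : a ≤ b) :
    Metric.ball (z + a • v) a ⊆ Metric.ball (z + b • v) b := by
  refine Metric.ball_subset_ball' ?_
  rw [dist_add_left, dist_eq_norm, ← sub_smul, norm_smul, Real.norm_eq_abs, abs_sub_comm,
    abs_of_nonneg (sub_nonneg.2 hab)]
  have := mul_le_of_le_one_right (sub_nonneg.2 hab) hv
  linarith

lemma continuousOn_measureReal_ball_diff (hn : 1 ≤ n) (z : Rn n) {v : Rn n} (hv1 : ‖v‖ ≤ 1) :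
    ContinuousOn (fun σ : ℝ => volume.real (Metric.ball (z + σ • v) σ \ E)) (Set.Ici 0) := by
  have hv : ∀ a b : ℝ, 0 ≤ a → a ≤ b →
      |volume.real (Metric.ball (z + b • v) b \ E) - volume.real (Metric.ball (z + a • v) a \ E)|
        ≤ |b ^ n * volume.real (Metric.ball (0 : Rn n) 1)
          - a ^ n * volume.real (Metric.ball (0 : Rn n) 1)| := by
    intro a b ha hab
    have h1 := measureReal_diff_sub_le (E := E)
      (Metric.isOpen_ball (x := z + a • v) (ε := a)).measurableSet
      (ball_add_smul_subset hv1 hab) measure_ball_lt_top.ne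
    rw [volume_real_ball hn _ ha, volume_real_ball hn _ (ha.trans hab)] at h1
    have h2 : volume.real (Metric.ball (z + a • v) a \ E)
        ≤ volume.real (Metric.ball (z + b • v) b \ E) :=
      measureReal_mono (Set.sdiff_subset_sdiff_left (ball_add_smul_subset hv1 hab))
        ((measure_mono Set.sdiff_subset).trans_lt measure_ball_lt_top).ne
    rw [abs_of_nonneg (sub_nonneg.2 h2)]
    exact h1.trans (le_abs_self _)
  intro a ha
  have hc : Tendsto (fun b : ℝ => |b ^ n * volume.real (Metric.ball (0 : Rn n) 1)
      - a ^ n * volume.real (Metric.ball (0 : Rn n) 1)|) (𝓝[Set.Ici 0] a) (𝓝 0) := by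
    have : Continuous (fun b : ℝ => |b ^ n * volume.real (Metric.ball (0 : Rn n) 1)
      - a ^ n * volume.real (Metric.ball (0 : Rn n) 1)|) := by fun_prop
    have h := this.tendsto a
    simp only [sub_self, abs_zero] at h
    exact h.mono_left nhdsWithin_le_nhds
  refine tendsto_iff_dist_tendsto_zero.2 (squeeze_zero' (Eventually.of_forall fun _ => dist_nonneg)
    ?_ hc)
  filter_upwards [self_mem_nhdsWithin] with b hb
  rw [Real.dist_eq]
  rcases le_total a b with h | h
  · exact hv a b ha h
  · rw [abs_sub_comm, abs_sub_comm (b ^ n * _)]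
    exact hv b a hb h

/-- A continuous function on `[s, t]` has a point of `(s, t]` at which its backward difference
quotients are at most the mean slope. -/
lemma exists_backward_slope_le {h : ℝ → ℝ} {s t : ℝ} (hst : s < t)
    (hc : ContinuousOn h (Set.Icc s t)) : ∃ s' ∈ Set.Ioc s t,
      ∀ᶠ τ in 𝓝[>] (0 : ℝ), h s' - h (s' - τ) ≤ (h t - h s) / (t - s) * τ := by
  set m := (h t - h s) / (t - s) with hmdef
  have hts : 0 < t - s := sub_pos.2 hst
  have hm : m * (t - s) = h t - h s := div_mul_cancel₀ _ hts.ne'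
  -- a minimum point of `h σ - m σ`; this function has equal values at `s` and `t`
  obtain ⟨x, hx, hmin⟩ := isCompact_Icc.exists_isMinOn (Set.nonempty_Icc.2 hst.le)
    (hc.sub (continuousOn_const.mul continuousOn_id) : ContinuousOn (fun σ => h σ - m * σ) _)
  have hmin' : ∀ σ ∈ Set.Icc s t, h x - m * x ≤ h σ - m * σ := fun σ hσ => hmin hσ
  obtain ⟨x', hx', hmin2⟩ : ∃ x' ∈ Set.Ioc s t, ∀ σ ∈ Set.Icc s t,
      h x' - m * x' ≤ h σ - m * σ := by
    rcases eq_or_lt_of_le hx.1 with h1 | h1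
    · refine ⟨t, ⟨hst, le_rfl⟩, fun σ hσ => ?_⟩
      have := hmin' σ hσ
      rw [← h1] at this
      linarith
    · exact ⟨x, ⟨h1, hx.2⟩, hmin'⟩
  refine ⟨x', hx', ?_⟩
  filter_upwards [Ioo_mem_nhdsGT (sub_pos.2 hx'.1)] with τ hτ
  have := hmin2 (x' - τ) ⟨by linarith [hτ.2], by linarith [hx'.2, hτ.1]⟩
  linarith

/-- One step of the De Giorgi iteration. Some radius in `(s, t]` has a sphere that cuts `Eᶜ` in an
area of at most the mean rate of growth of `|B_σ \ E|`; comparing `E` with its union with that ball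
bounds the perimeter of the missing part `B_σ \ E`, and the isoperimetric inequality bounds its
volume. -/
lemma exists_volume_ball_diff_pow_le : ∃ C : ℝ, 0 < C ∧
    ∀ (n : ℕ) (E : Set (Rn n)) (Λ : ℝ) (z : Rn n) (s t : ℝ), 2 ≤ n → 0 ≤ Λ → perimeter E ≠ ⊤ →
      NullMeasurableSet E → (∀ r : ℝ, perimeter E ≤ perimeter (E ∪ Metric.ball z r) +
        ENNReal.ofReal Λ * volume (Metric.ball z r \ E)) → 0 ≤ s → s < t → t ≤ s + 1 →
      volume.real (Metric.ball (0 : Rn n) 1) * volume.real (Metric.ball z s \ E) ^ (n - 1) ≤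
        2 ^ (n + 1) * ((C + Λ) / (t - s) * volume.real (Metric.ball z t \ E)) ^ n := by
  obtain ⟨C, hC0, hC⟩ := exists_perimeter_union_ball_add_diff_le
  refine ⟨C, hC0, fun n E Λ z s t hn hΛ hE hm hmin hs hst ht1 => ?_⟩
  have hmb : ∀ r, volume (Metric.ball z r \ E) ≠ ⊤ := fun r =>
    ((measure_mono Set.sdiff_subset).trans_lt measure_ball_lt_top).ne
  set h : ℝ → ℝ := fun σ => volume.real (Metric.ball z σ \ E) with hh
  have hmono : ∀ a b, a ≤ b → h a ≤ h b := fun a b hab =>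
    measureReal_mono (Set.sdiff_subset_sdiff_left (Metric.ball_subset_ball hab)) (hmb b)
  have h0 : ∀ a, 0 ≤ h a := fun a => measureReal_nonneg
  have hcont : ContinuousOn h (Set.Ici 0) := by
    simpa using continuousOn_measureReal_ball_diff (E := E) (by omega) z (v := 0) (by simp)
  obtain ⟨s', hs', hslope⟩ := exists_backward_slope_le hst (hcont.mono fun x hx => hs.trans hx.1)
  have hts : 0 < t - s := sub_pos.2 hst
  obtain ⟨hU, hD, hle⟩ := hC n E z s' _ hE hm (hs.trans_lt hs'.1) hslope
  have hmin' : (perimeter E).toReal ≤ (perimeter (E ∪ Metric.ball z s')).toReal + Λ * h s' := by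
    have h1 := ENNReal.toReal_mono (ENNReal.add_ne_top.2 ⟨hU, ENNReal.mul_ne_top
      ENNReal.ofReal_ne_top (hmb s')⟩) (hmin s')
    rwa [ENNReal.toReal_add hU (ENNReal.mul_ne_top ENNReal.ofReal_ne_top (hmb s')),
      ENNReal.toReal_mul, ENNReal.toReal_ofReal hΛ] at h1
  have hP : (perimeter (Metric.ball z s' \ E)).toReal ≤ (C + Λ) / (t - s) * h t := by
    have h1 : C * ((h t - h s) / (t - s)) ≤ C / (t - s) * h t := by
      rw [mul_div_assoc', div_mul_eq_mul_div]
      refine div_le_div_of_nonneg_right ?_ hts.le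
      nlinarith [h0 s]
    have h2 : Λ * h s' ≤ Λ / (t - s) * h t := by
      have h3 : Λ ≤ Λ / (t - s) := by
        rw [le_div_iff₀ hts]
        nlinarith
      exact mul_le_mul h3 (hmono _ _ hs'.2) (h0 _) (hΛ.trans h3)
    calc _ ≤ C * ((h t - h s) / (t - s)) + Λ * h s' := by linarith
      _ ≤ C / (t - s) * h t + Λ / (t - s) * h t := add_le_add h1 h2
      _ = _ := by ring
  -- divide the isoperimetric inequality by the volume to gain a power
  have hiso := volume_pow_le_perimeter_pow (by omega)
    (Metric.isOpen_ball.measurableSet.nullMeasurableSet.diff hm)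
    (Metric.isBounded_ball.subset Set.sdiff_subset) hD
  obtain ⟨k, rfl⟩ : ∃ k, n = k + 1 := ⟨n - 1, by omega⟩
  rw [Nat.add_sub_cancel]
  have hPn : (perimeter (Metric.ball z s' \ E)).toReal ^ (k + 1)
      ≤ ((C + Λ) / (t - s) * h t) ^ (k + 1) := pow_le_pow_left₀ ENNReal.toReal_nonneg hP _
  have hκ : 0 < volume.real (Metric.ball (0 : Rn (k + 1)) 1) := volume_real_unitBall_pos
  rcases (h0 s').eq_or_lt with hz | hz
  · have : h s = 0 := le_antisymm (hz ▸ hmono _ _ hs'.1.le) (h0 s)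
    show _ * h s ^ k ≤ _
    rw [this, zero_pow (by omega), mul_zero]
    have : 0 ≤ (C + Λ) / (t - s) * h t := mul_nonneg (by positivity) (h0 t)
    positivity
  · have h1 : volume.real (Metric.ball (0 : Rn (k + 1)) 1) * h s' ^ k ≤
        2 ^ (k + 1 + 1) * (perimeter (Metric.ball z s' \ E)).toReal ^ (k + 1) := by
      have hiso' : volume.real (Metric.ball (0 : Rn (k + 1)) 1) * h s' ^ (k + 1) ≤
        2 ^ (k + 1 + 1) * h s' * (perimeter (Metric.ball z s' \ E)).toReal ^ (k + 1) := hiso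
      refine le_of_mul_le_mul_right ?_ hz
      calc _ = volume.real (Metric.ball (0 : Rn (k + 1)) 1) * h s' ^ (k + 1) := by ring
        _ ≤ _ := hiso'
        _ = _ := by ring
    calc _ ≤ volume.real (Metric.ball (0 : Rn (k + 1)) 1) * h s' ^ k :=
          mul_le_mul_of_nonneg_left (pow_le_pow_left₀ (h0 s) (hmono _ _ hs'.1.le) k) hκ.le
      _ ≤ _ := h1
      _ ≤ _ := mul_le_mul_of_nonneg_left hPn (by positivity)

/-- A set of the volume of the unit ball which is minimal under adding balls, up to a volume term,
contains a ball whose radius depends only on the dimension, on the constant of the volume term and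
on a bound for the perimeter. -/
lemma exists_radius_ball_ae_subset (n : ℕ) (hn : 2 ≤ n) (Λ P₀ : ℝ) (hΛ : 0 ≤ Λ) (hP₀ : 0 < P₀) :
    ∃ s₀ : ℝ, 0 < s₀ ∧ ∀ E : Set (Rn n), NullMeasurableSet E → Bornology.IsBounded E →
      perimeter E ≤ ENNReal.ofReal P₀ → volume E = volume (Metric.ball (0 : Rn n) 1) →
      (∀ (z : Rn n) (r : ℝ), perimeter E ≤ perimeter (E ∪ Metric.ball z r) +
        ENNReal.ofReal Λ * volume (Metric.ball z r \ E)) →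
      ∃ y : Rn n, volume (Metric.ball y s₀ \ E) = 0 := by
  obtain ⟨C, hC0, hC⟩ := exists_volume_ball_diff_pow_le
  set κ := volume.real (Metric.ball (0 : Rn n) 1) with hκdef
  have hκ : 0 < κ := volume_real_unitBall_pos
  set D := C + Λ with hD
  have hD0 : 0 < D := by positivity
  -- the threshold below which the iteration converges is `c₁ κ s₀ ^ n`
  set c₁ : ℝ := (2 ^ (n + 1 + n ^ 2) * D ^ n)⁻¹ with hc₁
  have hc₁0 : 0 < c₁ := by positivity
  set s₀ : ℝ := min 1 (c₁ * κ / (2 ^ (n + 1) * P₀)) with hs₀def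
  have hs₀ : 0 < s₀ := by positivity
  have hs₀1 : s₀ ≤ 1 := min_le_left _ _
  refine ⟨s₀, hs₀, fun E hm hb hP hvol hmin => ?_⟩
  have hPtop : perimeter E ≠ ⊤ := (hP.trans_lt ENNReal.ofReal_lt_top).ne
  have hPr : (perimeter E).toReal ≤ P₀ := ENNReal.toReal_le_of_le_ofReal hP₀.le hP
  have hvr : volume.real E = κ := by rw [Measure.real, hvol, hκdef, Measure.real]
  obtain ⟨y, hy⟩ := exists_ball_diff_le hm hb hPtop
    (by rw [hvol]; exact (Metric.measure_ball_pos _ _ one_pos).ne') (2 * s₀)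
  refine ⟨y, ?_⟩
  have hmb : ∀ r, volume (Metric.ball y r \ E) ≠ ⊤ := fun r =>
    ((measure_mono Set.sdiff_subset).trans_lt measure_ball_lt_top).ne
  set h : ℝ → ℝ := fun σ => volume.real (Metric.ball y σ \ E) with hh
  have hmono : ∀ a b, a ≤ b → h a ≤ h b := fun a b hab =>
    measureReal_mono (Set.sdiff_subset_sdiff_left (Metric.ball_subset_ball hab)) (hmb b)
  have h0 : ∀ a, 0 ≤ h a := fun a => measureReal_nonneg
  set m : ℝ := c₁ * κ * s₀ ^ n with hm_def
  have hm0 : 0 < m := by positivity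
  have hinit : h (2 * s₀) ≤ m := by
    rw [hvr, volume_real_ball (by omega) 0 (by positivity)] at hy
    have h1 : h (2 * s₀) * κ ≤ ((2 * s₀) ^ n * (2 * s₀ * P₀)) * κ := by
      refine hy.trans ?_
      rw [mul_right_comm]
      refine mul_le_mul_of_nonneg_right ?_ hκ.le
      gcongr
    have h2 := le_of_mul_le_mul_right h1 hκ
    have h3 : s₀ * (2 ^ (n + 1) * P₀) ≤ c₁ * κ := by
      rw [← le_div_iff₀ (by positivity)]
      exact min_le_right _ _
    calc h (2 * s₀) ≤ (2 * s₀) ^ n * (2 * s₀ * P₀) := h2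
      _ = s₀ * (2 ^ (n + 1) * P₀) * s₀ ^ n := by ring
      _ ≤ c₁ * κ * s₀ ^ n := mul_le_mul_of_nonneg_right h3 (by positivity)
  -- the De Giorgi step between the radii `s₀ (1 + 2⁻ᵏ)`, which decrease from `2 s₀` to `s₀`
  have hiter : ∀ k : ℕ, h (s₀ * (1 + (2 ^ k)⁻¹)) ≤ m / (2 ^ k) ^ n := by
    intro k
    induction k with
    | zero => simpa [mul_comm, one_add_one_eq_two] using hinit
    | succ k ih =>
      set a : ℝ := 2 ^ k with ha
      have ha0 : 0 < a := by positivity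
      have ha1 : 1 ≤ a := one_le_pow₀ (by norm_num)
      have hpow : (2 : ℝ) ^ (k + 1) = 2 * a := by rw [pow_succ, mul_comm]
      rw [hpow]
      have hdiff : s₀ * (1 + a⁻¹) - s₀ * (1 + (2 * a)⁻¹) = s₀ / (2 * a) := by
        field_simp
        ring
      have hpos : 0 < s₀ / (2 * a) := by positivity
      have hle1 : s₀ / (2 * a) ≤ 1 := by
        rw [div_le_one (by positivity)]
        linarith
      have hstep := hC n E Λ y (s₀ * (1 + (2 * a)⁻¹)) (s₀ * (1 + a⁻¹)) hn hΛ hPtop hm (hmin y)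
        (by positivity) (by linarith) (by linarith)
      rw [hdiff] at hstep
      have hstep2 : κ * h (s₀ * (1 + (2 * a)⁻¹)) ^ (n - 1) ≤
          κ * (m / (2 * a) ^ n) ^ (n - 1) := by
        refine hstep.trans ?_
        calc 2 ^ (n + 1) * (D / (s₀ / (2 * a)) * h (s₀ * (1 + a⁻¹))) ^ n
            ≤ 2 ^ (n + 1) * (D / (s₀ / (2 * a)) * (m / a ^ n)) ^ n := by
              have := h0 (s₀ * (1 + a⁻¹))
              gcongr
          _ = κ * (m / (2 * a) ^ n) ^ (n - 1) := by
              obtain ⟨j, rfl⟩ : ∃ j, n = j + 1 := ⟨n - 1, by omega⟩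
              rw [Nat.add_sub_cancel]
              have hmm : m ^ (j + 1) = m ^ j * m := pow_succ _ _
              rw [mul_pow, div_pow, div_pow, div_pow, div_pow, hmm]
              have hrel : 2 ^ (j + 1 + 1 + (j + 1) ^ 2) * D ^ (j + 1) * m = κ * s₀ ^ (j + 1) := by
                rw [hm_def, hc₁]
                field_simp
              field_simp
              linear_combination (a * a ^ (j * 2) * a ^ j ^ 2) * hrel
      have hstep3 := le_of_mul_le_mul_left hstep2 hκ
      exact (pow_le_pow_iff_left₀ (h0 _) (by positivity) (by omega)).1 hstep3
  have hzero : h s₀ ≤ 0 := by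
    have hlim : Tendsto (fun k : ℕ => m / ((2 : ℝ) ^ k) ^ n) atTop (𝓝 0) := by
      refine tendsto_const_nhds.div_atTop ?_
      exact (tendsto_pow_atTop (by omega)).comp (tendsto_pow_atTop_atTop_of_one_lt one_lt_two)
    refine ge_of_tendsto hlim (Eventually.of_forall fun k => le_trans (hmono _ _ ?_) (hiter k))
    exact le_mul_of_one_le_right hs₀.le (by simp)
  have h1 : (volume (Metric.ball y s₀ \ E)).toReal = 0 := le_antisymm hzero (h0 s₀)
  exact ((ENNReal.toReal_eq_zero_iff _).1 h1).resolve_right (hmb _)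

end Density

/-! ### Test functions and the Sobolev inequality -/

section TestFunctions

variable {n : ℕ} {φ ψ : Rn n → ℝ}

lemma norm_gradient (φ : Rn n → ℝ) (x : Rn n) : ‖gradient φ x‖ = ‖fderiv ℝ φ x‖ := by
  simp [gradient]

lemma IsTestFunction.differentiable (hφ : IsTestFunction φ) : Differentiable ℝ φ :=
  hφ.1.differentiable (by simp)

lemma IsTestFunction.continuous (hφ : IsTestFunction φ) : Continuous φ := hφ.1.continuous

lemma IsTestFunction.continuous_gradient (hφ : IsTestFunction φ) : Continuous (gradient φ) :=
  (InnerProductSpace.toDual ℝ (Rn n)).symm.continuous.comp (hφ.1.continuous_fderiv (by simp))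

lemma IsTestFunction.hasCompactSupport_gradient (hφ : IsTestFunction φ) :
    HasCompactSupport (gradient φ) := by
  refine (hφ.2.fderiv (𝕜 := ℝ)).mono fun x hx => ?_
  contrapose! hx
  simp only [Function.mem_support, not_not] at hx ⊢
  simp [gradient, hx]

lemma IsTestFunction.memLp (hφ : IsTestFunction φ) (p : ℝ≥0∞) : MemLp φ p volume :=
  hφ.continuous.memLp_of_hasCompactSupport hφ.2

lemma IsTestFunction.memLp_gradient (hφ : IsTestFunction φ) (p : ℝ≥0∞) :
    MemLp (gradient φ) p volume :=
  hφ.continuous_gradient.memLp_of_hasCompactSupport hφ.hasCompactSupport_gradient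

lemma IsTestFunction.zero : IsTestFunction (0 : Rn n → ℝ) :=
  ⟨contDiff_const, HasCompactSupport.zero⟩

lemma IsTestFunction.add (hφ : IsTestFunction φ) (hψ : IsTestFunction ψ) :
    IsTestFunction (φ + ψ) := ⟨hφ.1.add hψ.1, hφ.2.add hψ.2⟩

lemma IsTestFunction.smul (c : ℝ) (hφ : IsTestFunction φ) : IsTestFunction (c • φ) :=
  ⟨hφ.1.const_smul c, hφ.2.smul_left (f := fun _ => c)⟩

lemma IsTestFunction.sub (hφ : IsTestFunction φ) (hψ : IsTestFunction ψ) :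
    IsTestFunction (φ - ψ) := ⟨hφ.1.sub hψ.1, hφ.2.sub hψ.2⟩

lemma IsTestFunction.gradient_add (hφ : IsTestFunction φ) (hψ : IsTestFunction ψ) :
    gradient (φ + ψ) = gradient φ + gradient ψ := by
  ext1 x
  simp [gradient, fderiv_add (hφ.differentiable x) (hψ.differentiable x)]

lemma IsTestFunction.gradient_sub (hφ : IsTestFunction φ) (hψ : IsTestFunction ψ) :
    gradient (φ - ψ) = gradient φ - gradient ψ := by
  ext1 x
  simp [gradient, fderiv_sub (hφ.differentiable x) (hψ.differentiable x)]

lemma IsTestFunction.gradient_smul (hφ : IsTestFunction φ) (c : ℝ) :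
    gradient (c • φ) = c • gradient φ := by
  ext1 x
  simp [gradient, fderiv_const_smul (hφ.differentiable x)]

/-- Integration by parts for test functions. -/
lemma IsTestFunction.integral_smul_gradient (hψ : IsTestFunction ψ) (hφ : IsTestFunction φ) :
    ∫ x, ψ x • gradient φ x = -∫ x, φ x • gradient ψ x := by
  have hi : ∀ {f g : Rn n → ℝ}, IsTestFunction f → IsTestFunction g →
      Integrable (fun x => f x • gradient g x) := fun hf hg =>
    (hf.continuous.smul hg.continuous_gradient).integrable_of_hasCompactSupport hf.2.smul_right
  refine ext_inner_left ℝ fun v => ?_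
  rw [inner_neg_right, ← integral_inner (hi hψ hφ), ← integral_inner (hi hφ hψ)]
  have hin : ∀ {f g : Rn n → ℝ}, ∀ x,
      inner ℝ v (f x • gradient g x) = f x * fderiv ℝ g x v := by
    intro f g x
    rw [inner_smul_right, inner_gradient_right]
    simp
  simp only [hin]
  have hi2 : ∀ {f g : Rn n → ℝ}, IsTestFunction f → IsTestFunction g →
      Integrable (fun x => f x * fderiv ℝ g x v) := fun {f g} hf hg => by
    have := (hi hf hg).const_inner (𝕜 := ℝ) v
    simpa only [hin] using this
  rw [integral_mul_fderiv_eq_neg_fderiv_mul_of_integrable (by simpa [mul_comm] using hi2 hφ hψ)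
    (hi2 hψ hφ) ((hψ.continuous.mul hφ.continuous).integrable_of_hasCompactSupport hψ.2.mul_right)
    (fun x _ => hψ.differentiable x) (fun x _ => hφ.differentiable x)]
  simp only [mul_comm]

lemma two_le_sobolevExponent (hn : 3 ≤ n) : 2 ≤ sobolevExponent n := by
  have h3 : (3 : ℝ) ≤ n := by exact_mod_cast hn
  rw [sobolevExponent, show (2 : ℝ≥0∞) = ENNReal.ofReal 2 by simp]
  refine ENNReal.ofReal_le_ofReal ?_
  rw [le_div_iff₀ (by linarith)]
  linarith

/-- The Gagliardo–Nirenberg–Sobolev inequality for test functions. -/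
lemma exists_sobolev (hn : 3 ≤ n) : ∃ C : NNReal, ∀ φ : Rn n → ℝ, IsTestFunction φ →
    eLpNorm φ (sobolevExponent n) volume ≤ C * eLpNorm (gradient φ) 2 volume := by
  have h3 : (3 : ℝ) ≤ n := by exact_mod_cast hn
  refine ⟨SNormLESNormFDerivOfEqConst ℝ (volume : Measure (Rn n)) 2, fun φ hφ => ?_⟩
  have hfr : Module.finrank ℝ (Rn n) = n := finrank_euclideanSpace_fin
  have h := eLpNorm_le_eLpNorm_fderiv_of_eq (volume : Measure (Rn n)) (u := φ) (p := 2)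
    (p' := (2 * (n : ℝ) / ((n : ℝ) - 2)).toNNReal) (hφ.1.of_le (by simp)) hφ.2
    (by norm_num) (by omega) (by
      rw [Real.coe_toNNReal _ (div_nonneg (by linarith) (by linarith)), hfr]
      have : (n : ℝ) - 2 ≠ 0 := by linarith
      have : (n : ℝ) ≠ 0 := by linarith
      push_cast
      field_simp)
  have hg : eLpNorm (fderiv ℝ φ) 2 volume = eLpNorm (gradient φ) 2 volume :=
    eLpNorm_congr_norm_ae (ae_of_all _ fun x => (norm_gradient φ x).symm)
  rw [← hg]
  exact h

lemma integral_norm_sq_eq {α H : Type*} {m : MeasurableSpace α} {μ : Measure α}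
    [NormedAddCommGroup H] {f : α → H} (hf : MemLp f 2 μ) :
    ∫ x, ‖f x‖ ^ 2 ∂μ = (eLpNorm f 2 μ).toReal ^ 2 := by
  have h0 : 0 ≤ ∫ x, ‖f x‖ ^ 2 ∂μ := integral_nonneg fun x => by positivity
  rw [hf.eLpNorm_eq_integral_rpow_norm (by simp) (by simp)]
  simp only [ENNReal.toReal_ofNat, Real.rpow_ofNat]
  rw [ENNReal.toReal_ofReal (by positivity), ← Real.rpow_natCast, ← Real.rpow_mul h0]
  norm_num

lemma exists_integral_sq_le (hn : 3 ≤ n) : ∃ C : ℝ, 0 < C ∧ ∀ N : Set (Rn n),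
    volume N ≤ volume (Metric.ball (0 : Rn n) 1) → ∀ φ : Rn n → ℝ, IsTestFunction φ →
      ∫ x in N, φ x ^ 2 ≤ C * ∫ x, ‖gradient φ x‖ ^ 2 := by
  obtain ⟨C, hC⟩ := exists_sobolev hn
  set e : ℝ := 1 / (2 : ℝ≥0∞).toReal - 1 / (sobolevExponent n).toReal with he
  have he0 : 0 ≤ e := by
    have h2 := ENNReal.toReal_mono (b := sobolevExponent n) ENNReal.ofReal_ne_top
      (two_le_sobolevExponent hn)
    rw [he, sub_nonneg]
    exact one_div_le_one_div_of_le (by norm_num) h2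
  set κ := volume (Metric.ball (0 : Rn n) 1) with hκ
  have hκt : κ ≠ ⊤ := measure_ball_lt_top.ne
  set D : ℝ := (C * κ ^ e : ℝ≥0∞).toReal with hD
  have hDt : (C * κ ^ e : ℝ≥0∞) ≠ ⊤ :=
    ENNReal.mul_ne_top ENNReal.coe_ne_top (ENNReal.rpow_ne_top_of_nonneg he0 hκt)
  refine ⟨D ^ 2 + 1, by positivity, fun N hN φ hφ => ?_⟩
  have h1 : eLpNorm φ 2 (volume.restrict N) ≤ (C * κ ^ e) * eLpNorm (gradient φ) 2 volume := by
    calc eLpNorm φ 2 (volume.restrict N)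
        ≤ eLpNorm φ (sobolevExponent n) (volume.restrict N) * (volume.restrict N) Set.univ ^ e :=
          eLpNorm_le_eLpNorm_mul_rpow_measure_univ (two_le_sobolevExponent hn)
            hφ.continuous.aestronglyMeasurable
      _ ≤ (C * eLpNorm (gradient φ) 2 volume) * κ ^ e := by
          refine mul_le_mul' ?_ ?_
          · exact (eLpNorm_mono_measure _ Measure.restrict_le_self).trans (hC φ hφ)
          · rw [Measure.restrict_apply_univ]
            exact ENNReal.rpow_le_rpow hN he0
      _ = _ := by ring
  have h2 := integral_norm_sq_eq ((hφ.memLp 2).restrict N)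
  have h3 := integral_norm_sq_eq (hφ.memLp_gradient 2)
  simp only [Real.norm_eq_abs, sq_abs] at h2
  rw [h2, h3]
  have h4 := ENNReal.toReal_mono (ENNReal.mul_ne_top hDt (hφ.memLp_gradient 2).eLpNorm_ne_top) h1
  rw [ENNReal.toReal_mul] at h4
  calc _ ≤ (D * (eLpNorm (gradient φ) 2 volume).toReal) ^ 2 :=
        pow_le_pow_left₀ ENNReal.toReal_nonneg h4 2
    _ ≤ _ := by
        rw [mul_pow]
        exact mul_le_mul_of_nonneg_right (by linarith) (by positivity)

lemma exists_tendsto_eLpNorm_sub {α H : Type*} {m : MeasurableSpace α} {μ : Measure α}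
    [NormedAddCommGroup H] [CompleteSpace H] {p : ℝ≥0∞} (hp : 1 ≤ p) {f : ℕ → α → H}
    (hf : ∀ k, MemLp (f k) p μ)
    (hc : ∀ ε > 0, ∃ N, ∀ k, N ≤ k → ∀ l, N ≤ l → eLpNorm (f k - f l) p μ < ε) :
    ∃ g, MemLp g p μ ∧ Tendsto (fun k => eLpNorm (f k - g) p μ) atTop (𝓝 0) := by
  have : Fact (1 ≤ p) := ⟨hp⟩
  have hC : CauchySeq (fun k => (hf k).toLp (f k)) := by
    refine EMetric.cauchySeq_iff.2 fun ε hε => ?_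
    obtain ⟨N, hN⟩ := hc ε hε
    exact ⟨N, fun k hk l hl => by rw [Lp.edist_toLp_toLp]; exact hN k hk l hl⟩
  obtain ⟨g, hg⟩ := cauchySeq_tendsto_of_complete hC
  refine ⟨g, Lp.memLp g, ?_⟩
  have h := (Lp.tendsto_Lp_iff_tendsto_eLpNorm'' f hf g (Lp.memLp g)).1
    (by rwa [Lp.toLp_coeFn])
  exact h

/-- A sequence of test functions whose gradients converge in `L²` has a limit in `D¹`. -/
lemma exists_memD1_of_cauchy (hn : 3 ≤ n) {φ : ℕ → Rn n → ℝ} (hφ : ∀ k, IsTestFunction (φ k))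
    (hc : ∀ ε > 0, ∃ N, ∀ k, N ≤ k → ∀ l, N ≤ l →
      eLpNorm (gradient (φ k) - gradient (φ l)) 2 volume < ε) :
    ∃ u g, MemD1 u g ∧ Tendsto (fun k => eLpNorm (gradient (φ k) - g) 2 volume) atTop (𝓝 0) ∧
      Tendsto (fun k => eLpNorm (φ k - u) (sobolevExponent n) volume) atTop (𝓝 0) := by
  obtain ⟨C, hC⟩ := exists_sobolev hn
  have h1S : 1 ≤ sobolevExponent n := le_trans (by norm_num) (two_le_sobolevExponent hn)
  obtain ⟨g, hg, hgl⟩ := exists_tendsto_eLpNorm_sub (by norm_num)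
    (fun k => (hφ k).memLp_gradient 2) hc
  obtain ⟨u, hu, hul⟩ := exists_tendsto_eLpNorm_sub h1S
    (fun k => (hφ k).memLp (sobolevExponent n)) fun ε hε => by
      have hC1 : (C : ℝ≥0∞) + 1 ≠ 0 := by simp
      have hC1t : (C : ℝ≥0∞) + 1 ≠ ⊤ := by simp
      obtain ⟨N, hN⟩ := hc (ε / (C + 1)) (ENNReal.div_pos hε.ne' hC1t)
      refine ⟨N, fun k hk l hl => ?_⟩
      refine (hC _ ((hφ k).sub (hφ l))).trans_lt ?_
      rw [(hφ k).gradient_sub (hφ l)]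
      calc (C : ℝ≥0∞) * eLpNorm (gradient (φ k) - gradient (φ l)) 2 volume
          ≤ (C + 1) * eLpNorm (gradient (φ k) - gradient (φ l)) 2 volume :=
            mul_le_mul_left le_self_add _
        _ < ε := by
            rw [mul_comm]
            exact ENNReal.mul_lt_of_lt_div (hN k hk l hl)
  refine ⟨u, g, ⟨hu, hg, ⟨hu.locallyIntegrable h1S, hg.locallyIntegrable (by norm_num), ?_⟩,
    φ, hφ, hgl⟩, hgl, hul⟩
  intro χ hχ
  -- pass to the limit in the integration by parts formula
  have key : ∀ {H : Type} [NormedAddCommGroup H] [NormedSpace ℝ H] [CompleteSpace H]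
      (p : ℝ≥0∞) (_ : 1 ≤ p) (f : ℕ → Rn n → ℝ) (w : Rn n → ℝ) (F : Rn n → H),
      (∀ k, MemLp (f k) p volume) → MemLp w p volume → (∀ q, MemLp F q volume) →
      Tendsto (fun k => eLpNorm (f k - w) p volume) atTop (𝓝 0) →
      Tendsto (fun k => ∫ x, f k x • F x) atTop (𝓝 (∫ x, w x • F x)) := by
    intro H _ _ _ p hp f w F hf hw hF hfw
    have : p.HolderConjugate p.conjExponent := ENNReal.HolderConjugate.conjExponent hp
    have hi : ∀ {f : Rn n → ℝ}, MemLp f p volume → Integrable (fun x => f x • F x) :=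
      fun hf => memLp_one_iff_integrable.1 (MemLp.smul (hF p.conjExponent) hf)
    refine tendsto_integral_of_L1' _ (hi hw).aestronglyMeasurable
      (Eventually.of_forall fun k => hi (hf k)) ?_
    have hb : Tendsto (fun k => eLpNorm (f k - w) p volume * eLpNorm F p.conjExponent volume)
        atTop (𝓝 0) := by
      have := ENNReal.Tendsto.mul_const (b := eLpNorm F p.conjExponent volume) hfw
        (Or.inr (hF _).eLpNorm_ne_top)
      rwa [zero_mul] at this
    refine tendsto_of_tendsto_of_tendsto_of_le_of_le tendsto_const_nhds hb
      (fun _ => zero_le) fun k => ?_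
    have h1 : (fun x => f k x • F x) - (fun x => w x • F x) = (f k - w) • F := by
      ext1 x
      simp [sub_smul]
    rw [h1]
    exact eLpNorm_smul_le_mul_eLpNorm (hF 1).aestronglyMeasurable
      ((hf k).sub hw).aestronglyMeasurable
  have hl1 : Tendsto (fun k => ∫ x, φ k x • gradient χ x) atTop
      (𝓝 (∫ x, u x • gradient χ x)) :=
    key _ h1S φ u (gradient χ) (fun k => (hφ k).memLp _) hu hχ.memLp_gradient hul
  have hl2 : Tendsto (fun k => ∫ x, χ x • gradient (φ k) x) atTop (𝓝 (∫ x, χ x • g x)) := by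
    have : ENNReal.HolderConjugate 2 2 := inferInstance
    have hi : ∀ {G : Rn n → Rn n}, MemLp G 2 volume → Integrable (fun x => χ x • G x) :=
      fun hG => memLp_one_iff_integrable.1 (MemLp.smul (p := 2) (q := 2) hG (hχ.memLp 2))
    refine tendsto_integral_of_L1' _ (hi hg).aestronglyMeasurable
      (Eventually.of_forall fun k => hi ((hφ k).memLp_gradient 2)) ?_
    have hb : Tendsto (fun k => eLpNorm χ 2 volume * eLpNorm (gradient (φ k) - g) 2 volume)
        atTop (𝓝 0) := by
      have := ENNReal.Tendsto.const_mul (a := eLpNorm χ 2 volume) hgl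
        (Or.inr (hχ.memLp 2).eLpNorm_ne_top)
      rwa [mul_zero] at this
    refine tendsto_of_tendsto_of_tendsto_of_le_of_le tendsto_const_nhds hb
      (fun _ => zero_le) fun k => ?_
    have h1 : (fun x => χ x • gradient (φ k) x) - (fun x => χ x • g x)
        = χ • (gradient (φ k) - g) := by
      ext1 x
      simp [smul_sub]
    rw [h1]
    exact eLpNorm_smul_le_mul_eLpNorm (((hφ k).memLp_gradient 2).sub hg).aestronglyMeasurable
      (hχ.memLp 2).aestronglyMeasurable
  refine tendsto_nhds_unique hl1 (hl2.neg.congr fun k => ?_)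
  rw [(hφ k).integral_smul_gradient hχ]

end TestFunctions

/-! ### The electrostatic form and the capacity -/

section Form

variable {n : ℕ} {β K : ℝ} {E : Set (Rn n)}

/-- The bilinear form of the electrostatic energy on pairs `(g, v)` of a vector field and a
function. The pair `(g, K ρ)` has the energy `∫ a_E |g|² + K ∫_E ρ²`. -/
noncomputable def energyForm (β K : ℝ) (E : Set (Rn n)) (p q : (Rn n → Rn n) × (Rn n → ℝ)) : ℝ :=
  (∫ x, inner ℝ (p.1 x) (q.1 x)) + (β - 1) * (∫ x in E, inner ℝ (p.1 x) (q.1 x)) +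
    K⁻¹ * ∫ x in E, p.2 x * q.2 x

/-- Pairs on which `energyForm` is finite. -/
def IsL2Pair (E : Set (Rn n)) (p : (Rn n → Rn n) × (Rn n → ℝ)) : Prop :=
  MemLp p.1 2 volume ∧ MemLp p.2 2 (volume.restrict E)

/-- The pair `(∇φ, -φ)`. -/
noncomputable def testPair (φ : Rn n → ℝ) : (Rn n → Rn n) × (Rn n → ℝ) := (gradient φ, -φ)

/-- The pair `(0, 1)`. -/
def onePair : (Rn n → Rn n) × (Rn n → ℝ) := (0, 1)

/-- The infimum of `∫ a_E |∇φ|² + K⁻¹ ∫_E (1 - φ)²` over test functions `φ`. It is the reciprocal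
of `𝒢_{β,K}(E)`, see `G_eq_inv_capacity`. -/
noncomputable def capacity (β K : ℝ) (E : Set (Rn n)) : ℝ :=
  ⨅ φ : {φ : Rn n → ℝ // IsTestFunction φ},
    energyForm β K E (onePair + testPair φ.1) (onePair + testPair φ.1)

lemma IsL2Pair.add {p q : (Rn n → Rn n) × (Rn n → ℝ)} (hp : IsL2Pair E p) (hq : IsL2Pair E q) :
    IsL2Pair E (p + q) := ⟨hp.1.add hq.1, hp.2.add hq.2⟩

lemma IsL2Pair.sub {p q : (Rn n → Rn n) × (Rn n → ℝ)} (hp : IsL2Pair E p) (hq : IsL2Pair E q) :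
    IsL2Pair E (p - q) := ⟨hp.1.sub hq.1, hp.2.sub hq.2⟩

lemma IsL2Pair.smul (c : ℝ) {p : (Rn n → Rn n) × (Rn n → ℝ)} (hp : IsL2Pair E p) :
    IsL2Pair E (c • p) := ⟨hp.1.const_smul c, hp.2.const_smul c⟩

lemma IsTestFunction.isL2Pair {φ : Rn n → ℝ} (hφ : IsTestFunction φ) : IsL2Pair E (testPair φ) :=
  ⟨hφ.memLp_gradient 2, (hφ.memLp 2).neg.restrict E⟩

lemma isL2Pair_onePair (hE : volume E ≠ ⊤) : IsL2Pair E (onePair (n := n)) := by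
  have : IsFiniteMeasure (volume.restrict E) := isFiniteMeasure_restrict.2 hE
  exact ⟨MemLp.zero, memLp_const 1⟩

lemma IsTestFunction.testPair_add {φ ψ : Rn n → ℝ} (hφ : IsTestFunction φ)
    (hψ : IsTestFunction ψ) : testPair (φ + ψ) = testPair φ + testPair ψ := by
  simp [testPair, hφ.gradient_add hψ, add_comm]

lemma IsTestFunction.testPair_smul {φ : Rn n → ℝ} (hφ : IsTestFunction φ) (c : ℝ) :
    testPair (c • φ) = c • testPair φ := by
  simp [testPair, hφ.gradient_smul c]

variable {p q r : (Rn n → Rn n) × (Rn n → ℝ)}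

lemma MemLp.integrable_inner {α H : Type*} {m : MeasurableSpace α} {μ : Measure α}
    [NormedAddCommGroup H] [InnerProductSpace ℝ H] {f g : α → H} (hf : MemLp f 2 μ)
    (hg : MemLp g 2 μ) : Integrable (fun x => inner ℝ (f x) (g x)) μ := by
  refine (L2.integrable_inner (𝕜 := ℝ) hf.toLp hg.toLp).congr ?_
  filter_upwards [hf.coeFn_toLp, hg.coeFn_toLp] with x h1 h2
  rw [h1, h2]

lemma IsL2Pair.integrable_mul (hp : IsL2Pair E p) (hq : IsL2Pair E q) :
    Integrable (fun x => p.2 x * q.2 x) (volume.restrict E) := by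
  have : ENNReal.HolderConjugate 2 2 := inferInstance
  exact MemLp.integrable_mul (p := 2) (q := 2) hp.2 hq.2

lemma energyForm_comm : energyForm β K E p q = energyForm β K E q p := by
  simp only [energyForm, real_inner_comm, mul_comm]

lemma energyForm_add_left (hp : IsL2Pair E p) (hq : IsL2Pair E q) (hr : IsL2Pair E r) :
    energyForm β K E (p + q) r = energyForm β K E p r + energyForm β K E q r := by
  have h1 := MemLp.integrable_inner hp.1 hr.1
  have h2 := MemLp.integrable_inner hq.1 hr.1
  simp only [energyForm, Prod.fst_add, Prod.snd_add, Pi.add_apply, inner_add_left, add_mul]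
  rw [integral_add h1 h2, integral_add h1.integrableOn h2.integrableOn,
    integral_add (hp.integrable_mul hr) (hq.integrable_mul hr)]
  ring

lemma energyForm_smul_left (c : ℝ) :
    energyForm β K E (c • p) r = c * energyForm β K E p r := by
  simp only [energyForm, Prod.smul_fst, Prod.smul_snd, Pi.smul_apply, inner_smul_left,
    smul_eq_mul, mul_assoc, integral_const_mul]
  simp
  ring

lemma energyForm_smul_right (c : ℝ) :
    energyForm β K E p (c • r) = c * energyForm β K E p r := by
  rw [energyForm_comm, energyForm_smul_left, energyForm_comm]

lemma energyForm_sub_left (hp : IsL2Pair E p) (hq : IsL2Pair E q) (hr : IsL2Pair E r) :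
    energyForm β K E (p - q) r = energyForm β K E p r - energyForm β K E q r := by
  have : p - q = p + (-1 : ℝ) • q := by rw [neg_one_smul, sub_eq_add_neg]
  rw [this, energyForm_add_left hp (hq.smul _) hr, energyForm_smul_left]
  ring

lemma energyForm_add_self (hp : IsL2Pair E p) (hq : IsL2Pair E q) :
    energyForm β K E (p + q) (p + q) =
      energyForm β K E p p + 2 * energyForm β K E p q + energyForm β K E q q := by
  rw [energyForm_add_left hp hq (hp.add hq), energyForm_comm (p := p),
    energyForm_comm (p := q), energyForm_add_left hp hq hp, energyForm_add_left hp hq hq,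
    energyForm_comm (p := q) (q := p)]
  ring

lemma energyForm_sub_self (hp : IsL2Pair E p) (hq : IsL2Pair E q) :
    energyForm β K E (p - q) (p - q) =
      energyForm β K E p p - 2 * energyForm β K E p q + energyForm β K E q q := by
  have : p - q = p + (-1 : ℝ) • q := by rw [neg_one_smul, sub_eq_add_neg]
  rw [this, energyForm_add_self hp (hq.smul _), energyForm_smul_left, energyForm_smul_right,
    energyForm_smul_right]
  ring

lemma energyForm_self (p : (Rn n → Rn n) × (Rn n → ℝ)) : energyForm β K E p p =
    (∫ x, ‖p.1 x‖ ^ 2) + (β - 1) * (∫ x in E, ‖p.1 x‖ ^ 2) + K⁻¹ * ∫ x in E, p.2 x ^ 2 := by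
  simp only [energyForm, real_inner_self_eq_norm_sq, sq]

lemma energyForm_self_nonneg (hβ : 1 ≤ β) (hK : 0 < K) : 0 ≤ energyForm β K E p p := by
  rw [energyForm_self]
  have h1 : 0 ≤ ∫ x, ‖p.1 x‖ ^ 2 := integral_nonneg fun x => by positivity
  have h2 : 0 ≤ ∫ x in E, ‖p.1 x‖ ^ 2 := integral_nonneg fun x => by positivity
  have h3 : 0 ≤ ∫ x in E, p.2 x ^ 2 := integral_nonneg fun x => by positivity
  have h4 : 0 ≤ β - 1 := by linarith
  positivity

lemma integral_norm_sq_le_energyForm (hβ : 1 ≤ β) (hK : 0 < K) :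
    ∫ x, ‖p.1 x‖ ^ 2 ≤ energyForm β K E p p := by
  rw [energyForm_self]
  have h2 : 0 ≤ ∫ x in E, ‖p.1 x‖ ^ 2 := integral_nonneg fun x => by positivity
  have h3 : 0 ≤ ∫ x in E, p.2 x ^ 2 := integral_nonneg fun x => by positivity
  have h4 : 0 ≤ β - 1 := by linarith
  have := mul_nonneg h4 h2
  have := mul_nonneg (inv_nonneg.2 hK.le) h3
  linarith

lemma inv_mul_integral_sq_le_energyForm (hβ : 1 ≤ β) :
    K⁻¹ * ∫ x in E, p.2 x ^ 2 ≤ energyForm β K E p p := by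
  rw [energyForm_self]
  have h1 : 0 ≤ ∫ x, ‖p.1 x‖ ^ 2 := integral_nonneg fun x => by positivity
  have h2 : 0 ≤ ∫ x in E, ‖p.1 x‖ ^ 2 := integral_nonneg fun x => by positivity
  have h4 : 0 ≤ β - 1 := by linarith
  have := mul_nonneg h4 h2
  linarith

/-- The Cauchy–Schwarz inequality for `energyForm`. -/
lemma energyForm_sq_le (hβ : 1 ≤ β) (hK : 0 < K) (hp : IsL2Pair E p) (hq : IsL2Pair E q) :
    energyForm β K E p q ^ 2 ≤ energyForm β K E p p * energyForm β K E q q := by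
  have h : ∀ t : ℝ, 0 ≤ energyForm β K E q q * (t * t) + 2 * energyForm β K E p q * t
      + energyForm β K E p p := by
    intro t
    have h1 := energyForm_self_nonneg (E := E) (p := p + t • q) hβ hK
    rw [energyForm_add_self hp (hq.smul t), energyForm_smul_left, energyForm_smul_right,
      energyForm_smul_right] at h1
    linarith
  have := discrim_le_zero h
  rw [discrim] at this
  linarith

lemma tendsto_energyForm (hβ : 1 ≤ β) (hK : 0 < K) {P : ℕ → (Rn n → Rn n) × (Rn n → ℝ)}
    (hP : ∀ k, IsL2Pair E (P k)) (hp : IsL2Pair E p) (hq : IsL2Pair E q)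
    (hlim : Tendsto (fun k => energyForm β K E (P k - p) (P k - p)) atTop (𝓝 0)) :
    Tendsto (fun k => energyForm β K E (P k) q) atTop (𝓝 (energyForm β K E p q)) := by
  rw [tendsto_iff_norm_sub_tendsto_zero]
  have h1 : Tendsto (fun k => Real.sqrt (energyForm β K E (P k - p) (P k - p) *
      energyForm β K E q q)) atTop (𝓝 0) := by
    have := (hlim.mul_const (energyForm β K E q q)).sqrt
    simpa using this
  refine squeeze_zero (fun _ => norm_nonneg _) (fun k => ?_) h1
  rw [← energyForm_sub_left (hP k) hp hq]
  exact Real.abs_le_sqrt (energyForm_sq_le hβ hK ((hP k).sub hp) hq)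

lemma tendsto_energyForm_self (hβ : 1 ≤ β) (hK : 0 < K) {P : ℕ → (Rn n → Rn n) × (Rn n → ℝ)}
    (hP : ∀ k, IsL2Pair E (P k)) (hp : IsL2Pair E p)
    (hlim : Tendsto (fun k => energyForm β K E (P k - p) (P k - p)) atTop (𝓝 0)) :
    Tendsto (fun k => energyForm β K E (P k) (P k)) atTop (𝓝 (energyForm β K E p p)) := by
  have h1 := tendsto_energyForm hβ hK hP hp hp hlim
  have h2 := (hlim.add (h1.const_mul 2)).sub_const (energyForm β K E p p)
  rw [show 0 + 2 * energyForm β K E p p - energyForm β K E p p = energyForm β K E p p by ring] at h2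
  refine h2.congr fun k => ?_
  rw [energyForm_sub_self (hP k) hp]
  ring

lemma capacity_le (hβ : 1 ≤ β) (hK : 0 < K) {φ : Rn n → ℝ} (hφ : IsTestFunction φ) :
    capacity β K E ≤ energyForm β K E (onePair + testPair φ) (onePair + testPair φ) :=
  ciInf_le ⟨0, by rintro _ ⟨ψ, rfl⟩; exact energyForm_self_nonneg hβ hK⟩
    (⟨φ, hφ⟩ : {φ : Rn n → ℝ // IsTestFunction φ})

lemma le_capacity {c : ℝ} (h : ∀ φ : Rn n → ℝ, IsTestFunction φ →
    c ≤ energyForm β K E (onePair + testPair φ) (onePair + testPair φ)) : c ≤ capacity β K E := by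
  have : Nonempty {φ : Rn n → ℝ // IsTestFunction φ} := ⟨⟨0, IsTestFunction.zero⟩⟩
  exact le_ciInf fun φ => h φ.1 φ.2

lemma exists_lt_of_capacity_lt {c : ℝ} (h : capacity β K E < c) : ∃ φ : Rn n → ℝ,
    IsTestFunction φ ∧ energyForm β K E (onePair + testPair φ) (onePair + testPair φ) < c := by
  have : Nonempty {φ : Rn n → ℝ // IsTestFunction φ} := ⟨⟨0, IsTestFunction.zero⟩⟩
  obtain ⟨φ, hφ⟩ := exists_lt_of_ciInf_lt h
  exact ⟨φ.1, φ.2, hφ⟩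

lemma energyForm_onePair_add_testPair (φ : Rn n → ℝ) :
    energyForm β K E (onePair + testPair φ) (onePair + testPair φ) =
      (∫ x, ‖gradient φ x‖ ^ 2) + (β - 1) * (∫ x in E, ‖gradient φ x‖ ^ 2) +
        K⁻¹ * ∫ x in E, (1 - φ x) ^ 2 := by
  rw [energyForm_self]
  simp [onePair, testPair, sub_eq_add_neg]

lemma capacity_le_volume (hβ : 1 ≤ β) (hK : 0 < K) : capacity β K E ≤ K⁻¹ * volume.real E := by
  refine (capacity_le hβ hK IsTestFunction.zero).trans ?_
  rw [energyForm_onePair_add_testPair]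
  have : gradient (0 : Rn n → ℝ) = 0 := gradient_fun_const' (𝕜 := ℝ) (F := Rn n) (0 : ℝ)
  simp [this]

/-- The capacity of a set of the volume of the unit ball is bounded away from zero. -/
lemma exists_le_capacity (hn : 3 ≤ n) {A : ℝ} (hA : 0 < A) : ∃ c : ℝ, 0 < c ∧
    ∀ (β K : ℝ) (E : Set (Rn n)), 1 ≤ β → 0 < K → K ≤ A →
      volume E = volume (Metric.ball (0 : Rn n) 1) → c ≤ capacity β K E := by
  obtain ⟨C, hC0, hC⟩ := exists_integral_sq_le hn
  set κ := volume.real (Metric.ball (0 : Rn n) 1) with hκ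
  have hκ0 : 0 < κ := volume_real_unitBall_pos
  refine ⟨κ / (2 * (A + C)), by positivity, fun β K E hβ hK hKA hE => le_capacity fun φ hφ => ?_⟩
  have hEt : volume E ≠ ⊤ := by rw [hE]; exact measure_ball_lt_top.ne
  set J := energyForm β K E (onePair + testPair φ) (onePair + testPair φ) with hJ
  have h1 : ∫ x, ‖gradient φ x‖ ^ 2 ≤ J := by
    have := integral_norm_sq_le_energyForm (E := E) (p := onePair + testPair φ) hβ hK
    simpa [onePair, testPair, hJ] using this
  have h2 : K⁻¹ * ∫ x in E, (1 - φ x) ^ 2 ≤ J := by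
    have := inv_mul_integral_sq_le_energyForm (E := E) (K := K) (p := onePair + testPair φ) hβ
    simpa [onePair, testPair, sub_eq_add_neg, hJ] using this
  have h3 := hC E hE.le φ hφ
  have hJ0 : 0 ≤ J := energyForm_self_nonneg hβ hK
  rw [inv_mul_le_iff₀ hK] at h2
  have hi : Integrable (fun _ : Rn n => (1 : ℝ)) (volume.restrict E) := integrableOn_const hEt
  have hiφ2 : Integrable (fun x => φ x ^ 2) (volume.restrict E) :=
    ((hφ.memLp 2).integrable_sq).integrableOn
  have hi1φ : Integrable (fun x => (1 - φ x) ^ 2) (volume.restrict E) := by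
    have h := ((isL2Pair_onePair hEt).add hφ.isL2Pair).2.integrable_sq
    simpa [onePair, testPair, sub_eq_add_neg] using h
  have h4 : κ ≤ 2 * (∫ x in E, (1 - φ x) ^ 2) + 2 * ∫ x in E, φ x ^ 2 := by
    calc κ = ∫ _ in E, (1 : ℝ) := by simp [hκ, Measure.real, hE]
      _ ≤ ∫ x in E, (2 * (1 - φ x) ^ 2 + 2 * φ x ^ 2) := by
          refine integral_mono hi ((hi1φ.const_mul 2).add (hiφ2.const_mul 2)) fun x => ?_
          show (1 : ℝ) ≤ 2 * (1 - φ x) ^ 2 + 2 * φ x ^ 2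
          nlinarith [sq_nonneg (1 - 2 * φ x)]
      _ = _ := by
          rw [integral_add (hi1φ.const_mul 2) (hiφ2.const_mul 2), integral_const_mul,
            integral_const_mul]
  rw [div_le_iff₀ (by positivity)]
  have h5 : C * ∫ x, ‖gradient φ x‖ ^ 2 ≤ C * J := mul_le_mul_of_nonneg_left h1 hC0.le
  have h6 : K * J ≤ A * J := mul_le_mul_of_nonneg_right hKA hJ0
  linarith

/-- The Pythagorean identity behind the duality between the energy and the capacity. -/
lemma energyForm_sub_smul (hE : volume E ≠ ⊤) (hp : IsL2Pair E p)
    (h0 : ∀ φ, IsTestFunction φ → energyForm β K E p (testPair φ) = 0)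
    (h1 : energyForm β K E p onePair = 1) (s : ℝ) {φ : Rn n → ℝ} (hφ : IsTestFunction φ) :
    energyForm β K E (onePair + testPair φ - s • p) (onePair + testPair φ - s • p) =
      energyForm β K E (onePair + testPair φ) (onePair + testPair φ) - 2 * s
        + s ^ 2 * energyForm β K E p p := by
  have hq : IsL2Pair E (onePair + testPair φ) := (isL2Pair_onePair hE).add hφ.isL2Pair
  rw [energyForm_sub_self hq (hp.smul s), energyForm_smul_left, energyForm_smul_right,
    energyForm_smul_right, energyForm_add_left (isL2Pair_onePair hE) hφ.isL2Pair hp,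
    energyForm_comm (p := onePair), energyForm_comm (p := testPair φ), h0 φ hφ, h1]
  ring

lemma inv_capacity_le (hβ : 1 ≤ β) (hK : 0 < K) (hE : volume E ≠ ⊤) (hp : IsL2Pair E p)
    (h0 : ∀ φ, IsTestFunction φ → energyForm β K E p (testPair φ) = 0)
    (h1 : energyForm β K E p onePair = 1) :
    (capacity β K E)⁻¹ ≤ energyForm β K E p p := by
  set e := energyForm β K E p p with he
  have he0 : 0 < e := by
    have := energyForm_sq_le hβ hK hp (isL2Pair_onePair hE)
    rw [h1, one_pow] at this
    have h2 := energyForm_self_nonneg (E := E) (p := p) hβ hK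
    rcases h2.eq_or_lt with h3 | h3
    · rw [← h3] at this; linarith
    · exact h3
  refine inv_le_of_inv_le₀ he0 (le_capacity fun φ hφ => ?_)
  have h2 := energyForm_sub_smul hE hp h0 h1 e⁻¹ hφ
  have h3 := energyForm_self_nonneg (E := E) (p := onePair + testPair φ - e⁻¹ • p) hβ hK
  rw [h2, ← he] at h3
  have : e⁻¹ ^ 2 * e = e⁻¹ := by field_simp
  linarith

end Form

/-! ### Minimizing pairs -/

section Minimizers

variable {n : ℕ} {β K : ℝ} {E : Set (Rn n)} {u : Rn n → ℝ} {g : Rn n → Rn n} {ρ : Rn n → ℝ}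

lemma permittivity_mul_eq (f : Rn n → ℝ) (x : Rn n) :
    permittivity β E x * f x = f x + (β - 1) * E.indicator f x := by
  by_cases hx : x ∈ E <;> simp [permittivity, hx]
  ring

lemma integrable_permittivity_mul (hm : NullMeasurableSet E) {f : Rn n → ℝ} (hf : Integrable f) :
    Integrable (fun x => permittivity β E x * f x) := by
  simp only [permittivity_mul_eq]
  exact hf.add ((hf.indicator₀ hm).const_mul _)

lemma integral_permittivity_mul (hm : NullMeasurableSet E) {f : Rn n → ℝ} (hf : Integrable f) :
    ∫ x, permittivity β E x * f x = (∫ x, f x) + (β - 1) * ∫ x in E, f x := by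
  simp only [permittivity_mul_eq]
  rw [integral_add hf ((hf.indicator₀ hm).const_mul _), integral_const_mul,
    integral_indicator₀ hm]

lemma energyForm_testPair_eq (hK : 0 < K) (hm : NullMeasurableSet E) (hg : MemLp g 2 volume)
    (h0 : ∀ᵐ x ∂(volume : Measure (Rn n)), x ∉ E → ρ x = 0) {φ : Rn n → ℝ}
    (hφ : IsTestFunction φ) : energyForm β K E (g, fun x => K * ρ x) (testPair φ) =
      (∫ x, permittivity β E x * inner ℝ (g x) (gradient φ x)) - ∫ x, ρ x * φ x := by
  rw [integral_permittivity_mul hm (MemLp.integrable_inner hg (hφ.memLp_gradient 2))]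
  have h1 : ∫ x, ρ x * φ x = ∫ x in E, ρ x * φ x := by
    refine (setIntegral_eq_integral_of_ae_compl_eq_zero ?_).symm
    filter_upwards [h0] with x hx hxE
    rw [hx hxE, zero_mul]
  have h2 : K⁻¹ * ∫ x in E, K * ρ x * (-φ) x = -∫ x in E, ρ x * φ x := by
    rw [← integral_const_mul, ← integral_neg]
    congr 1
    ext1 x
    simp only [Pi.neg_apply]
    field_simp
  simp only [energyForm, testPair]
  rw [h1, h2]
  ring

lemma energyForm_onePair_eq (hK : 0 < K)
    (h0 : ∀ᵐ x ∂(volume : Measure (Rn n)), x ∉ E → ρ x = 0) :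
    energyForm β K E (g, fun x => K * ρ x) onePair = ∫ x, ρ x := by
  have h1 : ∫ x, ρ x = ∫ x in E, ρ x := (setIntegral_eq_integral_of_ae_compl_eq_zero h0).symm
  simp only [energyForm, onePair]
  simp only [Pi.zero_apply, inner_zero_right, integral_zero, mul_zero, add_zero, zero_add,
    Pi.one_apply, mul_one]
  rw [h1, integral_const_mul, inv_mul_cancel_left₀ hK.ne']

lemma Admissible.isL2Pair (h : Admissible β E u g ρ) : IsL2Pair E (g, fun x => K * ρ x) :=
  ⟨h.memD1.gradient_memLp, (h.memLp.const_mul K).restrict E⟩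

lemma Admissible.energyForm_testPair (h : Admissible β E u g ρ) (hK : 0 < K)
    (hm : NullMeasurableSet E) {φ : Rn n → ℝ} (hφ : IsTestFunction φ) :
    energyForm β K E (g, fun x => K * ρ x) (testPair φ) = 0 := by
  rw [energyForm_testPair_eq hK hm h.memD1.gradient_memLp h.eq_zero hφ, h.equation φ hφ, sub_self]

lemma Admissible.energyForm_onePair (h : Admissible β E u g ρ) (hK : 0 < K) :
    energyForm β K E (g, fun x => K * ρ x) onePair = 1 := by
  rw [energyForm_onePair_eq hK h.eq_zero, h.integral_eq_one]

lemma Admissible.electricEnergy_eq (h : Admissible β E u g ρ) (hβ : 1 ≤ β) (hK : 0 < K)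
    (hm : NullMeasurableSet E) : electricEnergy β K E g ρ =
      ENNReal.ofReal (energyForm β K E (g, fun x => K * ρ x) (g, fun x => K * ρ x)) := by
  have hg2 : Integrable (fun x => ‖g x‖ ^ 2) := by
    have := h.memD1.gradient_memLp
    exact (memLp_two_iff_integrable_sq_norm this.aestronglyMeasurable).1 this
  have hρ2 : IntegrableOn (fun x => ρ x ^ 2) E := h.memLp.integrable_sq.integrableOn
  have ha : ∀ x, 0 ≤ permittivity β E x * ‖g x‖ ^ 2 := by
    intro x
    rw [permittivity_mul_eq (fun x => ‖g x‖ ^ 2) x]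
    have : 0 ≤ E.indicator (fun x => ‖g x‖ ^ 2) x :=
      Set.indicator_nonneg (fun _ _ => by positivity) x
    have : 0 ≤ (β - 1) * E.indicator (fun x => ‖g x‖ ^ 2) x := mul_nonneg (by linarith) this
    positivity
  rw [electricEnergy, ← ofReal_integral_eq_lintegral_ofReal
    (integrable_permittivity_mul hm hg2) (ae_of_all _ ha),
    ← ofReal_integral_eq_lintegral_ofReal hρ2 (ae_of_all _ fun x => by positivity),
    ← ENNReal.ofReal_mul hK.le, ← ENNReal.ofReal_add (integral_nonneg ha)
      (mul_nonneg hK.le (integral_nonneg fun x => by positivity)),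
    integral_permittivity_mul hm hg2, energyForm_self]
  congr 2
  simp only [mul_pow]
  rw [integral_const_mul]
  field_simp

/-- The parallelogram identity for two test functions, at the level of the capacity. -/
lemma energyForm_testPair_sub_le (hβ : 1 ≤ β) (hK : 0 < K) (hE : volume E ≠ ⊤)
    {φ ψ : Rn n → ℝ} (hφ : IsTestFunction φ) (hψ : IsTestFunction ψ) :
    energyForm β K E (testPair φ - testPair ψ) (testPair φ - testPair ψ) ≤
      2 * energyForm β K E (onePair + testPair φ) (onePair + testPair φ)
      + 2 * energyForm β K E (onePair + testPair ψ) (onePair + testPair ψ)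
      - 4 * capacity β K E := by
  have he := isL2Pair_onePair (n := n) hE
  have hp : IsL2Pair E (onePair + testPair φ) := he.add hφ.isL2Pair
  have hq : IsL2Pair E (onePair + testPair ψ) := he.add hψ.isL2Pair
  have h1 : testPair φ - testPair ψ = (onePair + testPair φ) - (onePair + testPair ψ) := by abel
  have h2 : (onePair + testPair φ) + (onePair + testPair ψ) =
      (2 : ℝ) • (onePair + testPair ((1 / 2 : ℝ) • (φ + ψ))) := by
    rw [(hφ.add hψ).testPair_smul, hφ.testPair_add hψ, smul_add, smul_smul]
    norm_num
    rw [two_smul]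
    abel
  have h3 := energyForm_add_self (β := β) (K := K) hp hq
  rw [h2, energyForm_smul_left, energyForm_smul_right] at h3
  have h4 := capacity_le (E := E) hβ hK ((hφ.add hψ).smul (1 / 2 : ℝ))
  rw [h1, energyForm_sub_self hp hq]
  linarith

/-- Near-minimizers of the capacity nearly solve the Euler–Lagrange equation. -/
lemma energyForm_testPair_sq_le (hβ : 1 ≤ β) (hK : 0 < K) (hE : volume E ≠ ⊤)
    {φ ψ : Rn n → ℝ} (hφ : IsTestFunction φ) (hψ : IsTestFunction ψ) :
    energyForm β K E (onePair + testPair φ) (testPair ψ) ^ 2 ≤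
      (energyForm β K E (onePair + testPair φ) (onePair + testPair φ) - capacity β K E) *
        energyForm β K E (testPair ψ) (testPair ψ) := by
  have he := isL2Pair_onePair (n := n) hE
  have hp : IsL2Pair E (onePair + testPair φ) := he.add hφ.isL2Pair
  have h : ∀ t : ℝ, 0 ≤ energyForm β K E (testPair ψ) (testPair ψ) * (t * t)
      + 2 * energyForm β K E (onePair + testPair φ) (testPair ψ) * t
      + (energyForm β K E (onePair + testPair φ) (onePair + testPair φ) - capacity β K E) := by
    intro t
    have h1 := capacity_le (E := E) hβ hK (hφ.add (hψ.smul t))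
    rw [hφ.testPair_add (hψ.smul t), hψ.testPair_smul, ← add_assoc,
      energyForm_add_self hp (hψ.isL2Pair.smul t), energyForm_smul_left, energyForm_smul_right,
      energyForm_smul_right] at h1
    linarith
  have := discrim_le_zero h
  rw [discrim] at this
  linarith

/-- An admissible pair whose energy is the reciprocal of the capacity, obtained as the normalized
limit of a minimizing sequence for the capacity. -/
lemma exists_admissible_energyForm_eq (hn : 3 ≤ n) (hβ : 1 ≤ β) (hK : 0 < K)
    (hm : NullMeasurableSet E) (hE : volume E ≠ ⊤) (hc : 0 < capacity β K E) :
    ∃ u g ρ, Admissible β E u g ρ ∧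
      energyForm β K E (g, fun x => K * ρ x) (g, fun x => K * ρ x) = (capacity β K E)⁻¹ := by
  set m := capacity β K E with hmdef
  set Q : (Rn n → Rn n) × (Rn n → ℝ) → ℝ := fun p => energyForm β K E p p with hQ
  have he := isL2Pair_onePair (n := n) hE
  have hseq : ∀ k : ℕ, ∃ φ : Rn n → ℝ, IsTestFunction φ ∧
      Q (onePair + testPair φ) < m + 1 / ((k : ℝ) + 1) := fun k =>
    exists_lt_of_capacity_lt (lt_add_of_pos_right _ (by positivity))
  choose φ hφ hφlt using hseq
  have hPk : ∀ k, IsL2Pair E (onePair + testPair (φ k)) := fun k => he.add (hφ k).isL2Pair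
  have hQm : ∀ k, m ≤ Q (onePair + testPair (φ k)) := fun k => capacity_le hβ hK (hφ k)
  have hone : Tendsto (fun k : ℕ => 1 / ((k : ℝ) + 1)) atTop (𝓝 0) :=
    tendsto_one_div_add_atTop_nhds_zero_nat
  have hQlim : Tendsto (fun k => Q (onePair + testPair (φ k))) atTop (𝓝 m) := by
    refine tendsto_of_tendsto_of_tendsto_of_le_of_le tendsto_const_nhds
      (by simpa using hone.const_add m) hQm fun k => (hφlt k).le
  -- the rescaled sequence
  have hψ : ∀ k, IsTestFunction (m⁻¹ • φ k) := fun k => (hφ k).smul _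
  have hcau : ∀ ε > 0, ∃ N, ∀ k, N ≤ k → ∀ l, N ≤ l →
      eLpNorm (gradient (m⁻¹ • φ k) - gradient (m⁻¹ • φ l)) 2 volume < ε := by
    intro ε hε
    obtain ⟨δ, hδ0, hδ, hδε⟩ := ENNReal.lt_iff_exists_real_btwn.1 hε
    have hδ0' : 0 < δ := by
      by_contra! h
      rw [ENNReal.ofReal_of_nonpos h] at hδ
      exact lt_irrefl _ hδ
    obtain ⟨N, hN⟩ := (hone.eventually (gt_mem_nhds
      (show 0 < (m * δ) ^ 2 / 4 by positivity))).exists_forall_of_atTop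
    refine ⟨N, fun k hk l hl => lt_of_le_of_lt ?_ hδε⟩
    have hL : MemLp (gradient (m⁻¹ • φ k) - gradient (m⁻¹ • φ l)) 2 volume :=
      ((hψ k).memLp_gradient 2).sub ((hψ l).memLp_gradient 2)
    refine (ENNReal.le_ofReal_iff_toReal_le hL.eLpNorm_ne_top hδ0).2 ?_
    refine le_of_sq_le_sq ?_ hδ0
    rw [← integral_norm_sq_eq hL]
    have h1 := integral_norm_sq_le_energyForm (E := E)
      (p := testPair (m⁻¹ • φ k) - testPair (m⁻¹ • φ l)) hβ hK
    refine le_trans h1 ?_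
    rw [(hφ k).testPair_smul, (hφ l).testPair_smul, ← smul_sub, energyForm_smul_left,
      energyForm_smul_right]
    have h2 := energyForm_testPair_sub_le hβ hK hE (hφ k) (hφ l)
    have h3 := hφlt k
    have h4 := hφlt l
    have h5 := hN k hk
    have h6 := hN l hl
    simp only [hQ] at h3 h4
    have h7 : energyForm β K E (testPair (φ k) - testPair (φ l))
        (testPair (φ k) - testPair (φ l)) ≤ (m * δ) ^ 2 := by linarith
    rw [← mul_assoc, ← mul_inv, inv_mul_le_iff₀ (by positivity)]
    calc _ ≤ _ := h7
      _ = _ := by ring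
  obtain ⟨u, g, hD1, hgl, hul⟩ := exists_memD1_of_cauchy hn hψ hcau
  obtain ⟨E', hE'E, hE'm, hE'⟩ := hm.exists_measurable_subset_ae_eq
  have hres : volume.restrict E' = volume.restrict E := Measure.restrict_congr_set hE'
  have hfin : IsFiniteMeasure (volume.restrict E) := isFiniteMeasure_restrict.2 hE
  have huE : MemLp u 2 (volume.restrict E) :=
    (hD1.memLp.restrict E).mono_exponent (two_le_sobolevExponent hn)
  have hvE : MemLp (fun x => m⁻¹ - u x) 2 (volume.restrict E) := (memLp_const m⁻¹).sub huE
  set ρ : Rn n → ℝ := E'.indicator (fun x => K⁻¹ * (m⁻¹ - u x)) with hρ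
  have hρL : MemLp ρ 2 volume := by
    rw [hρ, memLp_indicator_iff_restrict hE'm, hres]
    exact hvE.const_mul _
  have hρ0 : ∀ᵐ x ∂(volume : Measure (Rn n)), x ∉ E → ρ x = 0 := ae_of_all _ fun x hx =>
    Set.indicator_of_notMem (fun h => hx (hE'E h)) _
  set ξ : (Rn n → Rn n) × (Rn n → ℝ) := (g, fun x => K * ρ x) with hξ
  have hξL : IsL2Pair E ξ := ⟨hD1.gradient_memLp, (hρL.const_mul K).restrict E⟩
  have hξ2 : ∀ᵐ x ∂(volume.restrict E), ξ.2 x = m⁻¹ - u x := by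
    rw [← hres]
    refine (ae_restrict_iff' hE'm).2 (ae_of_all _ fun x hx => ?_)
    simp only [hξ, hρ, Set.indicator_of_mem hx]
    field_simp
  have hξk : ∀ k, IsL2Pair E (m⁻¹ • (onePair + testPair (φ k))) := fun k => (hPk k).smul _
  -- convergence in energy
  have hlim : Tendsto (fun k => energyForm β K E (m⁻¹ • (onePair + testPair (φ k)) - ξ)
      (m⁻¹ • (onePair + testPair (φ k)) - ξ)) atTop (𝓝 0) := by
    have hg2 : Tendsto (fun k => (eLpNorm (gradient (m⁻¹ • φ k) - g) 2 volume).toReal ^ 2)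
        atTop (𝓝 0) := by
      have := ((ENNReal.tendsto_toReal (ENNReal.zero_ne_top)).comp hgl).pow 2
      simpa using this
    have hu2 : Tendsto (fun k => (eLpNorm (m⁻¹ • φ k - u) 2 (volume.restrict E)).toReal ^ 2)
        atTop (𝓝 0) := by
      have hz : Tendsto (fun k => eLpNorm (m⁻¹ • φ k - u) 2 (volume.restrict E)) atTop (𝓝 0) := by
        set e : ℝ := 1 / (2 : ℝ≥0∞).toReal - 1 / (sobolevExponent n).toReal with he
        have he0 : 0 ≤ e := by
          have h2 := ENNReal.toReal_mono (b := sobolevExponent n) ENNReal.ofReal_ne_top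
            (two_le_sobolevExponent hn)
          rw [he, sub_nonneg]
          exact one_div_le_one_div_of_le (by norm_num) h2
        have hb : Tendsto (fun k => eLpNorm (m⁻¹ • φ k - u) (sobolevExponent n) volume
            * volume E ^ e) atTop (𝓝 0) := by
          have := ENNReal.Tendsto.mul_const (b := volume E ^ e) hul
            (Or.inr (ENNReal.rpow_ne_top_of_nonneg he0 hE))
          rwa [zero_mul] at this
        refine tendsto_of_tendsto_of_tendsto_of_le_of_le tendsto_const_nhds hb
          (fun _ => zero_le) fun k => ?_
        have h1 := eLpNorm_le_eLpNorm_mul_rpow_measure_univ (two_le_sobolevExponent hn)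
          (μ := volume.restrict E) (f := m⁻¹ • φ k - u)
          ((((hψ k).memLp _).sub hD1.memLp).aestronglyMeasurable.restrict)
        rw [Measure.restrict_apply_univ] at h1
        exact h1.trans (mul_le_mul_left (eLpNorm_mono_measure _ Measure.restrict_le_self) _)
      have := ((ENNReal.tendsto_toReal (ENNReal.zero_ne_top)).comp hz).pow 2
      simpa using this
    have hb := (hg2.const_mul β).add (hu2.const_mul K⁻¹)
    rw [mul_zero, mul_zero, add_zero] at hb
    refine squeeze_zero (fun k => energyForm_self_nonneg hβ hK) (fun k => ?_) hb
    have hL : MemLp (gradient (m⁻¹ • φ k) - g) 2 volume :=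
      ((hψ k).memLp_gradient 2).sub hD1.gradient_memLp
    have hL2 : MemLp (m⁻¹ • φ k - u) 2 (volume.restrict E) :=
      (((hψ k).memLp 2).restrict E).sub huE
    rw [← integral_norm_sq_eq hL, ← integral_norm_sq_eq hL2, energyForm_self]
    have h1 : (m⁻¹ • (onePair + testPair (φ k)) - ξ).1 = gradient (m⁻¹ • φ k) - g := by
      simp [onePair, testPair, hξ, (hφ k).gradient_smul]
    have h2 : ∫ x in E, (m⁻¹ • (onePair + testPair (φ k)) - ξ).2 x ^ 2
        = ∫ x in E, ‖(m⁻¹ • φ k - u) x‖ ^ 2 := by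
      refine integral_congr_ae ?_
      filter_upwards [hξ2] with x hx
      simp only [Prod.snd_sub, Pi.sub_apply, hx, Real.norm_eq_abs, sq_abs]
      simp [onePair, testPair]
      ring
    rw [h1, h2]
    have h3 : ∫ x in E, ‖(gradient (m⁻¹ • φ k) - g) x‖ ^ 2
        ≤ ∫ x, ‖(gradient (m⁻¹ • φ k) - g) x‖ ^ 2 :=
      setIntegral_le_integral ((memLp_two_iff_integrable_sq_norm hL.aestronglyMeasurable).1 hL)
        (ae_of_all _ fun x => by positivity)
    nlinarith
  have hξtest : ∀ χ, IsTestFunction χ → energyForm β K E ξ (testPair χ) = 0 := by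
    intro χ hχ
    have h1 := tendsto_energyForm hβ hK hξk hξL hχ.isL2Pair hlim
    refine tendsto_nhds_unique h1 ?_
    have h2 : Tendsto (fun k => Real.sqrt ((Q (onePair + testPair (φ k)) - m) *
        energyForm β K E (testPair χ) (testPair χ))) atTop (𝓝 0) := by
      have := ((hQlim.sub_const m).mul_const (energyForm β K E (testPair χ) (testPair χ))).sqrt
      simpa using this
    have h3 : Tendsto (fun k => energyForm β K E (onePair + testPair (φ k)) (testPair χ)) atTop
        (𝓝 0) := squeeze_zero_norm
      (fun k => Real.abs_le_sqrt (energyForm_testPair_sq_le hβ hK hE (hφ k) hχ)) h2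
    have h4 := h3.const_mul m⁻¹
    rw [mul_zero] at h4
    exact h4.congr fun k => energyForm_smul_left _ |>.symm
  have hξQ : energyForm β K E ξ ξ = m⁻¹ := by
    have h1 := tendsto_energyForm_self hβ hK hξk hξL hlim
    refine tendsto_nhds_unique h1 ?_
    have h2 := (hQlim.const_mul m⁻¹).const_mul m⁻¹
    rw [inv_mul_cancel₀ hc.ne', mul_one] at h2
    refine h2.congr fun k => ?_
    rw [energyForm_smul_left, energyForm_smul_right]
  have hξone : energyForm β K E ξ onePair = 1 := by
    have h1 := (tendsto_energyForm hβ hK hξk hξL hξL hlim).const_mul m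
    rw [hξQ, mul_inv_cancel₀ hc.ne'] at h1
    refine tendsto_nhds_unique ?_ h1
    refine tendsto_const_nhds.congr fun k => ?_
    rw [energyForm_smul_left, mul_inv_cancel_left₀ hc.ne', energyForm_add_left he
      (hφ k).isL2Pair hξL, energyForm_comm (p := testPair (φ k)), hξtest _ (hφ k), add_zero,
      energyForm_comm]
  refine ⟨u, g, ρ, ⟨hD1, hρL, hρ0, ?_, fun χ hχ => ?_⟩, hξQ⟩
  · rw [← energyForm_onePair_eq (β := β) (E := E) (g := g) hK hρ0]
    exact hξone
  · have := hξtest χ hχ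
    rw [hξ, energyForm_testPair_eq hK hm hD1.gradient_memLp hρ0 hχ] at this
    linarith

/-- The electrostatic energy is the reciprocal of the capacity. -/
lemma G_eq_inv_capacity (hn : 3 ≤ n) (hβ : 1 ≤ β) (hK : 0 < K) (hm : NullMeasurableSet E)
    (hE : volume E ≠ ⊤) (hc : 0 < capacity β K E) :
    G β K E = ENNReal.ofReal (capacity β K E)⁻¹ := by
  refine le_antisymm ?_ ?_
  · obtain ⟨u, g, ρ, h, he⟩ := exists_admissible_energyForm_eq hn hβ hK hm hE hc
    rw [← he, ← h.electricEnergy_eq hβ hK hm]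
    exact iInf₂_le_of_le u g (iInf₂_le ρ h)
  · refine le_iInf₂ fun u g => le_iInf₂ fun ρ h => ?_
    rw [h.electricEnergy_eq hβ hK hm]
    exact ENNReal.ofReal_le_ofReal (inv_capacity_le hβ hK hE h.isL2Pair
      (fun φ hφ => h.energyForm_testPair hK hm hφ) (h.energyForm_onePair hK))

lemma exists_isMinimizingPair (hn : 3 ≤ n) (hβ : 1 ≤ β) (hK : 0 < K) (hm : NullMeasurableSet E)
    (hE : volume E ≠ ⊤) (hc : 0 < capacity β K E) : ∃ u g ρ, IsMinimizingPair β K E u g ρ := by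
  obtain ⟨u, g, ρ, h, he⟩ := exists_admissible_energyForm_eq hn hβ hK hm hE hc
  exact ⟨u, g, ρ, h, by rw [h.electricEnergy_eq hβ hK hm, he, G_eq_inv_capacity hn hβ hK hm hE hc]⟩

/-- The distance of a competitor for the capacity to the rescaled minimizing pair measures its
excess exactly. -/
lemma IsMinimizingPair.energyForm_sub (h : IsMinimizingPair β K E u g ρ) (hn : 3 ≤ n) (hβ : 1 ≤ β)
    (hK : 0 < K) (hm : NullMeasurableSet E) (hE : volume E ≠ ⊤) (hc : 0 < capacity β K E)
    {φ : Rn n → ℝ} (hφ : IsTestFunction φ) :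
    energyForm β K E (onePair + testPair φ - capacity β K E • (g, fun x => K * ρ x))
        (onePair + testPair φ - capacity β K E • (g, fun x => K * ρ x)) =
      energyForm β K E (onePair + testPair φ) (onePair + testPair φ) - capacity β K E := by
  have h1 := h.2
  rw [h.1.electricEnergy_eq hβ hK hm, G_eq_inv_capacity hn hβ hK hm hE hc,
    ENNReal.ofReal_eq_ofReal_iff (energyForm_self_nonneg hβ hK) (inv_nonneg.2 hc.le)] at h1
  rw [energyForm_sub_smul hE h.1.isL2Pair (fun φ hφ => h.1.energyForm_testPair hK hm hφ)
    (h.1.energyForm_onePair hK) _ hφ, h1]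
  field_simp
  ring

end Minimizers

/-! ### Comparison of capacities -/

section Comparison

variable {n : ℕ} {β K : ℝ} {E F : Set (Rn n)} {u : Rn n → ℝ} {g : Rn n → Rn n} {ρ : Rn n → ℝ}

/-- A smooth substitute for the truncation to `[0, 1]`: it does not increase slopes or the distance
to `1`, and it stays at a bounded distance from `1`. -/
lemma exists_smooth_truncation : ∃ (D : ℝ) (ψ : ℝ → ℝ), ContDiff ℝ ∞ ψ ∧ ψ 0 = 0 ∧
    (∀ t, |deriv ψ t| ≤ 1) ∧ (∀ t, |1 - ψ t| ≤ |1 - t|) ∧ ∀ t, |1 - ψ t| ≤ D := by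
  -- the primitive of a bump function equal to `1` on `[0, 1]`
  let S : ContDiffBump (1 / 2 : ℝ) := ⟨1 / 2, 3 / 2, by norm_num, by norm_num⟩
  have hSc : Continuous S := S.continuous
  have hSi : Integrable (S : ℝ → ℝ) := hSc.integrable_of_hasCompactSupport S.hasCompactSupport
  have hii : ∀ a b : ℝ, IntervalIntegrable (S : ℝ → ℝ) volume a b := fun a b =>
    hSc.intervalIntegrable a b
  have hd : ∀ t : ℝ, HasDerivAt (fun t => ∫ s in (0 : ℝ)..t, S s) (S t) t := fun t =>
    intervalIntegral.integral_hasDerivAt_right (hii 0 t)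
      hSc.aestronglyMeasurable.stronglyMeasurableAtFilter hSc.continuousAt
  have h1 : (∫ s in (0 : ℝ)..1, S s) = 1 := by
    have : Set.EqOn (S : ℝ → ℝ) (fun _ => (1 : ℝ)) (Set.uIcc 0 1) := fun s hs => by
      rw [Set.uIcc_of_le zero_le_one] at hs
      refine S.one_of_mem_closedBall ?_
      rw [Metric.mem_closedBall, Real.dist_eq, abs_le]
      show -(1 / 2 : ℝ) ≤ s - 1 / 2 ∧ s - 1 / 2 ≤ 1 / 2
      constructor <;> linarith [hs.1, hs.2]
    rw [intervalIntegral.integral_congr this]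
    simp
  have h2 : ∀ t : ℝ, 1 - (∫ s in (0 : ℝ)..t, S s) = ∫ s in t..1, S s := fun t => by
    have := intervalIntegral.integral_interval_sub_left (hii 0 1) (hii 0 t)
    linarith
  refine ⟨∫ s, |S s|, fun t => ∫ s in (0 : ℝ)..t, S s, ?_, by simp, fun t => ?_, fun t => ?_,
    fun t => ?_⟩
  · refine contDiff_infty_iff_deriv.2 ⟨fun t => (hd t).differentiableAt, ?_⟩
    rw [show deriv (fun t => ∫ s in (0 : ℝ)..t, S s) = S from funext fun t => (hd t).deriv]
    exact S.contDiff
  · rw [(hd t).deriv, abs_of_nonneg S.nonneg]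
    exact S.le_one
  · show |1 - (∫ s in (0 : ℝ)..t, S s)| ≤ |1 - t|
    rw [h2]
    have := intervalIntegral.norm_integral_le_of_norm_le_const (a := t) (b := 1) (C := 1)
      (f := (S : ℝ → ℝ)) fun s _ => by
        rw [Real.norm_eq_abs, abs_of_nonneg S.nonneg]
        exact S.le_one
    simpa using this
  · show |1 - (∫ s in (0 : ℝ)..t, S s)| ≤ _
    rw [h2]
    refine (intervalIntegral.norm_integral_le_integral_norm_uIoc (f := (S : ℝ → ℝ))).trans ?_
    exact setIntegral_le_integral hSi.abs (ae_of_all _ fun s => abs_nonneg _)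

lemma integrableOn_one_sub_sq (hE : volume E ≠ ⊤) {φ : Rn n → ℝ} (hφ : IsTestFunction φ) :
    IntegrableOn (fun x => (1 - φ x) ^ 2) E := by
  have h := ((isL2Pair_onePair hE).add hφ.isL2Pair).2.integrable_sq
  simpa [onePair, testPair, sub_eq_add_neg, IntegrableOn] using h

lemma IsTestFunction.integrable_norm_gradient_sq {φ : Rn n → ℝ} (hφ : IsTestFunction φ) :
    Integrable (fun x => ‖gradient φ x‖ ^ 2) :=
  (memLp_two_iff_integrable_sq_norm hφ.continuous_gradient.aestronglyMeasurable).1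
    (hφ.memLp_gradient 2)

/-- For the capacity, only test functions at a bounded distance from `1` matter. -/
lemma exists_le_capacity_of_bounded : ∃ D : ℝ, 0 ≤ D ∧ ∀ {n : ℕ} {β K : ℝ} {E : Set (Rn n)},
    1 ≤ β → 0 < K → volume E ≠ ⊤ → ∀ c : ℝ, (∀ φ : Rn n → ℝ, IsTestFunction φ →
      (∀ x, |1 - φ x| ≤ D) → c ≤ energyForm β K E (onePair + testPair φ) (onePair + testPair φ)) →
    c ≤ capacity β K E := by
  obtain ⟨D, ψ, hψ, hψ0, hψ1, hψ2, hψD⟩ := exists_smooth_truncation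
  refine ⟨D, (abs_nonneg _).trans (hψD 0), fun {n β K E} hβ hK hE c h => le_capacity fun φ hφ => ?_⟩
  have hφ' : IsTestFunction (ψ ∘ φ) := ⟨hψ.comp hφ.1, hφ.2.comp_left hψ0⟩
  refine (h (ψ ∘ φ) hφ' fun x => hψD _).trans ?_
  have hgr : ∀ x, ‖gradient (ψ ∘ φ) x‖ ^ 2 ≤ ‖gradient φ x‖ ^ 2 := fun x => by
    refine pow_le_pow_left₀ (norm_nonneg _) ?_ 2
    have h1 : HasFDerivAt (ψ ∘ φ) (deriv ψ (φ x) • fderiv ℝ φ x) x :=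
      ((hψ.differentiable (by simp)) (φ x)).hasDerivAt.comp_hasFDerivAt x
        (hφ.differentiable x).hasFDerivAt
    rw [norm_gradient, norm_gradient, h1.fderiv, norm_smul]
    exact mul_le_of_le_one_left (norm_nonneg _) (hψ1 _)
  have hi := hφ.integrable_norm_gradient_sq
  have hi' := hφ'.integrable_norm_gradient_sq
  rw [energyForm_onePair_add_testPair, energyForm_onePair_add_testPair]
  have h1 := integral_mono hi' hi hgr
  have h2 := mul_le_mul_of_nonneg_left
    (integral_mono (hi'.integrableOn (s := E)) (hi.integrableOn (s := E)) hgr)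
    (show 0 ≤ β - 1 by linarith)
  have h3 := mul_le_mul_of_nonneg_left
    (integral_mono (integrableOn_one_sub_sq hE hφ') (integrableOn_one_sub_sq hE hφ) fun x =>
      sq_le_sq.2 (hψ2 (φ x))) (inv_nonneg.2 hK.le)
  linarith

lemma capacity_mono (hβ : 1 ≤ β) (hK : 0 < K) (hF : volume F ≠ ⊤) (h : E ⊆ F) :
    capacity β K E ≤ capacity β K F := by
  refine le_capacity fun φ hφ => (capacity_le hβ hK hφ).trans ?_
  rw [energyForm_onePair_add_testPair, energyForm_onePair_add_testPair]
  have h2 := mul_le_mul_of_nonneg_left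
    (setIntegral_mono_set hφ.integrable_norm_gradient_sq.integrableOn
      (ae_of_all _ fun x => by positivity) h.eventuallyLE) (show 0 ≤ β - 1 by linarith)
  have h3 := mul_le_mul_of_nonneg_left
    (setIntegral_mono_set (integrableOn_one_sub_sq hF hφ)
      (ae_of_all _ fun x => sq_nonneg _) h.eventuallyLE) (inv_nonneg.2 hK.le)
  linarith

lemma pow_mul_capacity_le_capacity_smul (hβ : 1 ≤ β) (hK : 0 < K) {c : ℝ} (hc : 0 < c)
    (hc1 : c ≤ 1) : c ^ n * capacity β K F ≤ capacity β K (c • F) := by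
  refine le_capacity fun φ hφ => ?_
  have hφ' : IsTestFunction (fun x => φ (c • x)) :=
    ⟨hφ.1.comp (contDiff_const_smul c), hφ.2.comp_smul hc.ne'⟩
  have hg : ∀ x, ‖gradient (fun x => φ (c • x)) x‖ ^ 2 = c ^ 2 * ‖gradient φ (c • x)‖ ^ 2 := by
    intro x
    have h1 : HasFDerivAt (fun x => φ (c • x))
        ((fderiv ℝ φ (c • x)).comp (c • ContinuousLinearMap.id ℝ (Rn n))) x :=
      HasFDerivAt.comp x (hφ.differentiable (c • x)).hasFDerivAt
        ((hasFDerivAt_id x).const_smul c)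
    rw [norm_gradient, norm_gradient, h1.fderiv, ContinuousLinearMap.comp_smul,
      ContinuousLinearMap.comp_id, norm_smul, mul_pow, Real.norm_eq_abs, sq_abs]
  have h1 := mul_le_mul_of_nonneg_left (capacity_le (E := F) hβ hK hφ') (pow_nonneg hc.le n)
  refine h1.trans ?_
  have hfr : Module.finrank ℝ (Rn n) = n := finrank_euclideanSpace_fin
  rw [energyForm_onePair_add_testPair, energyForm_onePair_add_testPair]
  simp only [hg, integral_const_mul]
  rw [Measure.integral_comp_smul_of_nonneg volume (fun x => ‖gradient φ x‖ ^ 2) c (hR := hc.le),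
    Measure.setIntegral_comp_smul_of_pos volume (fun x => ‖gradient φ x‖ ^ 2) F hc,
    Measure.setIntegral_comp_smul_of_pos volume (fun x => (1 - φ x) ^ 2) F hc, hfr]
  simp only [smul_eq_mul]
  have h2 : 0 ≤ ∫ x, ‖gradient φ x‖ ^ 2 := integral_nonneg fun x => by positivity
  have h3 : 0 ≤ (β - 1) * ∫ x in c • F, ‖gradient φ x‖ ^ 2 :=
    mul_nonneg (by linarith) (integral_nonneg fun x => by positivity)
  have hcc : c ^ 2 ≤ 1 := pow_le_one₀ hc.le hc1
  have hcn : c ^ n ≠ 0 := (pow_pos hc n).ne'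
  have h4 := mul_le_of_le_one_left h2 hcc
  have h5 := mul_le_of_le_one_left h3 hcc
  have key : ∀ a b d : ℝ, c ^ n * (c ^ 2 * ((c ^ n)⁻¹ * a) + (β - 1) * (c ^ 2 * ((c ^ n)⁻¹ * b))
      + K⁻¹ * ((c ^ n)⁻¹ * d)) = c ^ 2 * a + c ^ 2 * ((β - 1) * b) + K⁻¹ * d := fun a b d => by
    linear_combination (c ^ 2 * a + c ^ 2 * ((β - 1) * b) + K⁻¹ * d) * mul_inv_cancel₀ hcn
  rw [key]
  linarith

lemma setIntegral_le_add_setIntegral_diff (hF : NullMeasurableSet F) {f : Rn n → ℝ}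
    (hf : ∀ x, 0 ≤ f x) (hE : IntegrableOn f E) (hfF : IntegrableOn f F) :
    ∫ x in E, f x ≤ (∫ x in F, f x) + ∫ x in E \ F, f x := by
  rw [← integral_inter_add_sdiff₀ hF hE]
  have := setIntegral_mono_set hfF (ae_of_all _ hf)
    (Set.inter_subset_right (s := E) (t := F)).eventuallyLE
  linarith

/-- Removing `E \ F` decreases the capacity at most by a multiple of
`|E \ F| + ∫_{E \ F} |∇u_E|²`: for a competitor `φ` close to `1`, the loss of the zero-order term
is at most a multiple of `|E \ F|`, and the loss of the gradient term is absorbed by the excess of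
`φ` over the minimizer for `E`. -/
lemma exists_capacity_sub_le : ∃ D : ℝ, 0 ≤ D ∧ ∀ {n : ℕ} {β K : ℝ} {E F : Set (Rn n)}
    {u : Rn n → ℝ} {g : Rn n → Rn n} {ρ : Rn n → ℝ}, IsMinimizingPair β K E u g ρ → 3 ≤ n →
    1 ≤ β → 0 < K → NullMeasurableSet E → NullMeasurableSet F → volume E ≠ ⊤ → volume F ≠ ⊤ →
    0 < capacity β K E → capacity β K E - K⁻¹ * (D * volume.real (E \ F))
      - β * (β - 1) * capacity β K E ^ 2 * (∫ x in E \ F, ‖g x‖ ^ 2) ≤ capacity β K F := by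
  obtain ⟨D, hD0, hD⟩ := exists_le_capacity_of_bounded
  refine ⟨D ^ 2, sq_nonneg D, fun {n β K E F u g ρ} h hn hβ hK hEm hFm hE hF hc =>
    hD hβ hK hF _ fun φ hφ hφD => ?_⟩
  set m := capacity β K E with hmdef
  have h1 := h.energyForm_sub hn hβ hK hEm hE hc hφ
  set b : Rn n → Rn n := fun x => gradient φ x - m • g x with hb
  have hbL : MemLp b 2 volume := (hφ.memLp_gradient 2).sub (h.1.memD1.gradient_memLp.const_smul m)
  have hgi : Integrable (fun x => ‖g x‖ ^ 2) :=
    (memLp_two_iff_integrable_sq_norm h.1.memD1.gradient_memLp.aestronglyMeasurable).1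
      h.1.memD1.gradient_memLp
  have hbi : Integrable (fun x => ‖b x‖ ^ 2) :=
    (memLp_two_iff_integrable_sq_norm hbL.aestronglyMeasurable).1 hbL
  have hφi := hφ.integrable_norm_gradient_sq
  have hβ0 : 0 ≤ β - 1 := by linarith
  -- the excess controls the gradient of the difference on `E \ F`
  have h2 : β * (∫ x in E \ F, ‖b x‖ ^ 2) ≤
      energyForm β K E (onePair + testPair φ) (onePair + testPair φ) - m := by
    rw [← h1, energyForm_self]
    have hfst : (onePair + testPair φ - m • (g, fun x => K * ρ x)).1 = b := by
      simp [onePair, testPair, hb]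
      rfl
    rw [hfst]
    have i1 : ∫ x in E \ F, ‖b x‖ ^ 2 ≤ ∫ x, ‖b x‖ ^ 2 :=
      setIntegral_le_integral hbi (ae_of_all _ fun x => by positivity)
    have i2 : ∫ x in E \ F, ‖b x‖ ^ 2 ≤ ∫ x in E, ‖b x‖ ^ 2 :=
      setIntegral_mono_set hbi.integrableOn (ae_of_all _ fun x => by positivity)
        Set.sdiff_subset.eventuallyLE
    have i3 : 0 ≤ K⁻¹ * ∫ x in E, (onePair + testPair φ - m • (g, fun x => K * ρ x)).2 x ^ 2 :=
      mul_nonneg (inv_nonneg.2 hK.le) (integral_nonneg fun x => sq_nonneg _)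
    have i4 := mul_le_mul_of_nonneg_left i2 hβ0
    linarith
  have h3 : (β - 1) * (∫ x in E \ F, ‖gradient φ x‖ ^ 2) ≤ β * (∫ x in E \ F, ‖b x‖ ^ 2) +
      β * (β - 1) * m ^ 2 * ∫ x in E \ F, ‖g x‖ ^ 2 := by
    rw [← integral_const_mul, ← integral_const_mul, ← integral_const_mul,
      ← integral_add (hbi.const_mul _).integrableOn (hgi.const_mul _).integrableOn]
    refine integral_mono (hφi.const_mul _).integrableOn
      ((hbi.const_mul _).add (hgi.const_mul _)).integrableOn fun x => ?_
    have i1 : ‖gradient φ x‖ ≤ ‖b x‖ + m * ‖g x‖ := by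
      have : gradient φ x = b x + m • g x := by simp [hb]
      rw [this]
      refine (norm_add_le _ _).trans_eq ?_
      rw [norm_smul, Real.norm_eq_abs, abs_of_pos hc]
    have i2 : ‖gradient φ x‖ ^ 2 ≤ (‖b x‖ + m * ‖g x‖) ^ 2 :=
      pow_le_pow_left₀ (norm_nonneg _) i1 2
    have i3 := mul_le_mul_of_nonneg_left i2 hβ0
    show (β - 1) * ‖gradient φ x‖ ^ 2 ≤ β * ‖b x‖ ^ 2 + β * (β - 1) * m ^ 2 * ‖g x‖ ^ 2
    nlinarith [sq_nonneg (‖b x‖ - (β - 1) * (m * ‖g x‖))]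
  have h4 : ∫ x in E \ F, (1 - φ x) ^ 2 ≤ D ^ 2 * volume.real (E \ F) := by
    have hN : volume (E \ F) ≠ ⊤ := measure_ne_top_of_subset Set.sdiff_subset hE
    have := integral_mono (integrableOn_one_sub_sq hN hφ)
      (integrableOn_const (C := D ^ 2) hN) fun x => sq_le_sq.2
        ((hφD x).trans (le_abs_self D))
    refine this.trans_eq ?_
    simp [mul_comm]
  have h5 := setIntegral_le_add_setIntegral_diff (E := E) hFm (f := fun x => ‖gradient φ x‖ ^ 2)
    (fun x => by positivity) hφi.integrableOn hφi.integrableOn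
  have h6 := setIntegral_le_add_setIntegral_diff (E := E) hFm (f := fun x => (1 - φ x) ^ 2)
    (fun x => sq_nonneg _) (integrableOn_one_sub_sq hE hφ) (integrableOn_one_sub_sq hF hφ)
  rw [energyForm_onePair_add_testPair] at h2 ⊢
  have h7 := mul_le_mul_of_nonneg_left h5 hβ0
  have h8 := mul_le_mul_of_nonneg_left (h6.trans (add_le_add_right h4 _)) (inv_nonneg.2 hK.le)
  linarith

end Comparison

/-! ### Minimizers are almost minimal for the perimeter -/

section AlmostMinimality

variable {n : ℕ} {A β K Q R c₀ : ℝ} {E F : Set (Rn n)}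

lemma norm_add_le_of_ball_ae_subset (hn : 1 ≤ n) (hE : E ⊆ Metric.ball 0 R) {y : Rn n} {s : ℝ}
    (hs : 0 < s) (h : volume (Metric.ball y s \ E) = 0) : ‖y‖ + s ≤ R := by
  by_contra! hlt
  -- a unit vector in the direction of `y`
  obtain ⟨w, hw, hyw⟩ : ∃ w : Rn n, ‖w‖ = 1 ∧ y = ‖y‖ • w := by
    by_cases hy : y = 0
    · have : Nonempty (Fin n) := ⟨⟨0, hn⟩⟩
      obtain ⟨w, hw⟩ := exists_norm_eq (Rn n) zero_le_one
      exact ⟨w, hw, by simp [hy]⟩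
    · have hy' : ‖y‖ ≠ 0 := norm_ne_zero_iff.2 hy
      refine ⟨‖y‖⁻¹ • y, by rw [norm_smul, norm_inv, norm_norm, inv_mul_cancel₀ hy'], ?_⟩
      rw [smul_smul, mul_inv_cancel₀ hy', one_smul]
  obtain ⟨t, ht1, ht2⟩ := exists_between (max_lt (show R - ‖y‖ < s by linarith) hs)
  have hU : IsOpen (Metric.ball y s ∩ (Metric.closedBall 0 R)ᶜ) :=
    Metric.isOpen_ball.inter Metric.isClosed_closedBall.isOpen_compl
  have ht0 : 0 < t := (le_max_right _ _).trans_lt ht1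
  have hmem : y + t • w ∈ Metric.ball y s ∩ (Metric.closedBall 0 R)ᶜ := by
    refine ⟨?_, ?_⟩
    · rw [Metric.mem_ball, dist_eq_norm, add_sub_cancel_left, norm_smul, hw, mul_one,
        Real.norm_eq_abs, abs_of_pos ht0]
      exact ht2
    · rw [Set.mem_compl_iff, mem_closedBall_zero_iff, not_le, hyw, ← add_smul, norm_smul, hw,
        mul_one, Real.norm_eq_abs, abs_of_nonneg (by positivity)]
      have := (le_max_left _ _).trans_lt ht1
      linarith
  refine (hU.measure_pos volume ⟨_, hmem⟩).ne' (measure_mono_null ?_ h)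
  exact fun x hx => ⟨hx.1, fun hxE => hx.2 (Metric.ball_subset_closedBall (hE hxE))⟩

/-- A set can be enlarged inside `B_R` to have at least a given volume `V` by adding a ball
containing the given ball `B_s(y)`. If the latter does not already suffice, then the volume `V` is
attained exactly. -/
lemma exists_ball_fill (hn : 1 ≤ n) (hFm : NullMeasurableSet F) (hFR : F ⊆ Metric.ball 0 R)
    {y : Rn n} {s : ℝ} (hs : 0 < s) (hyR : ‖y‖ + s ≤ R) {V : ℝ}
    (hV : V ≤ volume.real (Metric.ball (0 : Rn n) R)) :
    ∃ (z : Rn n) (r : ℝ), s ≤ r ∧ Metric.ball z r ⊆ Metric.ball 0 R ∧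
      V ≤ volume.real F + volume.real (Metric.ball z r \ F) ∧
      volume.real (Metric.ball z r \ F) ≤
        max (volume.real (Metric.ball y s \ F)) (V - volume.real F) := by
  have hsR : s ≤ R := by linarith [norm_nonneg y]
  -- balls of radius `σ ∈ [s, R]` interpolating between `B_s(y)` and `B_R`
  obtain ⟨z, v, hv, hzs, hzR⟩ : ∃ z v : Rn n, ‖v‖ ≤ 1 ∧ z + s • v = y ∧ z + R • v = 0 := by
    rcases hsR.eq_or_lt with h | h
    · have : y = 0 := by
        rw [← norm_le_zero_iff]
        linarith
      exact ⟨0, 0, by simp, by simp [this], by simp⟩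
    · have hd : 0 < R - s := sub_pos.2 h
      refine ⟨(R * (R - s)⁻¹) • y, -((R - s)⁻¹ • y), ?_, ?_, ?_⟩
      · rw [norm_neg, norm_smul, norm_inv, Real.norm_eq_abs, abs_of_pos hd,
          inv_mul_le_iff₀ hd]
        linarith
      · rw [smul_neg, smul_smul, ← sub_eq_add_neg, ← sub_smul, ← sub_mul,
          mul_inv_cancel₀ hd.ne', one_smul]
      · rw [smul_neg, smul_smul, ← sub_eq_add_neg, sub_self]
  set h : ℝ → ℝ := fun σ => volume.real (Metric.ball (z + σ • v) σ \ F) with hh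
  have hcont : ContinuousOn h (Set.Icc s R) :=
    (continuousOn_measureReal_ball_diff hn z hv).mono fun σ hσ => hs.le.trans hσ.1
  have hsub : ∀ σ ≤ R, Metric.ball (z + σ • v) σ ⊆ Metric.ball 0 R := fun σ hσ => by
    have := ball_add_smul_subset (z := z) hv hσ
    rwa [hzR] at this
  have hR : V - volume.real F ≤ h R := by
    have h1 := measureReal_inter_add_sdiff₀ (μ := volume) (s := Metric.ball (0 : Rn n) R) hFm
      measure_ball_lt_top.ne
    rw [Set.inter_eq_self_of_subset_right hFR] at h1
    simp only [hh, hzR]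
    linarith
  by_cases h0 : V - volume.real F ≤ h s
  · refine ⟨z + s • v, s, le_rfl, hsub s hsR, by simp only [hh] at h0; linarith, ?_⟩
    rw [hzs]
    exact le_max_left _ _
  · obtain ⟨σ, hσ, hhσ⟩ := intermediate_value_Icc hsR hcont ⟨(not_le.1 h0).le, hR⟩
    refine ⟨z + σ • v, σ, hσ.1, hsub σ hσ.2, ?_, ?_⟩
    · simp only [hh] at hhσ
      linarith
    · simp only [hh] at hhσ
      rw [hhσ]
      exact le_max_right _ _

/-- Comparison of a minimizer with a set `F ⊆ B_R` of at least the same volume: shrinking `F` to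
the right volume decreases the perimeter and the confinement is preserved. -/
lemma IsMinimizer.perimeter_le_of_volume_le (hn : 3 ≤ n) (hctl : ControlledBy A β K Q)
    (hmin : IsMinimizer β K Q R E) (hc₀ : 0 < c₀)
    (hc : ∀ E' : Set (Rn n), volume E' = volume (Metric.ball (0 : Rn n) 1) →
      c₀ ≤ capacity β K E')
    (hFm : NullMeasurableSet F) (hFR : F ⊆ Metric.ball 0 R)
    (hvol : volume.real (Metric.ball (0 : Rn n) 1) ≤ volume.real F) {D : ℝ} (hD : 0 ≤ D)
    (hcap : capacity β K E - D ≤ capacity β K F) :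
    perimeter E ≤ perimeter F + ENNReal.ofReal (Q ^ 2 / c₀ ^ 2 *
      (A * (volume.real F - volume.real (Metric.ball (0 : Rn n) 1)) + D)) := by
  obtain ⟨hβ, hK, hQ, hA⟩ := hctl
  have hKA : K⁻¹ ≤ A := by
    rw [one_div] at hA
    linarith
  obtain ⟨⟨hEm, hER, hEv⟩, hEmin⟩ := hmin
  have hfr : Module.finrank ℝ (Rn n) = n := finrank_euclideanSpace_fin
  have hFt : volume F ≠ ⊤ := measure_ne_top_of_subset hFR measure_ball_lt_top.ne
  set κ := volume.real (Metric.ball (0 : Rn n) 1) with hκdef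
  set V := volume.real F with hVdef
  have hκ : 0 < κ := volume_real_unitBall_pos
  have hV : 0 < V := hκ.trans_le hvol
  set c : ℝ := (κ / V) ^ ((n : ℝ)⁻¹) with hcdef
  have hcn : c ^ n = κ / V := Real.rpow_inv_natCast_pow (by positivity) (by omega)
  have hc0 : 0 < c := Real.rpow_pos_of_pos (by positivity) _
  have hc1 : c ≤ 1 := Real.rpow_le_one (by positivity) (div_le_one_of_le₀ hvol hV.le)
    (by positivity)
  have hcv : volume (c • F) = volume (Metric.ball (0 : Rn n) 1) := by
    rw [Measure.addHaar_smul, hfr, hcn, abs_of_nonneg (by positivity),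
      ← ENNReal.toReal_eq_toReal_iff' (ENNReal.mul_ne_top ENNReal.ofReal_ne_top hFt)
        measure_ball_lt_top.ne, ENNReal.toReal_mul, ENNReal.toReal_ofReal (by positivity)]
    show κ / V * V = κ
    field_simp
  have hcomp : IsCompetitor R (c • F) := by
    refine ⟨Measure.NullMeasurableSet.const_smul hFm c, ?_, hcv⟩
    rintro _ ⟨x, hx, rfl⟩
    have hxR := mem_ball_zero_iff.1 (hFR hx)
    rw [mem_ball_zero_iff]
    show ‖c • x‖ < R
    rw [norm_smul, Real.norm_eq_abs, abs_of_pos hc0]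
    exact (mul_le_of_le_one_left (norm_nonneg _) hc1).trans_lt hxR
  set m := capacity β K E with hm
  set m' := capacity β K (c • F) with hm'
  have hcm : c₀ ≤ m := hc E hEv
  have hcm' : c₀ ≤ m' := hc _ hcv
  have h1 := hEmin _ hcomp
  rw [freeEnergy, freeEnergy,
    G_eq_inv_capacity hn hβ hK hEm (by rw [hEv]; exact measure_ball_lt_top.ne) (hc₀.trans_le hcm),
    G_eq_inv_capacity hn hβ hK hcomp.1 (by rw [hcv]; exact measure_ball_lt_top.ne)
      (hc₀.trans_le hcm'), ← ENNReal.ofReal_mul (sq_nonneg Q),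
    ← ENNReal.ofReal_mul (sq_nonneg Q)] at h1
  -- the loss of capacity caused by the shrinking
  have h2 : m - m' ≤ A * (V - κ) + D := by
    have i1 : c ^ n * capacity β K F ≤ m' := pow_mul_capacity_le_capacity_smul hβ hK hc0 hc1
    rw [hcn] at i1
    have i2 : capacity β K F ≤ K⁻¹ * V := capacity_le_volume hβ hK
    have i3 : capacity β K F - κ / V * capacity β K F ≤ A * (V - κ) := by
      have e : capacity β K F - κ / V * capacity β K F = (V - κ) * (capacity β K F / V) := by
        field_simp
      rw [e, mul_comm A]
      refine mul_le_mul_of_nonneg_left ?_ (by linarith)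
      rw [div_le_iff₀ hV]
      exact i2.trans (mul_le_mul_of_nonneg_right hKA hV.le)
    linarith
  have hm0 : 0 < m := hc₀.trans_le hcm
  have hm0' : 0 < m' := hc₀.trans_le hcm'
  have hA0 : 0 ≤ A := (inv_nonneg.2 hK.le).trans hKA
  set S := A * (V - κ) + D with hS
  have hS0 : 0 ≤ S := add_nonneg (mul_nonneg hA0 (by linarith)) hD
  have h3 : Q ^ 2 * m'⁻¹ ≤ Q ^ 2 / c₀ ^ 2 * S + Q ^ 2 * m⁻¹ := by
    have i1 : m'⁻¹ - m⁻¹ = (m - m') / (m' * m) := by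
      field_simp
    have i2 : (m - m') / (m' * m) ≤ S / c₀ ^ 2 := by
      refine (div_le_div_of_nonneg_right h2 (by positivity)).trans
        (div_le_div_of_nonneg_left hS0 (by positivity) ?_)
      rw [sq]
      exact mul_le_mul hcm' hcm hc₀.le hm0'.le
    have i3 := mul_le_mul_of_nonneg_left (i1.trans_le i2) (sq_nonneg Q)
    have e : Q ^ 2 / c₀ ^ 2 * S = Q ^ 2 * (S / c₀ ^ 2) := by ring
    rw [e]
    linarith
  have h4 : perimeter E + ENNReal.ofReal (Q ^ 2 * m⁻¹) ≤
      (perimeter F + ENNReal.ofReal (Q ^ 2 / c₀ ^ 2 * S)) + ENNReal.ofReal (Q ^ 2 * m⁻¹) := by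
    refine h1.trans ?_
    rw [add_assoc, ← ENNReal.ofReal_add (by positivity) (by positivity)]
    exact add_le_add (perimeter_smul_le hc0 hc1 (by omega)) (ENNReal.ofReal_le_ofReal h3)
  exact (ENNReal.add_le_add_iff_right ENNReal.ofReal_ne_top).1 h4

lemma IsMinimizer.perimeter_le_of_subset (hn : 3 ≤ n) (hctl : ControlledBy A β K Q) (hR : 1 ≤ R)
    (hmin : IsMinimizer β K Q R E) (hc₀ : 0 < c₀)
    (hc : ∀ E' : Set (Rn n), volume E' = volume (Metric.ball (0 : Rn n) 1) →
      c₀ ≤ capacity β K E')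
    (hFm : NullMeasurableSet F) (hFb : Bornology.IsBounded F) (hEF : E ⊆ F) :
    perimeter E ≤ perimeter F + ENNReal.ofReal (A ^ 3 / c₀ ^ 2) * volume (F \ E) := by
  have hβ := hctl.1
  have hK := hctl.2.1
  have hQ := hctl.2.2.1
  have hK' : 0 < 1 / K := by positivity
  have hA := hctl.2.2.2
  have hEm := hmin.1.1
  have hER := hmin.1.2.1
  have hEv := hmin.1.2.2
  set F₁ := F ∩ Metric.ball 0 R with hF₁
  have hEF₁ : E ⊆ F₁ := Set.subset_inter hEF hER
  have hF₁t : volume F₁ ≠ ⊤ := measure_ne_top_of_subset Set.inter_subset_right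
    measure_ball_lt_top.ne
  have hF₁m : NullMeasurableSet F₁ := hFm.inter Metric.isOpen_ball.measurableSet.nullMeasurableSet
  have hEr : volume.real E = volume.real (Metric.ball (0 : Rn n) 1) := by simp [Measure.real, hEv]
  have h1 := hmin.perimeter_le_of_volume_le hn hctl hc₀ hc hF₁m Set.inter_subset_right
    (by rw [← hEr]; exact measureReal_mono hEF₁ hF₁t) le_rfl
    (by rw [sub_zero]; exact capacity_mono hβ hK hF₁t hEF₁)
  refine h1.trans (add_le_add (perimeter_inter_ball_le hFm hFb (by linarith)) ?_)
  have hFE : volume (F \ E) ≠ ⊤ := measure_ne_top_of_subset Set.sdiff_subset hFb.measure_lt_top.ne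
  rw [← ENNReal.ofReal_toReal hFE, ← ENNReal.ofReal_mul (by
    have : 0 ≤ A := by linarith
    positivity)]
  refine ENNReal.ofReal_le_ofReal ?_
  have h2 : volume.real F₁ - volume.real (Metric.ball (0 : Rn n) 1) ≤ volume.real (F \ E) := by
    rw [← hEr]
    have h3 := measureReal_inter_add_sdiff₀ (μ := volume) (s := F₁) hEm hF₁t
    rw [Set.inter_eq_self_of_subset_right hEF₁] at h3
    have h4 : volume.real (F₁ \ E) ≤ volume.real (F \ E) :=
      measureReal_mono (Set.sdiff_subset_sdiff_left Set.inter_subset_left) hFE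
    linarith
  have hQ2 : Q ^ 2 ≤ A ^ 2 := pow_le_pow_left₀ hQ (by linarith) 2
  have hA0 : 0 ≤ A := by linarith
  calc _ ≤ Q ^ 2 / c₀ ^ 2 * (A * volume.real (F \ E)) := by
        rw [add_zero]
        gcongr
    _ ≤ A ^ 2 / c₀ ^ 2 * (A * volume.real (F \ E)) := by gcongr
    _ = _ := by
        rw [Measure.real]
        ring

lemma IsMinimizer.perimeter_le (hn : 3 ≤ n) (hctl : ControlledBy A β K Q) (hR : 1 ≤ R)
    (hmin : IsMinimizer β K Q R E) (hc₀ : 0 < c₀)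
    (hc : ∀ E' : Set (Rn n), volume E' = volume (Metric.ball (0 : Rn n) 1) →
      c₀ ≤ capacity β K E') :
    perimeter E ≤ ENNReal.ofReal
      (n * volume.real (Metric.ball (0 : Rn n) 1) + A ^ 2 / c₀) := by
  obtain ⟨hβ, hK, hQ, hA⟩ := hctl
  have hK' : 0 < 1 / K := by positivity
  have hB : IsCompetitor R (Metric.ball (0 : Rn n) 1) :=
    ⟨Metric.isOpen_ball.measurableSet.nullMeasurableSet, Metric.ball_subset_ball hR, rfl⟩
  have h1 : perimeter (Metric.ball (0 : Rn n) 1) ≤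
      ENNReal.ofReal (n * volume.real (Metric.ball (0 : Rn n) 1)) := by
    have h := perimeter_union_ball_le (E := (∅ : Set (Rn n))) (z := 0) nullMeasurableSet_empty
      one_pos
    rw [Set.empty_union, perimeter_empty, zero_add, Set.sdiff_empty, div_one,
      ← ENNReal.ofReal_toReal (measure_ball_lt_top (μ := volume) (x := (0 : Rn n)) (r := 1)).ne,
      ← ENNReal.ofReal_mul (by positivity)] at h
    exact h
  have h2 := hmin.2 _ hB
  have hcB := hc _ (rfl : volume (Metric.ball (0 : Rn n) 1) = _)
  rw [freeEnergy, freeEnergy, G_eq_inv_capacity hn hβ hK hB.1 measure_ball_lt_top.ne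
    (hc₀.trans_le hcB), ← ENNReal.ofReal_mul (sq_nonneg Q)] at h2
  refine le_self_add.trans (h2.trans ?_)
  rw [ENNReal.ofReal_add (by positivity) (by positivity)]
  refine add_le_add h1 (ENNReal.ofReal_le_ofReal ?_)
  rw [div_eq_mul_inv]
  have hcB0 := inv_nonneg.2 (hc₀.le.trans hcB)
  have hQ2 : Q ^ 2 ≤ A ^ 2 := pow_le_pow_left₀ hQ (by linarith) 2
  gcongr

/-- Almost minimality under arbitrary bounded perturbations. The perturbed set is first intersected
with `B_R`. If its volume is then too small, a ball of uniformly bounded radius which is, at the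
start, almost contained in the minimizer is filled. -/
lemma exists_perimeter_le (hn : 3 ≤ n) (hA : 0 < A) : ∃ Λ : ℝ, 0 < Λ ∧ ∀ {β K Q R : ℝ}
    {E : Set (Rn n)}, ControlledBy A β K Q → 1 ≤ R → IsMinimizer β K Q R E →
      (∃ u g ρ, IsMinimizingPair β K E u g ρ) ∧ ∀ u g ρ, IsMinimizingPair β K E u g ρ →
        ∀ F : Set (Rn n), NullMeasurableSet F → Bornology.IsBounded F →
          perimeter E ≤ perimeter F + ENNReal.ofReal Λ * volume (symmDiff E F) +
            ENNReal.ofReal (Λ * Q ^ 2) * ∫⁻ y in E \ F, ENNReal.ofReal (‖g y‖ ^ 2) := by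
  obtain ⟨c₀, hc₀, hcap⟩ := exists_le_capacity hn hA
  obtain ⟨D, hD0, hD⟩ := exists_capacity_sub_le
  set κ := volume.real (Metric.ball (0 : Rn n) 1) with hκdef
  have hκ : 0 < κ := volume_real_unitBall_pos
  obtain ⟨s₀, hs₀, hball⟩ := exists_radius_ball_ae_subset n (by omega) (A ^ 3 / c₀ ^ 2)
    (n * κ + A ^ 2 / c₀) (by positivity) (by positivity)
  set C₁ : ℝ := A ^ 2 / c₀ ^ 2 * (A + A * D) + n / s₀ with hC₁
  set C₂ : ℝ := A ^ 2 * (A * κ) ^ 2 / c₀ ^ 2 with hC₂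
  have hC₁0 : 0 ≤ C₁ := by positivity
  have hC₂0 : 0 ≤ C₂ := by positivity
  refine ⟨C₁ + C₂ + 1, by positivity, fun {β K Q R E} hctl hR hmin => ?_⟩
  have hβ := hctl.1
  have hK := hctl.2.1
  have hQ := hctl.2.2.1
  have hK' : 0 < 1 / K := by positivity
  have hAs := hctl.2.2.2
  have hKA : K⁻¹ ≤ A := by
    rw [← one_div]
    linarith
  have hQA : Q ^ 2 ≤ A ^ 2 := pow_le_pow_left₀ hQ (by linarith) 2
  have hc : ∀ E' : Set (Rn n), volume E' = volume (Metric.ball (0 : Rn n) 1) →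
      c₀ ≤ capacity β K E' := fun E' hE' => hcap β K E' hβ hK (by linarith) hE'
  have hEm := hmin.1.1
  have hER := hmin.1.2.1
  have hEv := hmin.1.2.2
  have hEt : volume E ≠ ⊤ := by rw [hEv]; exact measure_ball_lt_top.ne
  have hEr : volume.real E = κ := by simp [Measure.real, hEv, hκdef]
  have hEb : Bornology.IsBounded E := Metric.isBounded_ball.subset hER
  have hm0 : 0 < capacity β K E := hc₀.trans_le (hc E hEv)
  refine ⟨exists_isMinimizingPair hn hβ hK hEm hEt hm0, fun u g ρ h F hFm hFb => ?_⟩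
  obtain ⟨y, hy⟩ := hball E hEm hEb (hmin.perimeter_le hn hctl hR hc₀ hc) hEv fun z r => by
    have := hmin.perimeter_le_of_subset hn hctl hR hc₀ hc (F := E ∪ Metric.ball z r)
      (hEm.union Metric.isOpen_ball.measurableSet.nullMeasurableSet)
      (hEb.union Metric.isBounded_ball) Set.subset_union_left
    rwa [Set.union_sdiff_left] at this
  have hyR := norm_add_le_of_ball_ae_subset (by omega) hER hs₀ hy
  set F₁ := F ∩ Metric.ball 0 R with hF₁
  have hF₁m : NullMeasurableSet F₁ := hFm.inter Metric.isOpen_ball.measurableSet.nullMeasurableSet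
  have hF₁t : volume F₁ ≠ ⊤ := measure_ne_top_of_subset Set.inter_subset_right
    measure_ball_lt_top.ne
  have hEF₁ : E \ F₁ = E \ F := by
    ext x
    simp only [hF₁, Set.mem_sdiff, Set.mem_inter_iff, not_and]
    exact ⟨fun hx => ⟨hx.1, fun hxF => hx.2 hxF (hER hx.1)⟩,
      fun hx => ⟨hx.1, fun hxF => absurd hxF hx.2⟩⟩
  have hSt : volume (symmDiff E F) ≠ ⊤ :=
    measure_ne_top_of_subset (Set.symmDiff_subset_union) (hEb.union hFb).measure_lt_top.ne
  set d := volume.real (symmDiff E F) with hd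
  have hd0 : 0 ≤ d := measureReal_nonneg
  have hEF : volume.real (E \ F) ≤ d := measureReal_mono (fun x hx => Or.inl hx) hSt
  have hFE : volume.real (F₁ \ E) ≤ d :=
    measureReal_mono (fun x hx => Or.inr ⟨hx.1.1, hx.2⟩) hSt
  have hP₁ : perimeter F₁ ≤ perimeter F := perimeter_inter_ball_le hFm hFb (by linarith)
  set I := ∫ x in E \ F, ‖g x‖ ^ 2 with hI
  have hI0 : 0 ≤ I := integral_nonneg fun x => by positivity
  have hgi : Integrable (fun x => ‖g x‖ ^ 2) :=
    (memLp_two_iff_integrable_sq_norm h.1.memD1.gradient_memLp.aestronglyMeasurable).1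
      h.1.memD1.gradient_memLp
  -- the capacity of the perturbed set
  have hcapF : capacity β K E - (A * D * d + A ^ 2 * (A * κ) ^ 2 * I) ≤ capacity β K F₁ := by
    have h1 := hD h hn hβ hK hEm hF₁m hEt hF₁t hm0
    rw [hEF₁] at h1
    have hmA : capacity β K E ≤ A * κ := by
      refine (capacity_le_volume hβ hK).trans ?_
      rw [hEr]
      exact mul_le_mul_of_nonneg_right hKA hκ.le
    have h2 : K⁻¹ * (D * volume.real (E \ F)) ≤ A * D * d := by
      rw [mul_assoc]
      exact mul_le_mul hKA (mul_le_mul_of_nonneg_left hEF hD0) (by positivity) hA.le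
    have h3 : β * (β - 1) * capacity β K E ^ 2 * I ≤ A ^ 2 * (A * κ) ^ 2 * I := by
      refine mul_le_mul_of_nonneg_right (mul_le_mul ?_ (pow_le_pow_left₀ hm0.le hmA 2)
        (by positivity) (by positivity)) hI0
      rw [sq]
      exact mul_le_mul (by linarith) (by linarith) (by linarith) hA.le
    linarith
  -- enlarge the perturbed set inside `B_R` to have at least the volume of the minimizer
  obtain ⟨F₂, hF₂m, hF₂R, hF₁₂, hF₂v, hF₂v', hP₂⟩ : ∃ F₂ : Set (Rn n), NullMeasurableSet F₂ ∧
      F₂ ⊆ Metric.ball 0 R ∧ F₁ ⊆ F₂ ∧ κ ≤ volume.real F₂ ∧ volume.real F₂ - κ ≤ d ∧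
      perimeter F₂ ≤ perimeter F₁ + ENNReal.ofReal (n / s₀ * d) := by
    have e1 := measureReal_inter_add_sdiff₀ (μ := volume) (s := F₁) hEm hF₁t
    have e2 := measureReal_inter_add_sdiff₀ (μ := volume) (s := E) hF₁m hEt
    rw [Set.inter_comm, hEF₁, hEr] at e2
    by_cases hv : κ ≤ volume.real F₁
    · refine ⟨F₁, hF₁m, Set.inter_subset_right, subset_rfl, hv, ?_, le_self_add⟩
      have : volume.real (F₁ ∩ E) ≤ κ := by linarith [measureReal_nonneg (μ := volume) (s := E \ F)]
      linarith
    · obtain ⟨z, r, hr, hzr, hV, hle⟩ := exists_ball_fill (by omega) hF₁m Set.inter_subset_right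
        hs₀ hyR (V := κ) (measureReal_mono (Metric.ball_subset_ball hR) measure_ball_lt_top.ne)
      have hadd : volume.real (F₁ ∪ Metric.ball z r) =
          volume.real F₁ + volume.real (Metric.ball z r \ F₁) := by
        have e3 := measureReal_inter_add_sdiff₀ (μ := volume) (s := F₁ ∪ Metric.ball z r) hF₁m
          (measure_union_ne_top hF₁t measure_ball_lt_top.ne)
        rw [Set.union_inter_cancel_left, Set.union_sdiff_left] at e3
        exact e3.symm
      have hd' : volume.real (Metric.ball z r \ F₁) ≤ d := by
        refine hle.trans (max_le ?_ ?_)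
        · -- the ball `B_{s₀}(y)` is contained in the minimizer up to a null set
          refine le_trans ?_ hEF
          rw [← hEF₁]
          refine ENNReal.toReal_mono (measure_ne_top_of_subset Set.sdiff_subset hEt) ?_
          calc volume (Metric.ball y s₀ \ F₁)
              ≤ volume ((Metric.ball y s₀ \ E) ∪ (E \ F₁)) := measure_mono fun x hx => by
                by_cases hxE : x ∈ E
                · exact Or.inr ⟨hxE, hx.2⟩
                · exact Or.inl ⟨hx.1, hxE⟩
            _ ≤ _ := measure_union_le _ _
            _ = _ := by rw [hy, zero_add]
        · linarith [measureReal_nonneg (μ := volume) (s := F₁ \ E)]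
      refine ⟨F₁ ∪ Metric.ball z r, hF₁m.union Metric.isOpen_ball.measurableSet.nullMeasurableSet,
        Set.union_subset Set.inter_subset_right hzr, Set.subset_union_left, by rwa [hadd],
        by rw [hadd]; linarith, ?_⟩
      refine (perimeter_union_ball_le hF₁m (hs₀.trans_le hr)).trans (add_le_add_right ?_ _)
      rw [← ENNReal.ofReal_toReal (measure_ne_top_of_subset Set.sdiff_subset
        (measure_ball_lt_top (μ := volume) (x := z) (r := r)).ne),
        ← ENNReal.ofReal_mul (div_nonneg (Nat.cast_nonneg n) (hs₀.le.trans hr))]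
      refine ENNReal.ofReal_le_ofReal (mul_le_mul ?_ hd' ENNReal.toReal_nonneg (by positivity))
      exact div_le_div_of_nonneg_left (Nat.cast_nonneg n) hs₀ hr
  have hF₂t : volume F₂ ≠ ⊤ := measure_ne_top_of_subset hF₂R measure_ball_lt_top.ne
  have h1 := hmin.perimeter_le_of_volume_le hn hctl hc₀ hc hF₂m hF₂R hF₂v (by positivity)
    (hcapF.trans (capacity_mono hβ hK hF₂t hF₁₂))
  have h2 : n / s₀ * d + Q ^ 2 / c₀ ^ 2 * (A * (volume.real F₂ - κ) +
      (A * D * d + A ^ 2 * (A * κ) ^ 2 * I)) ≤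
      (C₁ + C₂ + 1) * d + (C₁ + C₂ + 1) * Q ^ 2 * I := by
    have i1 : Q ^ 2 / c₀ ^ 2 * (A * (volume.real F₂ - κ)) ≤ A ^ 2 / c₀ ^ 2 * (A * d) := by
      have : 0 ≤ volume.real F₂ - κ := by linarith
      gcongr
    have i2 : Q ^ 2 / c₀ ^ 2 * (A * D * d) ≤ A ^ 2 / c₀ ^ 2 * (A * D * d) := by gcongr
    have i3 : Q ^ 2 / c₀ ^ 2 * (A ^ 2 * (A * κ) ^ 2 * I) = C₂ * (Q ^ 2 * I) := by
      rw [hC₂]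
      ring
    have i4 : C₁ * d = A ^ 2 / c₀ ^ 2 * (A * d) + A ^ 2 / c₀ ^ 2 * (A * D * d) + n / s₀ * d := by
      rw [hC₁]
      ring
    have i5 : 0 ≤ (C₂ + 1) * d := by positivity
    have i6 : 0 ≤ (C₁ + 1) * (Q ^ 2 * I) := by positivity
    linarith
  rw [← ENNReal.ofReal_toReal hSt, ← ofReal_integral_eq_lintegral_ofReal hgi.integrableOn
    (ae_of_all _ fun x => by positivity), ← ENNReal.ofReal_mul (by positivity),
    ← ENNReal.ofReal_mul (by positivity), add_assoc,
    ← ENNReal.ofReal_add (by positivity) (by positivity)]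
  refine h1.trans ((add_le_add_left hP₂ _).trans ?_)
  rw [add_assoc, ← ENNReal.ofReal_add (by positivity) (mul_nonneg (by positivity)
    (add_nonneg (mul_nonneg hA.le (by linarith)) (by positivity)))]
  exact add_le_add hP₁ (ENNReal.ofReal_le_ofReal h2)

end AlmostMinimality

end ChargedDroplet

theorem mainTheorem7 (n : ℕ) (hn : 3 ≤ n) (A : ℝ) (hA : 0 < A) :
    ∃ Λ₂ r₂ : ℝ, 0 < Λ₂ ∧ 0 < r₂ ∧
      ∀ β K Q R : ℝ, ChargedDroplet.ControlledBy A β K Q → 1 ≤ R →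
      ∀ E : Set (ChargedDroplet.Rn n), ChargedDroplet.IsMinimizer β K Q R E →
        -- the minimizing pair `(u_E, ρ_E)` exists, with `g = ∇u_E`
        (∃ u g ρ, ChargedDroplet.IsMinimizingPair β K E u g ρ) ∧
        -- (i) inner perturbations
        (∀ u g ρ, ChargedDroplet.IsMinimizingPair β K E u g ρ →
          ∀ (F : Set (ChargedDroplet.Rn n)) (x : ChargedDroplet.Rn n) (r : ℝ),
            ChargedDroplet.IsFinitePerimeter F → F ⊆ E → r ≤ r₂ → E \ F ⊆ Metric.ball x r →
            ChargedDroplet.perimeter E ≤ ChargedDroplet.perimeter F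
              + ENNReal.ofReal Λ₂ * volume (E \ F)
              + ENNReal.ofReal (Λ₂ * Q ^ 2) * ∫⁻ y in E \ F, ENNReal.ofReal (‖g y‖ ^ 2)) ∧
        -- (ii) outer perturbations, not necessarily contained in `B_R`
        (∀ (F : Set (ChargedDroplet.Rn n)) (x : ChargedDroplet.Rn n) (r : ℝ),
            ChargedDroplet.IsFinitePerimeter F → E ⊆ F → r ≤ r₂ → F \ E ⊆ Metric.ball x r →
            ChargedDroplet.perimeter E ≤ ChargedDroplet.perimeter F
              + ENNReal.ofReal Λ₂ * volume (F \ E)) ∧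
        -- in particular, two-sided perturbations
        (∀ u g ρ, ChargedDroplet.IsMinimizingPair β K E u g ρ →
          ∀ (F : Set (ChargedDroplet.Rn n)) (x : ChargedDroplet.Rn n) (r : ℝ),
            ChargedDroplet.IsFinitePerimeter F → r ≤ r₂ → symmDiff E F ⊆ Metric.ball x r →
            ChargedDroplet.perimeter E ≤ ChargedDroplet.perimeter F
              + ENNReal.ofReal Λ₂ * volume (symmDiff E F)
              + ENNReal.ofReal (Λ₂ * Q ^ 2) *
                ∫⁻ y in symmDiff E F, ENNReal.ofReal (‖g y‖ ^ 2)) := by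
  obtain ⟨Λ, hΛ, h⟩ := ChargedDroplet.exists_perimeter_le hn hA
  refine ⟨Λ, 1, hΛ, one_pos, fun β K Q R hctl hR E hmin => ?_⟩
  obtain ⟨hex, hall⟩ := h hctl hR hmin
  have hb : ∀ (F : Set (ChargedDroplet.Rn n)) (x : ChargedDroplet.Rn n) (r : ℝ),
      F \ E ⊆ Metric.ball x r → Bornology.IsBounded F := fun F x r hF =>
    ((Metric.isBounded_ball.subset hmin.1.2.1).union Metric.isBounded_ball).subset fun y hy => by
      by_cases hyE : y ∈ E
      · exact Or.inl hyE
      · exact Or.inr (hF ⟨hy, hyE⟩)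
  refine ⟨hex, fun u g ρ hp F x r hF hFE _ _ => ?_, fun F x r hF hEF _ hFx => ?_,
    fun u g ρ hp F x r hF _ hFx => ?_⟩
  · have := hall u g ρ hp F hF.1 ((Metric.isBounded_ball.subset hmin.1.2.1).subset hFE)
    rwa [symmDiff_of_ge hFE] at this
  · obtain ⟨u, g, ρ, hp⟩ := hex
    have := hall u g ρ hp F hF.1 (hb F x r hFx)
    rwa [symmDiff_of_le hEF, Set.sdiff_eq_empty.2 hEF, Measure.restrict_empty,
      lintegral_zero_measure, mul_zero, add_zero] at this
  · refine (hall u g ρ hp F hF.1 (hb F x r fun y hy => hFx (Or.inr hy))).trans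
      (add_le_add_right (mul_le_mul_right (lintegral_mono_set fun y hy => Or.inl hy) _) _)
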